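/- **Setting: the base.** Let $(\zeta_n)_{n\ge 0}$ be a stationary process on a probability space $(\Omega_0,\mathcal F_0,P_0)$ with values in a metric space $(\mathcal Y,d_0)$ of diameter at most $1$, and suppose it is stretched-exponentially $\alpha$-mixing: there are $a,b,c>0$ such that $|P_0(A\cap B)-P_0(A)P_0(B)|\le a e^{-bn^c}$ for all $n,k\ge1$, $A\in\sigma\{\zeta_1,\dots,\zeta_k\}$, $B\in\sigma\{\zeta_i:i\ge k+n\}$. Let $\Omega=\mathcal Y^{\mathbb Z}$ with the product $\sigma$-algebra, let $\theta$ be the two-sided shift, and let $P$ be the probability measure on $\Omega$ with $P\{y: y_i\in A_i,\ |i|\le N\}=P_0(\zeta_i\in A_{i-N},\ 0\le i\le 2N)$ for all $N$ and all Borel sets $A_i$. Put $d(a,b)=\sum_{n\in\mathbb Z}2^{-|n|}d_0(a_n,b_n)$ on $\Omega$. **Setting: the fibers.** Let $(\mathcal X,\rho)$ be a compact metric space, $\alpha\in(0,1]$, $\xi>0$, and for $g$ on $\mathcal X$ let $\|g\|_{\alpha,\xi}=\sup|g|+v_{\alpha,\xi}(g)$, where $v_{\alpha,\xi}(g)=\inf\{R:|g(x)-g(x')|\le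 R\rho(x,x')^\alpha\text{ if }\rho(x,x')<\xi\}$. Let $T_\omega:\mathcal X\to\mathcal X$ $(\omega\in\Omega)$ be continuous surjections and $\phi_\omega,u_\omega:\mathcal X\to\mathbb R$ functions, all jointly measurable in $(\omega,x)$. Write $T_\omega^n=T_{\theta^{n-1}\omega}\circ\cdots\circ T_\omega$ and $\mathcal L_z^\omega g(x)=\sum_{T_\omega y=x}e^{\phi_\omega(y)+zu_\omega(y)}g(y)$ for $z\in\mathbb C$. Assume that there are constants $n_0,D\in\mathbb N$, $\gamma>1$ and $C<\infty$ such that $P$-a.s.: $T_\omega^{n_0}(B(x,\xi))=\mathcal X$ for all $x$; whenever $\rho(x,x')<\xi$ one can write $T_\omega^{-1}\{x\}=\{y_1,\dots,y_k\}$ and $T_\omega^{-1}\{x'\}=\{y'_1,\dots,y'_k\}$ (without repetitions) with $k\le D$ and $\rho(y_i,y_i')\le\gamma^{-1}\rho(x,x')$; and $\|\phi_\omega\|_{\alpha,\xi},\|u_\omega\|_{\alpha,\xi}\le C$. Assume also that $(\omega,x)\mapsto\mathcal L_z^\omega g_\omega(x)$ is measurable for every $z$ and every measurable $g:\Omega\times\mathcal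 X\to\mathbb C$. Let $(\lambda_\omega,h_\omega,\nu_\omega)$ be the random Ruelle-Perron-Frobenius triplet of $\mathcal L_0^\omega$, i.e. they depend measurably on $\omega$ and $P$-a.s. $\lambda_\omega>0$, $h_\omega>0$ with $\|h_\omega\|_{\alpha,\xi}$ bounded uniformly in $\omega$, $\nu_\omega$ is a Borel probability measure, $\mathcal L_0^\omega h_\omega=\lambda_\omega h_{\theta\omega}$, $\nu_{\theta\omega}(\mathcal L_0^\omega g)=\lambda_\omega\nu_\omega(g)$ for bounded Borel $g$, and $\nu_\omega(h_\omega)=1$. Let $\mu_\omega=h_\omega\nu_\omega$ be the Gibbs measures. Assume that there are a Borel measure $\mu$ on $\mathcal X$ and functions $r_\omega$ with $\mu_\omega=r_\omega\mu$ $P$-a.s., where the $r_\omega$ take values in a fixed interval $(m,M)$ with $0<m<M<\infty$ and $\|r_\omega\|_{\alpha,\xi}$ is bounded uniformly in $\omega$. Put $\bar u_\omega=u_\omega-\mu_\omega(u_\omega)$, $S_k^\omega\bar u=\sum_{j=0}^{k-1}\bar u_{\theta^j\omega}\circ T_\omega^j$ and $\tilde V_k(\omega)=\int(S_k^\omega\bar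 u)^2\,d\mu$. For $\beta>0$, condition (Poly $V_k$) with exponent $\beta$ says: for every $k\ge1$ the function $\tilde V_k$ is $P$-integrable, and for every $\varepsilon>0$ there is a constant $d(k,\varepsilon)$ such that for all $n\ge1$ $$P\Big\{\omega:\Big|\sum_{j=0}^{n-1}\tilde V_k(\theta^{jk}\omega)-n\int\tilde V_k\,dP\Big|\ge\varepsilon n\Big\}\le\frac{d(k,\varepsilon)}{n^\beta}.$$ **Proposition.** (i) Suppose that $\omega\mapsto u_\omega$ and $\omega\mapsto T_\omega$ are Hölder continuous on $(\Omega,d)$ with respect to the norm $\|\cdot\|_{\alpha,\xi}$ and the metric $\sup_{x}\rho(T_\omega x,T_{\omega'}x)$, respectively. Then (Poly $V_k$) holds with every $\beta>0$. Moreover, every $\tilde V_k$, $k\ge1$, is Hölder continuous on $(\Omega,d)$ (that is, $P$-a.s. equal to a Hölder continuous function) provided that the maps $T_\omega:\mathcal X\to\mathcal X$ are Lipschitz uniformly in $\omega$, or that they are Hölder continuous uniformly in $\omega$ (with a common exponent and constant) and $\omega\mapsto\mu_\omega(u_\omega)$ is $P$-a.s. equal to a Hölder continuous function (for example, to a constant).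 (ii) Let $\mathcal J\subset\mathbb Z$ be finite and suppose that $u_\omega$ and $T_\omega$ depend only on the coordinates $\omega_j$, $j\in\mathcal J$ (no continuity in $\omega$ is required). Then (Poly $V_k$) holds with every $\beta>0$. -/

import Mathlib

open MeasureTheory ProbabilityTheory Filter
open scoped ENNReal NNReal Topology

noncomputable section

namespace RandomSkew

/-! ### The norm `‖·‖_{α,ξ}` -/

section HolderNorm

variable {X E : Type*} [MetricSpace X] [NormedAddCommGroup E]

/-- `v_{α,ξ}(g)`: the infimum of all `R` with `|g x - g x'| ≤ R ρ(x,x')^α` whenever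
`ρ(x,x') < ξ`; it is `∞` if there is no such `R`. -/
def holderVar (α ξ : ℝ) (g : X → E) : ℝ≥0∞ :=
  ⨅ (R : ℝ≥0) (_ : ∀ x x' : X, dist x x' < ξ → ‖g x - g x'‖ ≤ R * dist x x' ^ α), (R : ℝ≥0∞)

/-- `‖g‖_{α,ξ} = ‖g‖_∞ + v_{α,ξ}(g)`, with values in `[0,∞]`. -/
def holderNorm (α ξ : ℝ) (g : X → E) : ℝ≥0∞ :=
  (⨆ x, ‖g x‖ₑ) + holderVar α ξ g

end HolderNorm

/-! ### Random maps over a base map `θ`, transfer operators, Gibbs measures -/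

section System

variable {Ω X : Type*}

/-- `T_ω^n = T_{θ^{n-1} ω} ∘ ⋯ ∘ T_{θ ω} ∘ T_ω`. -/
def fiberIter (θ : Ω → Ω) (T : Ω → X → X) : ℕ → Ω → X → X
  | 0, _ => id
  | n + 1, ω => T (θ^[n] ω) ∘ fiberIter θ T n ω

/-- `L_z^ω g (x) = ∑_{y ∈ T_ω⁻¹{x}} exp (φ_ω(y) + z u_ω(y)) g(y)`. -/
def transferOp (T : Ω → X → X) (φ u : Ω → X → ℝ) (z : ℂ) (ω : Ω) (g : X → ℂ) (x : X) : ℂ :=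
  ∑ᶠ (y : X) (_ : T ω y = x), Complex.exp ((φ ω y : ℂ) + z * (u ω y : ℂ)) * g y

variable [MeasurableSpace Ω] [MetricSpace X] [MeasurableSpace X]

/-- The standing assumptions on the random maps `T_ω` and the random functions `φ_ω`, `u_ω`:
measurability, topological exactness and the pairing property with constants that are uniform
in `ω`, bounded norms, and measurability of the transfer operators. Since the maps are onto,
bounded random variables `n_ω`, `D_ω` and a random variable `γ_ω` with `γ_ω - 1` bounded away from
`0` may be replaced by constants. -/
structure IsExpandingSystem (P : Measure Ω) (θ : Ω → Ω) (T : Ω → X → X) (φ u : Ω → X → ℝ)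
    (α ξ : ℝ) : Prop where
  alpha_pos : 0 < α
  alpha_le_one : α ≤ 1
  xi_pos : 0 < ξ
  measurable_map : Measurable fun p : Ω × X => T p.1 p.2
  continuous_map : ∀ ω, Continuous (T ω)
  surjective_map : ∀ ω, Function.Surjective (T ω)
  measurable_phi : Measurable fun p : Ω × X => φ p.1 p.2
  measurable_u : Measurable fun p : Ω × X => u p.1 p.2
  exact : ∃ n₀ : ℕ, ∀ᵐ ω ∂P, ∀ x : X, fiberIter θ T n₀ ω '' Metric.ball x ξ = Set.univ
  pairing : ∃ (D : ℕ) (γ : ℝ), 1 < γ ∧ ∀ᵐ ω ∂P, ∀ x x' : X, dist x x' < ξ →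
    ∃ (k : ℕ) (y y' : Fin k → X), k ≤ D ∧ Function.Injective y ∧ Function.Injective y' ∧
      Set.range y = T ω ⁻¹' {x} ∧ Set.range y' = T ω ⁻¹' {x'} ∧
      ∀ i, dist (y i) (y' i) ≤ γ⁻¹ * dist x x'
  bounded_phi : ∃ C : ℝ≥0, ∀ᵐ ω ∂P, holderNorm α ξ (φ ω) ≤ C
  bounded_u : ∃ C : ℝ≥0, ∀ᵐ ω ∂P, holderNorm α ξ (u ω) ≤ C
  measurable_transferOp : ∀ (z : ℂ) (g : Ω × X → ℂ), Measurable g →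
    Measurable fun p : Ω × X => transferOp T φ u z p.1 (fun x => g (p.1, x)) p.2

/-- `(λ_ω, h_ω, ν_ω)` is the (random, uniformly bounded) Ruelle-Perron-Frobenius triplet of the
transfer operators `L_0^ω`: `L_0^ω h_ω = λ_ω h_{θω}`, `(L_0^ω)^* ν_{θω} = λ_ω ν_ω`,
`ν_ω(h_ω) = ν_ω(1) = 1`. -/
structure IsRPFTriplet (P : Measure Ω) (θ : Ω → Ω) (T : Ω → X → X) (φ u : Ω → X → ℝ)
    (α ξ : ℝ) (lam : Ω → ℝ) (h : Ω → X → ℝ) (ν : Ω → Measure X) : Prop where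
  measurable_lam : Measurable lam
  measurable_h : Measurable fun p : Ω × X => h p.1 p.2
  measurable_nu : Measurable ν
  lam_pos : ∀ᵐ ω ∂P, 0 < lam ω
  h_pos : ∀ᵐ ω ∂P, ∀ x, 0 < h ω x
  h_bounded : ∃ C : ℝ≥0, ∀ᵐ ω ∂P, holderNorm α ξ (h ω) ≤ C
  nu_prob : ∀ᵐ ω ∂P, IsProbabilityMeasure (ν ω)
  h_eq : ∀ᵐ ω ∂P, ∀ x,
    transferOp T φ u 0 ω (fun y => (h ω y : ℂ)) x = (lam ω : ℂ) * (h (θ ω) x : ℂ)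
  nu_eq : ∀ᵐ ω ∂P, ∀ g : X → ℂ, Measurable g → (∃ C : ℝ, ∀ x, ‖g x‖ ≤ C) →
    ∫ x, transferOp T φ u 0 ω g x ∂(ν (θ ω)) = (lam ω : ℂ) * ∫ x, g x ∂(ν ω)
  nu_h : ∀ᵐ ω ∂P, ∫ x, h ω x ∂(ν ω) = 1

/-- The Gibbs measure `μ_ω = h_ω ν_ω`. -/
def gibbs (h : Ω → X → ℝ) (ν : Ω → Measure X) (ω : Ω) : Measure X :=
  (ν ω).withDensity fun x => ENNReal.ofReal (h ω x)

/-- The Gibbs measures have the form `μ_ω = r_ω μ` with a measure `μ` that does not depend on `ω`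
and functions `r_ω` with values in a finite interval `(m, M) ⊂ (0, ∞)`, uniformly
bounded in `‖·‖_{α,ξ}`. -/
def HasCommonReference (P : Measure Ω) (α ξ : ℝ) (h : Ω → X → ℝ) (ν : Ω → Measure X)
    (μ : Measure X) : Prop :=
  ∃ (r : Ω → X → ℝ) (m M : ℝ) (C : ℝ≥0), 0 < m ∧ ∀ᵐ ω ∂P,
    Measurable (r ω) ∧ (∀ x, r ω x ∈ Set.Ioo m M) ∧ holderNorm α ξ (r ω) ≤ C ∧
      gibbs h ν ω = μ.withDensity fun x => ENNReal.ofReal (r ω x)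

/-- `μ_ω(u_ω)`. -/
def gibbsMean (u : Ω → X → ℝ) (h : Ω → X → ℝ) (ν : Ω → Measure X) (ω : Ω) : ℝ :=
  ∫ x, u ω x ∂(gibbs h ν ω)

/-- `S_k^ω ū = ∑_{j<k} ū_{θ^j ω} ∘ T_ω^j`, where `ū_ω = u_ω - μ_ω(u_ω)`. -/
def centeredSum (θ : Ω → Ω) (T : Ω → X → X) (u : Ω → X → ℝ) (h : Ω → X → ℝ)
    (ν : Ω → Measure X) (k : ℕ) (ω : Ω) (x : X) : ℝ :=
  ∑ j ∈ Finset.range k, (u (θ^[j] ω) (fiberIter θ T j ω x) - gibbsMean u h ν (θ^[j] ω))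

/-- `Ṽ_k(ω) = E_μ (S_k^ω ū)²`. -/
def tildeV (θ : Ω → Ω) (T : Ω → X → X) (u : Ω → X → ℝ) (h : Ω → X → ℝ)
    (ν : Ω → Measure X) (μ : Measure X) (k : ℕ) (ω : Ω) : ℝ :=
  ∫ x, centeredSum θ T u h ν k ω x ^ 2 ∂μ

/-- The polynomial concentration inequality with exponent `β` for the averages of `V`
along `ω, θ^k ω, θ^{2k} ω, …`. -/
def PolyConcentration (P : Measure Ω) (θ : Ω → Ω) (V : Ω → ℝ) (k : ℕ) (β : ℝ) : Prop :=
  Integrable V P ∧ ∀ ε : ℝ, 0 < ε → ∃ d : ℝ, ∀ n : ℕ, 1 ≤ n →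
    P {ω | ε * n ≤ |∑ j ∈ Finset.range n, V (θ^[j * k] ω) - n * ∫ ω', V ω' ∂P|}
      ≤ ENNReal.ofReal (d / (n : ℝ) ^ β)

/-- The maps `T_ω : X → X` are Hölder continuous with exponent `s`, uniformly in `ω`. -/
def UniformlyHolderMaps (T : Ω → X → X) (s : ℝ) : Prop :=
  ∃ C : ℝ, ∀ ω x x', dist (T ω x) (T ω x') ≤ C * dist x x' ^ s

end System

/-! ### The two-sided shift of a stationary process -/

section Shift

variable {Y : Type*}

/-- The two-sided shift. -/
def shift (ω : ℤ → Y) : ℤ → Y := fun n => ω (n + 1)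

/-- `d(a,b) = ∑_{n ∈ ℤ} 2^{-|n|} d₀(a_n,b_n)`. -/
def seqDist [MetricSpace Y] (a b : ℤ → Y) : ℝ :=
  ∑' n : ℤ, (2 : ℝ)⁻¹ ^ n.natAbs * dist (a n) (b n)

/-- Hölder continuity, with respect to `seqDist`, of a family indexed by `ω ∈ Y^ℤ`, where `D ω ω'`
is the distance of the members of the family with indexes `ω` and `ω'`. -/
def IsHolderFamily [MetricSpace Y] (D : (ℤ → Y) → (ℤ → Y) → ℝ≥0∞) : Prop :=
  ∃ C κ : ℝ, 0 < κ ∧ κ ≤ 1 ∧ ∀ ω ω', D ω ω' ≤ ENNReal.ofReal (C * seqDist ω ω' ^ κ)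

/-- `V : Y^ℤ → ℝ`, which is only determined up to `P`-null sets, is Hölder continuous: it is
`P`-a.s. equal to a Hölder continuous function. -/
def IsHolderAE [MetricSpace Y] [MeasurableSpace Y] (P : Measure (ℤ → Y)) (V : (ℤ → Y) → ℝ) :
    Prop :=
  ∃ W : (ℤ → Y) → ℝ, IsHolderFamily (fun ω ω' => edist (W ω) (W ω')) ∧ V =ᵐ[P] W

variable {Ω₀ : Type*} [MeasurableSpace Ω₀] [MeasurableSpace Y]

/-- `ζ_0, ζ_1, …` is a stationary process. -/
def IsStationarySeq (P₀ : Measure Ω₀) (ζ : ℕ → Ω₀ → Y) : Prop :=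
  (∀ n, Measurable (ζ n)) ∧
    P₀.map (fun w n => ζ (n + 1) w) = P₀.map (fun w n => ζ n w)

/-- `P` is the law on `Y^ℤ` of the two-sided extension of the process `ζ`. -/
def IsTwoSidedLaw (P₀ : Measure Ω₀) (ζ : ℕ → Ω₀ → Y) (P : Measure (ℤ → Y)) : Prop :=
  ∀ (N : ℕ) (A : ℤ → Set Y), (∀ i, MeasurableSet (A i)) →
    P {y | ∀ i : ℤ, |i| ≤ N → y i ∈ A i} =
      P₀ {w | ∀ i : ℕ, i ≤ 2 * N → ζ i w ∈ A ((i : ℤ) - N)}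

/-- Stretched exponential `α`-mixing. -/
def IsStretchedExpMixing (P₀ : Measure Ω₀) (ζ : ℕ → Ω₀ → Y) : Prop :=
  ∃ a b c : ℝ, 0 < a ∧ 0 < b ∧ 0 < c ∧ ∀ n k : ℕ, 1 ≤ n → 1 ≤ k → ∀ A B : Set Ω₀,
    MeasurableSet[⨆ i ∈ Set.Icc 1 k, MeasurableSpace.comap (ζ i) inferInstance] A →
    MeasurableSet[⨆ i ∈ Set.Ici (k + n), MeasurableSpace.comap (ζ i) inferInstance] B →
    |P₀.real (A ∩ B) - P₀.real A * P₀.real B| ≤ a * Real.exp (-b * (n : ℝ) ^ c)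

end Shift

end RandomSkew

end

/-! Two independent facts give the proposition: averages of a bounded function of finitely many
coordinates concentrate faster than any power of `n`, and `tildeV` is, almost surely and uniformly,
approximable by such functions. Concentration survives uniform approximation, so every `β` is
reached.

Concentration. Keep only every `l`-th term of a bounded centred sequence. By the covariance
inequality its exponential moments nearly factorize, Hoeffding's lemma bounds each factor, and
Chernoff's bound leaves an error of order `q * exp (const * q) * ρ l` for `q` about `n / l`. With
`l` about `n ^ (1 - δ)` and `δ` small compared with the mixing exponent, `ρ l` beats the
exponential; summing over the residues mod `l` loses only a factor `l`
(`IsMixingSeq.exists_measure_abs_sum_ge_le`). A function of the coordinates `|i| ≤ N`, read along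
the orbit, is such a sequence (`exists_measure_abs_birkhoff_sub_ge_le`).

Dependence of `tildeV` on `ω`. The objects `φ`, `lam`, `h`, `ν` and `r` come with no continuity in
`ω`, so they may enter only through uniform constants, and only `T` and `u` can be compared at
different points. Two devices make this possible.

The first removes the Gibbs measures. The transfer operator normalized by `h` is an averaging
operator with weights bounded below; exactness and the Lasota-Yorke inequality make it contract
oscillations exponentially (`exists_oscLE_decay`). Applied to `1 / r`, the density of `μ` with
respect to the Gibbs measure, this shows that the image of `μ` under `n` fibre maps started at time
`-n` is exponentially close to `μ(X)` times the Gibbs measure at time `0` (`exists_gibbs_approx`).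
Hence `gibbsMean` is determined, up to `τ ^ n`, by `T` and `u` on a finite stretch of the orbit.

The second replaces one fibre map by a nearby one inside an integral `∫ f * G ∘ T dμ` with `f`
Hölder and `G` merely bounded (`abs_integral_comp_sub_le`). Composition with `T` has a dual operator
on Hölder functions; let `F` be the difference of the duals of `f` for the two maps. Then `∫ F ^ 2 =
∫ f * (F ∘ T - F ∘ T')`, which is small because `F` is Hölder. So `F` is small in `L²`, and `∫ F *
G` is small for every bounded `G`. Iterating this along sums and squares of sums gives
`exists_tildeV_sub_le`: if `T` and `u` are `e`-close at times `-n, …, k`, the values of `tildeV`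
differ by at most `C * (τ ^ n + K ^ n * (e + e ^ (α / 2)))`.

Conclusion. In the Hölder case `e` is a power of the distance times `2 ^ (n + k)`, and balancing `n`
against the distance gives a Hölder bound on the full-measure set of typical points, extended by
McShane's formula. For concentration, truncating far coordinates changes `T` and `u` little (or not
at all, in the finitely dependent case), and separability of spaces of continuous maps supplies a
measurable approximating function of the truncated sequence (`hasLocalApprox_tildeV`). -/

namespace RandomSkew

/-! ### Concentration for bounded mixing sequences -/

section Mixing

variable {S : Type*} [MeasurableSpace S]

theorem integrableOn_measureReal_le (Q : Measure S) [IsFiniteMeasure Q] (f : S → ℝ) (a : ℝ) :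
    IntegrableOn (fun s => Q.real {x | s ≤ f x}) (Set.Ioc 0 a) := by
  have hanti : Antitone fun s => Q.real {x | s ≤ f x} := fun s t hst =>
    measureReal_mono fun x hx => le_trans hst hx
  refine Measure.integrableOn_of_bounded (M := Q.real Set.univ) (by simp)
    hanti.measurable.aestronglyMeasurable (Eventually.of_forall fun s => ?_)
  rw [Real.norm_eq_abs, abs_of_nonneg measureReal_nonneg]
  exact measureReal_mono (Set.subset_univ _)

/-- Two finite measures that are close, up to a factor, on the superlevel sets of a bounded
function have close integrals of that function. -/
theorem abs_integral_sub_mul_integral_le (Q Q' : Measure S) [IsFiniteMeasure Q] [IsFiniteMeasure Q']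
    {f : S → ℝ} (hf : Measurable f) {a c ε : ℝ} (hf0 : ∀ x, 0 ≤ f x) (hfa : ∀ x, f x ≤ a)
    (ha : 0 ≤ a)
    (h : ∀ s, |Q.real {x | s ≤ f x} - c * Q'.real {x | s ≤ f x}| ≤ ε) :
    |(∫ x, f x ∂Q) - c * (∫ x, f x ∂Q')| ≤ a * ε := by
  have hint : ∀ (Q : Measure S) [IsFiniteMeasure Q], Integrable f Q := fun _ _ =>
    Integrable.of_mem_Icc 0 a hf.aemeasurable (Eventually.of_forall fun x => ⟨hf0 x, hfa x⟩)
  -- Layer cake for both integrals: what remains is a difference of tails, at most `ε` pointwise,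
  -- over an interval of length `a`.
  rw [(hint Q).integral_eq_integral_Ioc_meas_le (Eventually.of_forall hf0)
      (Eventually.of_forall hfa),
    (hint Q').integral_eq_integral_Ioc_meas_le (Eventually.of_forall hf0)
      (Eventually.of_forall hfa), ← integral_const_mul,
    ← integral_sub (integrableOn_measureReal_le Q f a)
      ((integrableOn_measureReal_le Q' f a).const_mul c)]
  have := norm_setIntegral_le_of_norm_le_const (μ := volume) (s := Set.Ioc 0 a) (C := ε)
    (f := fun s => Q.real {x | s ≤ f x} - c * Q'.real {x | s ≤ f x}) (by simp)
    (fun s _ => h s)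
  rw [Real.norm_eq_abs] at this
  refine this.trans (le_of_eq ?_)
  simp [measureReal_def, ENNReal.toReal_ofReal ha, mul_comm]

/-- The covariance inequality for bounded nonnegative functions. -/
theorem abs_integral_mul_sub_le (P : Measure S) [IsProbabilityMeasure P] {f g : S → ℝ}
    (hf : Measurable f) (hg : Measurable g) {a b ε : ℝ} (ha : 0 ≤ a) (hb : 0 ≤ b)
    (hf0 : ∀ x, 0 ≤ f x) (hfa : ∀ x, f x ≤ a) (hg0 : ∀ x, 0 ≤ g x) (hgb : ∀ x, g x ≤ b)
    (h : ∀ s t, |P.real ({x | s ≤ f x} ∩ {x | t ≤ g x})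
      - P.real {x | s ≤ f x} * P.real {x | t ≤ g x}| ≤ ε) :
    |(∫ x, f x * g x ∂P) - (∫ x, f x ∂P) * (∫ x, g x ∂P)| ≤ a * (b * ε) := by
  have hgi : Integrable g P :=
    Integrable.of_mem_Icc 0 b hg.aemeasurable (Eventually.of_forall fun x => ⟨hg0 x, hgb x⟩)
  have hset : ∀ s, |(∫ x in {x | s ≤ f x}, g x ∂P) - P.real {x | s ≤ f x} * (∫ x, g x ∂P)|
      ≤ b * ε := fun s => by
    have hms : MeasurableSet {x | s ≤ f x} := measurableSet_le measurable_const hf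
    refine abs_integral_sub_mul_integral_le (P.restrict {x | s ≤ f x}) P hg hg0 hgb hb fun t => ?_
    rw [measureReal_restrict_apply (measurableSet_le measurable_const hg), Set.inter_comm]
    exact h s t
  -- The density `g` is absorbed into the measure, so that the layer-cake comparison can be used a
  -- second time, now in `f`.
  let Q := P.withDensity fun x => ENNReal.ofReal (g x)
  have hQf : IsFiniteMeasure Q := isFiniteMeasure_withDensity_ofReal hgi.2
  have hQs : ∀ s, Q.real {x | s ≤ f x} = ∫ x in {x | s ≤ f x}, g x ∂P := fun s => by
    have hms : MeasurableSet {x | s ≤ f x} := measurableSet_le measurable_const hf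
    rw [measureReal_def, withDensity_apply _ hms,
      integral_eq_lintegral_of_nonneg_ae (Eventually.of_forall hg0) hg.aestronglyMeasurable]
  have hQi : ∫ x, f x ∂Q = ∫ x, f x * g x ∂P := by
    rw [integral_withDensity_eq_integral_toReal_smul hg.ennreal_ofReal
      (Eventually.of_forall fun x => ENNReal.ofReal_lt_top)]
    refine integral_congr_ae (Eventually.of_forall fun x => ?_)
    simp [ENNReal.toReal_ofReal (hg0 x), mul_comm]
  rw [← hQi, mul_comm (∫ x, f x ∂P)]
  refine abs_integral_sub_mul_integral_le Q P hf hf0 hfa ha fun s => ?_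
  rw [hQs, mul_comm]
  exact hset s

/-- Past events `ℱ p` and events of the single variable `Y (p + l)` are `ρ l`-mixing. -/
structure IsMixingSeq (P : Measure S) (ℱ : ℕ → MeasurableSpace S) (Y : ℕ → S → ℝ) (ρ : ℕ → ℝ) :
    Prop where
  measurable : ∀ j, Measurable (Y j)
  adapted : ∀ p, ∀ i ≤ p, Measurable[ℱ p] (Y i)
  mixing : ∀ p l, 1 ≤ l → ∀ A, MeasurableSet[ℱ p] A → ∀ B : Set ℝ, MeasurableSet B →
    |P.real (A ∩ Y (p + l) ⁻¹' B) - P.real A * P.real (Y (p + l) ⁻¹' B)| ≤ ρ l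

variable {P : Measure S} {ℱ : ℕ → MeasurableSpace S} {Y : ℕ → S → ℝ}
  {ρ : ℕ → ℝ}

theorem IsMixingSeq.neg (h : IsMixingSeq P ℱ Y ρ) : IsMixingSeq P ℱ (fun j x => - Y j x) ρ where
  measurable j := (h.measurable j).neg
  adapted p i hi := (h.adapted p i hi).neg
  mixing p l hl A hA B hB := by
    have := h.mixing p l hl A hA (Neg.neg ⁻¹' B) (measurable_neg hB)
    exact this

variable [IsProbabilityMeasure P]

/-- Exponential moments of an `l`-spaced subsequence. -/
theorem IsMixingSeq.integral_exp_sum_le (h : IsMixingSeq P ℱ Y ρ) {B t : ℝ} (hB : 0 ≤ B)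
    (ht : 0 ≤ t) (hYB : ∀ j x, |Y j x| ≤ B) (hY0 : ∀ j, ∫ x, Y j x ∂P = 0) (r : ℕ) {l : ℕ}
    (hl : 1 ≤ l) (q : ℕ) :
    ∫ x, Real.exp (t * ∑ i ∈ Finset.range q, Y (r + i * l) x) ∂P ≤
      Real.exp (B ^ 2 * t ^ 2 / 2) ^ q + q * (Real.exp (t * B) ^ q * ρ l) := by
  have hρ : 0 ≤ ρ l :=
    (abs_nonneg _).trans (h.mixing 0 l hl ∅ (@MeasurableSet.empty _ (ℱ 0)) ∅ .empty)
  have hK : 1 ≤ Real.exp (t * B) := Real.one_le_exp (mul_nonneg ht hB)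
  have hK' : Real.exp (B ^ 2 * t ^ 2 / 2) ≥ 0 := (Real.exp_pos _).le
  -- Hoeffding's lemma on `[-B, B]`, whose variance proxy is `B ^ 2`.
  have hmgf : ∀ j, ∫ x, Real.exp (t * Y j x) ∂P ≤ Real.exp (B ^ 2 * t ^ 2 / 2) := fun j => by
    have := (hasSubgaussianMGF_of_mem_Icc_of_integral_eq_zero (μ := P) (a := -B) (b := B)
      (h.measurable j).aemeasurable
      (Eventually.of_forall fun x => abs_le.1 (hYB j x)) (hY0 j)).mgf_le t
    rw [mgf] at this
    refine this.trans (le_of_eq ?_)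
    congr 2
    simp only [NNReal.coe_pow, NNReal.coe_div, coe_nnnorm, NNReal.coe_ofNat, Real.norm_eq_abs]
    rw [sub_neg_eq_add, abs_of_nonneg (by linarith)]
    ring
  have hle : ∀ j x, Real.exp (t * Y j x) ≤ Real.exp (t * B) := fun j x =>
    Real.exp_le_exp.2 (mul_le_mul_of_nonneg_left ((le_abs_self _).trans (hYB j x)) ht)
  have hmK : ∀ j, ∫ x, Real.exp (t * Y j x) ∂P ≤ Real.exp (t * B) := fun j => by
    have := integral_mono_of_nonneg (μ := P) (Eventually.of_forall fun x => (Real.exp_pos _).le)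
      (integrable_const (Real.exp (t * B))) (Eventually.of_forall fun x => hle j x)
    simpa using this
  induction q with
  | zero => simp
  | succ q ih =>
    have hsum : ∀ x, Real.exp (t * ∑ i ∈ Finset.range q, Y (r + i * l) x)
        ≤ Real.exp (t * B) ^ q := fun x => by
      rw [← Real.exp_nat_mul]
      refine Real.exp_le_exp.2 ?_
      rw [mul_left_comm]
      refine mul_le_mul_of_nonneg_left ?_ ht
      refine (Finset.sum_le_sum fun i _ => (le_abs_self _).trans (hYB (r + i * l) x)).trans ?_
      simp
    have hstep : |∫ x, Real.exp (t * ∑ i ∈ Finset.range q, Y (r + i * l) x)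
          * Real.exp (t * Y (r + q * l) x) ∂P
        - (∫ x, Real.exp (t * ∑ i ∈ Finset.range q, Y (r + i * l) x) ∂P)
          * ∫ x, Real.exp (t * Y (r + q * l) x) ∂P|
        ≤ Real.exp (t * B) ^ q * (Real.exp (t * B) * ρ l) := by
      refine abs_integral_mul_sub_le P ?_ ?_ (by positivity) (by positivity)
        (fun x => (Real.exp_pos _).le) hsum (fun x => (Real.exp_pos _).le)
        (fun x => hle _ x) ?_
      · exact Real.measurable_exp.comp
          ((Finset.measurable_sum _ fun i _ => h.measurable _).const_mul t)
      · exact Real.measurable_exp.comp ((h.measurable _).const_mul t)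
      · intro s s'
        -- For `q = 0` there is no earlier index to serve as the past; the first factor is the
        -- constant `1`, its superlevel sets are trivial, and the covariance vanishes.
        rcases q with _ | q
        · by_cases hs : s ≤ 1
          · simpa [hs] using hρ
          · simpa [hs] using hρ
        · have := h.mixing (r + q * l) l hl
            {x | s ≤ Real.exp (t * ∑ i ∈ Finset.range (q + 1), Y (r + i * l) x)} ?_
            {y | s' ≤ Real.exp (t * y)}
            (measurableSet_le measurable_const (by fun_prop))
          · rw [show r + (q + 1) * l = r + q * l + l by ring]
            exact this
          · refine measurableSet_le (mδ := ℱ (r + q * l)) measurable_const ?_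
            refine Real.measurable_exp.comp ?_
            refine Measurable.const_mul (m := ℱ (r + q * l)) ?_ t
            refine Finset.measurable_sum (m := ℱ (r + q * l)) _ fun i hi => ?_
            refine h.adapted _ _ ?_
            have : i ≤ q := by simpa [Nat.lt_succ_iff] using hi
            gcongr
    have heq : ∀ x, Real.exp (t * ∑ i ∈ Finset.range (q + 1), Y (r + i * l) x) =
        Real.exp (t * ∑ i ∈ Finset.range q, Y (r + i * l) x) * Real.exp (t * Y (r + q * l) x) :=
      fun x => by rw [Finset.sum_range_succ, mul_add, Real.exp_add]
    simp_rw [heq]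
    have h0 : 0 ≤ ∫ x, Real.exp (t * Y (r + q * l) x) ∂P :=
      integral_nonneg fun x => (Real.exp_pos _).le
    have h1 := (abs_le.1 hstep).2
    have h2 := mul_le_mul_of_nonneg_right ih h0
    have h3 : Real.exp (B ^ 2 * t ^ 2 / 2) ^ q * ∫ x, Real.exp (t * Y (r + q * l) x) ∂P ≤
        Real.exp (B ^ 2 * t ^ 2 / 2) ^ q * Real.exp (B ^ 2 * t ^ 2 / 2) :=
      mul_le_mul_of_nonneg_left (hmgf _) (by positivity)
    have h4 : q * (Real.exp (t * B) ^ q * ρ l) * ∫ x, Real.exp (t * Y (r + q * l) x) ∂P ≤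
        q * (Real.exp (t * B) ^ q * ρ l) * Real.exp (t * B) :=
      mul_le_mul_of_nonneg_left (hmK _) (by positivity)
    rw [pow_succ (Real.exp (B ^ 2 * t ^ 2 / 2)), pow_succ (Real.exp (t * B))]
    push_cast
    linarith

/-- Chernoff's bound with `t = ε / B ^ 2`, the minimizer of `-t * ε * q + B ^ 2 * t ^ 2 * q / 2`. In
the mixing error the prefactor `exp (-t * ε * q)` is simply dropped. -/
theorem IsMixingSeq.measure_spaced_sum_ge_le (h : IsMixingSeq P ℱ Y ρ) {B ε : ℝ} (hB : 0 < B)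
    (hε : 0 < ε) (hYB : ∀ j x, |Y j x| ≤ B) (hY0 : ∀ j, ∫ x, Y j x ∂P = 0) (r : ℕ) {l : ℕ}
    (hl : 1 ≤ l) (q : ℕ) :
    P.real {x | ε * q ≤ ∑ i ∈ Finset.range q, Y (r + i * l) x} ≤
      Real.exp (-(ε ^ 2 / (2 * B ^ 2)) * q) + q * (Real.exp (ε / B * q) * ρ l) := by
  have hρ : 0 ≤ ρ l :=
    (abs_nonneg _).trans (h.mixing 0 l hl ∅ (@MeasurableSet.empty _ (ℱ 0)) ∅ .empty)
  have ht : 0 ≤ ε / B ^ 2 := by positivity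
  have hm : Measurable fun x => ∑ i ∈ Finset.range q, Y (r + i * l) x :=
    Finset.measurable_sum _ fun i _ => h.measurable _
  have h1 := h.integral_exp_sum_le hB.le ht hYB hY0 r hl q
  have hch := measure_ge_le_exp_mul_mgf (μ := P)
    (X := fun x => ∑ i ∈ Finset.range q, Y (r + i * l) x) (ε * q) ht ?_
  · refine hch.trans ((mul_le_mul_of_nonneg_left h1 (Real.exp_pos _).le).trans ?_)
    rw [mul_add]
    refine add_le_add (le_of_eq ?_) ?_
    · rw [← Real.exp_nat_mul, ← Real.exp_add]
      congr 1
      field_simp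
      ring
    · have : Real.exp (-(ε / B ^ 2) * (ε * q)) ≤ 1 := by
        refine Real.exp_le_one_iff.2 ?_
        have : 0 ≤ ε / B ^ 2 * (ε * q) := by positivity
        linarith
      refine (mul_le_mul_of_nonneg_right this (by positivity)).trans (le_of_eq ?_)
      rw [one_mul, ← Real.exp_nat_mul]
      congr 3
      field_simp
  · refine Integrable.of_mem_Icc 0 (Real.exp (ε / B ^ 2 * (q * B)))
      (Real.measurable_exp.comp (hm.const_mul _)).aemeasurable
      (Eventually.of_forall fun x => ⟨(Real.exp_pos _).le, Real.exp_le_exp.2 ?_⟩)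
    refine mul_le_mul_of_nonneg_left ?_ ht
    refine (Finset.sum_le_sum fun i _ => (le_abs_self _).trans (hYB (r + i * l) x)).trans ?_
    simp

/-- The indices below `q * l` split into `l` residue classes of size `q`. The remaining fewer than
`l` terms contribute at most `B * l ≤ ε * n`, which is why the level is `2 * ε`: some class must
then have a sum of at least `ε * q`. -/
theorem IsMixingSeq.measure_sum_ge_le (h : IsMixingSeq P ℱ Y ρ) {B ε : ℝ} (hB : 0 < B)
    (hε : 0 < ε) (hYB : ∀ j x, |Y j x| ≤ B) (hY0 : ∀ j, ∫ x, Y j x ∂P = 0) (n : ℕ) {l : ℕ}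
    (hl : 1 ≤ l) (hln : B * l ≤ ε * n) :
    P.real {x | 2 * ε * n ≤ ∑ i ∈ Finset.range n, Y i x} ≤
      l * (Real.exp (-(ε ^ 2 / (2 * B ^ 2)) * (n / l : ℕ)) +
        (n / l : ℕ) * (Real.exp (ε / B * (n / l : ℕ)) * ρ l)) := by
  set q := n / l with hq
  have hnq : n = q * l + n % l := (Nat.div_add_mod' n l).symm
  have hmod : n % l < l := Nat.mod_lt _ hl
  have hsub : {x | 2 * ε * n ≤ ∑ i ∈ Finset.range n, Y i x} ⊆
      ⋃ r ∈ Finset.range l, {x | ε * q ≤ ∑ i ∈ Finset.range q, Y (r + i * l) x} := by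
    intro x hx
    simp only [Set.mem_ofPred_eq] at hx
    by_contra hcon
    simp only [Set.mem_iUnion, Set.mem_ofPred_eq, not_exists, not_le] at hcon
    have hs1 : ∑ i ∈ Finset.range (q * l), Y i x
        = ∑ r ∈ Finset.range l, ∑ i ∈ Finset.range q, Y (r + i * l) x := by
      clear_value q
      clear hnq hq hx hcon hln
      induction q with
      | zero => simp
      | succ q ih =>
        rw [Nat.succ_mul, Finset.sum_range_add, ih, ← Finset.sum_add_distrib]
        refine Finset.sum_congr rfl fun r _ => ?_
        rw [Finset.sum_range_succ, add_comm r]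
    have hs2 : ∑ i ∈ Finset.range n, Y i x ≤ ∑ i ∈ Finset.range (q * l), Y i x + B * l := by
      rw [hnq, Finset.sum_range_add]
      refine add_le_add_right ?_ _
      refine (Finset.sum_le_sum fun i _ => (le_abs_self _).trans (hYB (q * l + i) x)).trans ?_
      rw [Finset.sum_const, Finset.card_range, nsmul_eq_mul, mul_comm]
      refine mul_le_mul_of_nonneg_left ?_ hB.le
      exact_mod_cast hmod.le
    have hs3 : ∑ r ∈ Finset.range l, ∑ i ∈ Finset.range q, Y (r + i * l) x
        < ∑ r ∈ Finset.range l, ε * q :=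
      Finset.sum_lt_sum_of_nonempty ⟨0, Finset.mem_range.2 hl⟩ fun r hr => hcon r hr
    have hs4 : ∑ r ∈ Finset.range l, ε * (q : ℝ) ≤ ε * n := by
      rw [Finset.sum_const, Finset.card_range, nsmul_eq_mul, mul_left_comm]
      refine mul_le_mul_of_nonneg_left ?_ hε.le
      have : l * q ≤ n := Nat.mul_div_le n l
      exact_mod_cast this
    linarith
  calc _ ≤ _ := measureReal_mono hsub (measure_ne_top _ _)
    _ ≤ ∑ r ∈ Finset.range l, P.real {x | ε * q ≤ ∑ i ∈ Finset.range q, Y (r + i * l) x} :=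
        measureReal_biUnion_finset_le _ _
    _ ≤ ∑ r ∈ Finset.range l, _ := Finset.sum_le_sum fun r _ =>
        h.measure_spaced_sum_ge_le hB hε hYB hY0 r hl q
    _ = _ := by rw [Finset.sum_const, Finset.card_range, nsmul_eq_mul]

end Mixing

/-! ### Choice of the spacing and polynomial tails of every order -/

section Concentration

/-- The spacing `⌈n^{1-δ}⌉`. -/
theorem spacing_bounds {δ : ℝ} (hδ0 : 0 < δ) (hδ1 : δ < 1) {n : ℕ} (hn : 1 ≤ n) :
    (n : ℝ) ^ (1 - δ) ≤ ⌈(n : ℝ) ^ (1 - δ)⌉₊ ∧ 1 ≤ ⌈(n : ℝ) ^ (1 - δ)⌉₊ ∧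
    ⌈(n : ℝ) ^ (1 - δ)⌉₊ ≤ n ∧ (⌈(n : ℝ) ^ (1 - δ)⌉₊ : ℝ) * (n : ℝ) ^ δ ≤ 2 * n ∧
    ((n / ⌈(n : ℝ) ^ (1 - δ)⌉₊ : ℕ) : ℝ) ≤ (n : ℝ) ^ δ ∧
    (n : ℝ) ^ δ / 2 - 1 ≤ (n / ⌈(n : ℝ) ^ (1 - δ)⌉₊ : ℕ) := by
  have hn' : (1 : ℝ) ≤ n := by exact_mod_cast hn
  have hn0 : (0 : ℝ) < n := by linarith
  set l := ⌈(n : ℝ) ^ (1 - δ)⌉₊ with hl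
  have h1 : (n : ℝ) ^ (1 - δ) ≤ l := Nat.le_ceil _
  have hone : 1 ≤ (n : ℝ) ^ (1 - δ) := Real.one_le_rpow hn' (by linarith)
  have hl1 : 1 ≤ l := by
    have : (1 : ℝ) ≤ l := hone.trans h1
    exact_mod_cast this
  have hl1' : (1 : ℝ) ≤ l := by exact_mod_cast hl1
  have hmul : (n : ℝ) ^ (1 - δ) * (n : ℝ) ^ δ = n := by
    rw [← Real.rpow_add hn0]; simp
  have hxpos : 0 < (n : ℝ) ^ δ := Real.rpow_pos_of_pos hn0 _
  have hl2 : (l : ℝ) ≤ 2 * (n : ℝ) ^ (1 - δ) := by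
    have := Nat.ceil_lt_add_one (a := (n : ℝ) ^ (1 - δ)) (by linarith)
    rw [← hl] at this
    linarith
  have h4 : (l : ℝ) * (n : ℝ) ^ δ ≤ 2 * n := by
    calc (l : ℝ) * (n : ℝ) ^ δ ≤ 2 * (n : ℝ) ^ (1 - δ) * (n : ℝ) ^ δ :=
          mul_le_mul_of_nonneg_right hl2 hxpos.le
      _ = 2 * n := by rw [mul_assoc, hmul]
  refine ⟨h1, hl1, ?_, h4, ?_, ?_⟩
  · rw [hl]
    refine Nat.ceil_le.2 ?_
    calc (n : ℝ) ^ (1 - δ) ≤ (n : ℝ) ^ (1 : ℝ) :=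
          Real.rpow_le_rpow_of_exponent_le hn' (by linarith)
      _ = n := Real.rpow_one _
  · refine (Nat.cast_div_le).trans ?_
    rw [div_le_iff₀ (by linarith)]
    nlinarith
  · have hlt : n < (n / l + 1) * l := Nat.lt_mul_of_div_lt (Nat.lt_succ_self _) hl1 |>.trans_eq rfl
    have hlt' : (n : ℝ) < ((n / l : ℕ) + 1) * l := by exact_mod_cast hlt
    have : (n : ℝ) ^ δ / 2 * l ≤ n := by nlinarith
    have h6 : (n : ℝ) ^ δ / 2 * l < ((n / l : ℕ) + 1) * l := this.trans_lt hlt'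
    have := lt_of_mul_lt_mul_right h6 (by linarith)
    linarith

variable {S : Type*} [MeasurableSpace S] {P : Measure S} [IsProbabilityMeasure P]
  {ℱ : ℕ → MeasurableSpace S} {Y : ℕ → S → ℝ} {ρ : ℕ → ℝ}

/-- The choice of `δ` makes `l ^ c` at least `x * x ^ c` with `x = n ^ δ`. As `x ^ c` tends to
infinity, the mixing rate dominates `exp (c₂ * x)` and leaves `exp (-x)` to spare, so all terms
decay faster than any power of `n`. The threshold is uniform in `Y`, so that it serves `Y` and `-Y`
alike. -/
theorem IsMixingSeq.eventually_measure_sum_ge_le {a b c B ε : ℝ} (ha : 0 < a) (hb : 0 < b)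
    (hc : 0 < c) (hρ : ∀ l : ℕ, 1 ≤ l → ρ l ≤ a * Real.exp (-b * (l : ℝ) ^ c)) (hB : 0 < B)
    (hε : 0 < ε) (β : ℝ) :
    ∀ᶠ n : ℕ in atTop, ∀ Y : ℕ → S → ℝ, IsMixingSeq P ℱ Y ρ → (∀ j x, |Y j x| ≤ B) →
      (∀ j, ∫ x, Y j x ∂P = 0) →
      P.real {x | 2 * ε * n ≤ ∑ i ∈ Finset.range n, Y i x} ≤ 1 / (n : ℝ) ^ β := by
  set δ : ℝ := c / (1 + 2 * c) with hδ
  have hδ0 : 0 < δ := by positivity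
  have hδ1 : δ < 1 := by rw [hδ, div_lt_one (by positivity)]; linarith
  have hδc : (1 - δ) * c = δ * (1 + c) := by rw [hδ]; field_simp; ring
  have hx : Tendsto (fun n : ℕ => (n : ℝ) ^ δ) atTop atTop :=
    (tendsto_rpow_atTop hδ0).comp tendsto_natCast_atTop_atTop
  have hxc : Tendsto (fun n : ℕ => ((n : ℝ) ^ δ) ^ c) atTop atTop :=
    (tendsto_rpow_atTop hc).comp hx
  set c₁ : ℝ := ε ^ 2 / (2 * B ^ 2) with hc₁
  set c₂ : ℝ := ε / B with hc₂
  have hc₁0 : 0 < c₁ := by positivity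
  have hc₂0 : 0 < c₂ := by positivity
  have hlim : Tendsto (fun n : ℕ => Real.exp c₁ *
      (((n : ℝ) ^ δ) ^ ((β + 1) / δ) * Real.exp (-(c₁ / 2) * (n : ℝ) ^ δ)) +
      a * (((n : ℝ) ^ δ) ^ ((β + 2) / δ) * Real.exp (-1 * (n : ℝ) ^ δ))) atTop (𝓝 0) := by
    have h1 := (tendsto_rpow_mul_exp_neg_mul_atTop_nhds_zero ((β + 1) / δ) (c₁ / 2)
      (by positivity)).comp hx
    have h2 := (tendsto_rpow_mul_exp_neg_mul_atTop_nhds_zero ((β + 2) / δ) 1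
      (by positivity)).comp hx
    simpa using (h1.const_mul (Real.exp c₁)).add (h2.const_mul a)
  filter_upwards [hlim.eventually_le_const (show (0 : ℝ) < 1 by norm_num), eventually_ge_atTop 1,
    hx.eventually_ge_atTop (2 * B / ε), hxc.eventually_ge_atTop ((c₂ + 1) / b)]
    with n hn1 hn hnB hnc Y hY hYB hY0
  have hn' : (1 : ℝ) ≤ n := by exact_mod_cast hn
  have hn0 : (0 : ℝ) < n := by linarith
  obtain ⟨hl1, hl2, hl3, hl4, hl5, hl6⟩ := spacing_bounds hδ0 hδ1 hn
  set l := ⌈(n : ℝ) ^ (1 - δ)⌉₊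
  set x := (n : ℝ) ^ δ with hxdef
  have hx0 : 0 < x := Real.rpow_pos_of_pos hn0 _
  have hln : B * l ≤ ε * n := by
    have h1 : 2 * B ≤ ε * x := by rw [div_le_iff₀ hε] at hnB; linarith
    have h2 : 2 * (B * l) ≤ ε * (l * x) := by
      have : (0 : ℝ) ≤ l := by positivity
      nlinarith
    nlinarith
  refine (hY.measure_sum_ge_le hB hε hYB hY0 n hl2 hln).trans ?_
  rw [← hc₁, ← hc₂]
  set q := n / l with hq
  have hqn : (q : ℝ) ≤ n := by exact_mod_cast Nat.div_le_self n l
  have hln' : (l : ℝ) ≤ n := by exact_mod_cast hl3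
  have e1 : Real.exp (-c₁ * q) ≤ Real.exp c₁ * Real.exp (-(c₁ / 2) * x) := by
    rw [← Real.exp_add]
    refine Real.exp_le_exp.2 ?_
    nlinarith
  have e2 : Real.exp (c₂ * q) * ρ l ≤ a * Real.exp (-1 * x) := by
    have hlc : x * x ^ c ≤ (l : ℝ) ^ c := by
      calc x * x ^ c = (n : ℝ) ^ ((1 - δ) * c) := by
            rw [hδc, hxdef, ← Real.rpow_mul hn0.le, ← Real.rpow_add hn0]; ring_nf
        _ = ((n : ℝ) ^ (1 - δ)) ^ c := by rw [Real.rpow_mul hn0.le]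
        _ ≤ _ := Real.rpow_le_rpow (by positivity) hl1 hc.le
    have hxc' : c₂ + 1 ≤ b * x ^ c := by
      rw [div_le_iff₀ hb] at hnc; linarith
    calc Real.exp (c₂ * q) * ρ l ≤ Real.exp (c₂ * q) * (a * Real.exp (-b * (l : ℝ) ^ c)) :=
          mul_le_mul_of_nonneg_left (hρ l hl2) (Real.exp_pos _).le
      _ = a * Real.exp (c₂ * q + -b * (l : ℝ) ^ c) := by rw [Real.exp_add]; ring
      _ ≤ _ := by
          refine mul_le_mul_of_nonneg_left (Real.exp_le_exp.2 ?_) ha.le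
          nlinarith [mul_le_mul_of_nonneg_left hl5 hc₂0.le,
            mul_le_mul_of_nonneg_left hlc hb.le, mul_le_mul_of_nonneg_left hxc' hx0.le]
  have e3 : (l : ℝ) * (Real.exp (-c₁ * q) + q * (Real.exp (c₂ * q) * ρ l)) ≤
      n * (Real.exp c₁ * Real.exp (-(c₁ / 2) * x) + n * (a * Real.exp (-1 * x))) := by
    have h1 : (q : ℝ) * (Real.exp (c₂ * q) * ρ l) ≤ n * (a * Real.exp (-1 * x)) :=
      (mul_le_mul_of_nonneg_left e2 (by positivity)).trans
        (mul_le_mul_of_nonneg_right hqn (by positivity))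
    exact (mul_le_mul_of_nonneg_left (add_le_add e1 h1) (by positivity)).trans
      (mul_le_mul_of_nonneg_right hln' (by positivity))
  refine e3.trans ?_
  rw [le_div_iff₀ (Real.rpow_pos_of_pos hn0 _)]
  refine le_trans (le_of_eq ?_) hn1
  have p1 : x ^ ((β + 1) / δ) = n * (n : ℝ) ^ β := by
    rw [hxdef, ← Real.rpow_mul hn0.le, mul_div_cancel₀ _ hδ0.ne', Real.rpow_add hn0,
      Real.rpow_one, mul_comm]
  have p2 : x ^ ((β + 2) / δ) = n * n * (n : ℝ) ^ β := by
    rw [hxdef, ← Real.rpow_mul hn0.le, mul_div_cancel₀ _ hδ0.ne', Real.rpow_add hn0,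
      Real.rpow_two]
    ring
  rw [p1, p2]
  ring

/-- Polynomial concentration of every order for bounded centred sequences with stretched
exponential mixing. -/
theorem IsMixingSeq.exists_measure_abs_sum_ge_le {a b c B ε β : ℝ} (ha : 0 < a) (hb : 0 < b)
    (hc : 0 < c) (hρ : ∀ l : ℕ, 1 ≤ l → ρ l ≤ a * Real.exp (-b * (l : ℝ) ^ c)) (hB : 0 < B)
    (hε : 0 < ε) (hβ : 0 < β) (hY : IsMixingSeq P ℱ Y ρ) (hYB : ∀ j x, |Y j x| ≤ B)
    (hY0 : ∀ j, ∫ x, Y j x ∂P = 0) :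
    ∃ d : ℝ, ∀ n : ℕ, 1 ≤ n →
      P.real {x | ε * n ≤ |∑ i ∈ Finset.range n, Y i x|} ≤ d / (n : ℝ) ^ β := by
  obtain ⟨n₀, hn₀⟩ := eventually_atTop.1
    (IsMixingSeq.eventually_measure_sum_ge_le (P := P) (ℱ := ℱ) ha hb hc hρ hB (half_pos hε) β)
  -- The `2` counts the two tails for `n ≥ n₀`; the other summand covers `n ≤ n₀`, where the
  -- probability is at most `1`.
  refine ⟨2 + (n₀ : ℝ) ^ β, fun n hn => ?_⟩
  have hn' : (1 : ℝ) ≤ n := by exact_mod_cast hn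
  have hnβ : 0 < (n : ℝ) ^ β := Real.rpow_pos_of_pos (by linarith) _
  have hn₀β : 0 ≤ (n₀ : ℝ) ^ β := by positivity
  rw [le_div_iff₀ hnβ]
  rcases le_total n₀ n with h | h
  · have h1 := hn₀ n h Y hY hYB hY0
    have h2 := hn₀ n h (fun j x => -Y j x) hY.neg (by simpa using hYB)
      (fun j => by rw [integral_neg, hY0, neg_zero])
    have hsub : {x | ε * n ≤ |∑ i ∈ Finset.range n, Y i x|} ⊆
        {x | 2 * (ε / 2) * n ≤ ∑ i ∈ Finset.range n, Y i x} ∪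
        {x | 2 * (ε / 2) * n ≤ ∑ i ∈ Finset.range n, -Y i x} := by
      intro x hx
      simp only [Set.mem_ofPred_eq, Set.mem_union] at hx ⊢
      rw [show 2 * (ε / 2) = ε by ring, Finset.sum_neg_distrib]
      exact le_abs.1 hx
    have h3 := (measureReal_mono hsub (measure_ne_top P _)).trans (measureReal_union_le _ _)
    rw [le_div_iff₀ hnβ] at h1 h2
    nlinarith
  · have h1 : P.real {x | ε * n ≤ |∑ i ∈ Finset.range n, Y i x|} ≤ 1 := measureReal_le_one
    have h2 : (n : ℝ) ^ β ≤ (n₀ : ℝ) ^ β :=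
      Real.rpow_le_rpow (by linarith) (by exact_mod_cast h) hβ.le
    nlinarith [measureReal_nonneg (μ := P) (s := {x | ε * n ≤ |∑ i ∈ Finset.range n, Y i x|})]

end Concentration

/-! ### The two-sided shift -/

section ShiftBy

variable {Y : Type*}

/-- The `m`-th power, `m ∈ ℤ`, of the two-sided shift. -/
def shiftBy (m : ℤ) (ω : ℤ → Y) : ℤ → Y := fun i => ω (i + m)

theorem shiftBy_shiftBy (m n : ℤ) (ω : ℤ → Y) : shiftBy m (shiftBy n ω) = shiftBy (m + n) ω := by
  funext i; simp [shiftBy, add_assoc]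

@[simp] theorem shiftBy_zero (ω : ℤ → Y) : shiftBy 0 ω = ω := by
  funext i; simp [shiftBy]

theorem shift_eq_shiftBy (ω : ℤ → Y) : shift ω = shiftBy 1 ω := rfl

theorem iterate_shift (n : ℕ) (ω : ℤ → Y) : shift^[n] ω = shiftBy n ω := by
  induction n generalizing ω with
  | zero => simp
  | succ n ih => rw [Function.iterate_succ_apply, ih, shift_eq_shiftBy, shiftBy_shiftBy]; simp

theorem measurable_shiftBy [MeasurableSpace Y] (m : ℤ) : Measurable (shiftBy (Y := Y) m) :=
  measurable_pi_lambda _ fun i => measurable_pi_apply (i + m)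

end ShiftBy

/-! ### The two-sided law: windows and shift invariance -/

section TwoSided

variable {Y Ω₀ : Type*} [MeasurableSpace Y] [MeasurableSpace Ω₀]
  {P₀ : Measure Ω₀} {ζ : ℕ → Ω₀ → Y} {P : Measure (ℤ → Y)}

theorem IsStationarySeq.map_add (h : IsStationarySeq P₀ ζ) (m : ℕ) :
    P₀.map (fun w n => ζ (n + m) w) = P₀.map (fun w n => ζ n w) := by
  have hm : ∀ m, Measurable (fun w (n : ℕ) => ζ (n + m) w) := fun m =>
    measurable_pi_lambda _ fun n => h.1 _
  induction m with
  | zero => rfl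
  | succ m ih =>
    have hs : Measurable fun (y : ℕ → Y) n => y (n + m) :=
      measurable_pi_lambda _ fun n => measurable_pi_apply _
    have h1 := congrArg (Measure.map fun (y : ℕ → Y) n => y (n + m)) h.2
    rw [Measure.map_map hs (hm 1),
      Measure.map_map hs (by simpa using hm 0)] at h1
    exact h1.trans ih

variable [IsProbabilityMeasure P₀] [IsProbabilityMeasure P]

/-- The one-sided windows of the two-sided process have the law of the original process. -/
theorem IsTwoSidedLaw.map_window (hP : IsTwoSidedLaw P₀ ζ P) (h : IsStationarySeq P₀ ζ) (M : ℤ) :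
    P.map (fun ω (n : ℕ) => ω (n + M)) = P₀.map (fun w n => ζ n w) := by
  have hm1 : Measurable fun (ω : ℤ → Y) (n : ℕ) => ω (n + M) :=
    measurable_pi_lambda _ fun n => measurable_pi_apply _
  have hm2 : ∀ m, Measurable (fun w (n : ℕ) => ζ (n + m) w) := fun m =>
    measurable_pi_lambda _ fun n => h.1 _
  have := Measure.isProbabilityMeasure_map (μ := P) hm1.aemeasurable
  have := Measure.isProbabilityMeasure_map (μ := P₀) (hm2 0).aemeasurable
  refine ext_of_generate_finite _ generateFrom_squareCylinders.symm
    (isPiSystem_squareCylinders (fun _ => MeasurableSpace.isPiSystem_measurableSet) (by simp)) ?_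
    (by simp only [measure_univ])
  rintro _ ⟨s, t, ht, rfl⟩
  have ht' : ∀ i, MeasurableSet (t i) := fun i => ht i (Set.mem_univ _)
  have hms : MeasurableSet ((s : Set ℕ).pi t) :=
    MeasurableSet.pi (Finset.countable_toSet _) fun i _ => ht' i
  obtain ⟨b, hb⟩ : ∃ b : ℕ, ∀ i ∈ s, i ≤ b := ⟨s.sup id, fun i hi => Finset.le_sup (f := id) hi⟩
  -- a symmetric window containing all coordinates in question
  obtain ⟨N, hN⟩ : ∃ N : ℕ, (b : ℤ) + |M| ≤ N := ⟨((b : ℤ) + |M|).toNat, Int.self_le_toNat _⟩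
  have hM1 := le_abs_self M
  have hM2 := neg_abs_le M
  obtain ⟨m, hm⟩ : ∃ m : ℕ, (m : ℤ) = M + N := ⟨(M + N).toNat, Int.toNat_of_nonneg (by omega)⟩
  -- The symmetric window of radius `N` identifies coordinate `n + M` of the two-sided sequence with
  -- `ζ (n + M + N)`; stationarity absorbs the offset `m = M + N`.
  rw [Measure.map_apply hm1 hms, ← h.map_add m, Measure.map_apply (hm2 m) hms]
  classical
  have key := hP N (fun j => if (j - M).toNat ∈ s ∧ M ≤ j then t (j - M).toNat else Set.univ)
    (fun j => by split_ifs; exacts [ht' _, MeasurableSet.univ])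
  convert key using 2
  · ext ω
    simp only [Set.mem_preimage, Set.mem_pi, Finset.mem_coe, Set.mem_ofPred_eq]
    constructor
    · intro hω j hj
      split_ifs with hjs
      · have := hω _ hjs.1
        rwa [Int.toNat_of_nonneg (by omega), sub_add_cancel] at this
      · exact Set.mem_univ _
    · intro hω i hi
      have h1 := hb i hi
      have h2 := hω (i + M) (abs_le.2 (by omega))
      rw [if_pos ⟨by simpa using hi, by omega⟩] at h2
      rwa [show ((i : ℤ) + M - M).toNat = i by omega] at h2
  · ext w
    simp only [Set.mem_preimage, Set.mem_pi, Finset.mem_coe, Set.mem_ofPred_eq]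
    constructor
    · intro hω j hj
      split_ifs with hjs
      · have := hω _ hjs.1
        rwa [show ((j : ℤ) - N - M).toNat + m = j by omega] at this
      · exact Set.mem_univ _
    · intro hω i hi
      have h1 := hb i hi
      have h2 := hω (i + m) (by omega)
      have e : ((i + m : ℕ) : ℤ) - N - M = i := by push_cast; omega
      rw [e, if_pos ⟨by simpa using hi, by omega⟩] at h2
      simpa using h2

theorem IsTwoSidedLaw.measurePreserving_shiftBy (hP : IsTwoSidedLaw P₀ ζ P)
    (h : IsStationarySeq P₀ ζ) (m : ℤ) : MeasurePreserving (shiftBy m) P P := by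
  refine ⟨measurable_shiftBy m, ?_⟩
  have := Measure.isProbabilityMeasure_map (μ := P) (measurable_shiftBy (Y := Y) m).aemeasurable
  refine ext_of_generate_finite _ generateFrom_squareCylinders.symm
    (isPiSystem_squareCylinders (fun _ => MeasurableSpace.isPiSystem_measurableSet) (by simp)) ?_
    (by simp)
  rintro _ ⟨s, t, ht, rfl⟩
  have ht' : ∀ i, MeasurableSet (t i) := fun i => ht i (Set.mem_univ _)
  obtain ⟨N, hN⟩ : ∃ N : ℤ, ∀ i ∈ s, N ≤ i := by
    obtain ⟨N, hN⟩ := s.bddBelow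
    exact ⟨N, fun i hi => hN hi⟩
  rw [Measure.map_apply (measurable_shiftBy m)
    (MeasurableSet.pi (Finset.countable_toSet _) fun i _ => ht' i)]
  have hB : MeasurableSet {y : ℕ → Y | ∀ i ∈ s, y (i - N).toNat ∈ t i} := by
    simp only [Set.ofPred_forall]
    exact MeasurableSet.biInter (Finset.countable_toSet _) fun i _ =>
      (measurable_pi_apply _) (ht' i)
  -- One event of the one-sided law, read in the window that starts at `M`. The starts `N` and `N +
  -- m` give the cylinder and its preimage under the shift.
  have key : ∀ M : ℤ, P {ω | ∀ i ∈ s, ω (i - N + M) ∈ t i} =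
      P₀.map (fun w n => ζ n w) {y : ℕ → Y | ∀ i ∈ s, y (i - N).toNat ∈ t i} := fun M => by
    rw [← hP.map_window h M, Measure.map_apply
      (measurable_pi_lambda _ fun n => measurable_pi_apply _) hB]
    congr 1
    ext ω
    refine forall₂_congr fun i hi => ?_
    dsimp only
    rw [Int.toNat_of_nonneg (by have := hN i hi; omega)]
  have k1 := (key (N + m)).trans (key N).symm
  convert k1 using 2
  · ext ω
    simp [shiftBy, Set.mem_pi, sub_add_eq_add_sub]
    refine forall₂_congr fun i hi => ?_
    rw [show i + (N + m) - N = i + m by ring]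
  · ext ω
    simp [Set.mem_pi]

/-- The sequence with the coordinates of `ω` for `|i| ≤ N` and `y₀` elsewhere. -/
def truncate (y₀ : Y) (N : ℕ) (ω : ℤ → Y) : ℤ → Y := fun i => if i.natAbs ≤ N then ω i else y₀

theorem measurable_truncate (y₀ : Y) (N : ℕ) : Measurable (truncate y₀ N) := by
  refine measurable_pi_lambda _ fun i => ?_
  by_cases hi : i.natAbs ≤ N
  · simpa [truncate, hi] using measurable_pi_apply i
  · simp [truncate, hi]

end TwoSided

/-! ### Concentration for functions of finitely many coordinates -/

section LocalConcentration

variable {Y : Type*} [MeasurableSpace Y]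

/-- The two-sided sequence that carries `y m, …, y (m + 2 N)` in the window `|i| ≤ N`. -/
def windowSeq (y₀ : Y) (N m : ℕ) (y : ℕ → Y) : ℤ → Y :=
  fun i => if i.natAbs ≤ N then y (i + N + m).toNat else y₀

theorem measurable_windowSeq_comp {S : Type*} {m' : MeasurableSpace S} {ζ : ℕ → S → Y}
    (y₀ : Y) (N m : ℕ)
    (h : ∀ i ∈ Set.Icc m (m + 2 * N), Measurable[m'] (ζ i)) :
    Measurable[m'] fun w => windowSeq y₀ N m fun n => ζ n w := by
  refine measurable_pi_lambda _ fun i => ?_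
  by_cases hi : i.natAbs ≤ N
  · simp only [windowSeq, hi, if_true]
    refine h _ ⟨?_, ?_⟩ <;> omega
  · simp only [windowSeq, hi, if_false]
    exact measurable_const

/-- Concentration for the averages of a bounded function of finitely many coordinates. -/
theorem exists_measure_abs_birkhoff_sub_ge_le {Ω₀ : Type*} [MeasurableSpace Ω₀]
    {P₀ : Measure Ω₀} [IsProbabilityMeasure P₀] {ζ : ℕ → Ω₀ → Y} {P : Measure (ℤ → Y)}
    [IsProbabilityMeasure P] (hstat : IsStationarySeq P₀ ζ)
    (hmix : IsStretchedExpMixing P₀ ζ) (hP : IsTwoSidedLaw P₀ ζ P) {V : (ℤ → Y) → ℝ}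
    (hV : Measurable V) {y₀ : Y} {N : ℕ} (hloc : ∀ ω, V (truncate y₀ N ω) = V ω) {M : ℝ}
    (hM : ∀ ω, |V ω| ≤ M) {k : ℕ} (hk : 1 ≤ k) {ε β : ℝ} (hε : 0 < ε) (hβ : 0 < β) :
    ∃ d : ℝ, ∀ n : ℕ, 1 ≤ n →
      P.real {ω | ε * n ≤ |∑ j ∈ Finset.range n, V (shift^[j * k] ω) - n * ∫ ω', V ω' ∂P|}
        ≤ d / (n : ℝ) ^ β := by
  obtain ⟨a, b, c, ha, hb, hc, hmix⟩ := hmix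
  have hM0 : 0 ≤ M := (abs_nonneg _).trans (hM fun _ => y₀)
  set m := ∫ ω', V ω' ∂P with hm
  have hmM : |m| ≤ M := by
    have := norm_integral_le_of_norm_le_const (μ := P) (f := V) (C := M) (Eventually.of_forall hM)
    simpa using this
  -- The offset `1` keeps all indices in `{1, 2, …}`, where the mixing condition is stated; the
  -- window `R` below starts at `-N - 1` to compensate.
  let F : ℕ → (ℕ → Y) → ℝ := fun j y => V (windowSeq y₀ N (j * k + 1) y) - m
  have hwin : ∀ i, Measurable fun y : ℕ → Y => y i := fun i => measurable_pi_apply i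
  have hFm : ∀ j, Measurable (F j) := fun j =>
    (hV.comp (measurable_windowSeq_comp (ζ := fun i (y : ℕ → Y) => y i) y₀ N _
      fun i _ => hwin i)).sub_const m
  have hζm : Measurable fun w (n : ℕ) => ζ n w := measurable_pi_lambda _ fun n => hstat.1 n
  let R : (ℤ → Y) → ℕ → Y := fun ω n => ω (n + (-N - 1))
  have hRm : Measurable R := measurable_pi_lambda _ fun n => measurable_pi_apply _
  have hR : P.map R = P₀.map fun w n => ζ n w := hP.map_window hstat (-N - 1)
  have hFR : ∀ j ω, F j (R ω) = V (shift^[j * k] ω) - m := fun j ω => by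
    simp only [F]
    rw [← hloc (shift^[j * k] ω), iterate_shift]
    congr 2
    funext i
    simp only [windowSeq, truncate, R, shiftBy]
    split_ifs with hi
    · have : (0 : ℤ) ≤ ((j * k : ℕ) : ℤ) := Int.natCast_nonneg _
      generalize j * k = p at this ⊢
      congr 1; omega
    · rfl
  let X : ℕ → Ω₀ → ℝ := fun j w => F j fun n => ζ n w
  have hXm : ∀ j, Measurable (X j) := fun j => (hFm j).comp hζm
  have hX0 : ∀ j, ∫ w, X j w ∂P₀ = 0 := fun j => by
    have h1 : ∫ w, X j w ∂P₀ = ∫ ω, F j (R ω) ∂P := by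
      rw [← integral_map hζm.aemeasurable (hFm j).aestronglyMeasurable, ← hR,
        integral_map hRm.aemeasurable (hFm j).aestronglyMeasurable]
    have hVi : Integrable V P := Integrable.of_bound hV.aestronglyMeasurable M
      (Eventually.of_forall hM)
    have hmp := hP.measurePreserving_shiftBy hstat ((j * k : ℕ) : ℤ)
    have h2 : ∫ ω, V (shiftBy ((j * k : ℕ) : ℤ) ω) ∂P = m := by
      rw [← integral_map hmp.measurable.aemeasurable hV.aestronglyMeasurable, hmp.map_eq]
    simp_rw [h1, hFR, iterate_shift]
    have h3 : Integrable (fun ω => V (shiftBy ((j * k : ℕ) : ℤ) ω)) P :=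
      hmp.integrable_comp_of_integrable hVi
    rw [integral_sub h3 (integrable_const _), h2]
    simp
  -- The summand `1` only serves to make the bound positive when `M = 0`.
  have hXB : ∀ j w, |X j w| ≤ 2 * M + 1 := fun j w => by
    refine (abs_sub _ _).trans ?_
    linarith [hM (windowSeq y₀ N (j * k + 1) fun n => ζ n w)]
  let ℱ : ℕ → MeasurableSpace Ω₀ := fun p =>
    ⨆ i ∈ Set.Icc 1 (p * k + 2 * N + 1), MeasurableSpace.comap (ζ i) inferInstance
  -- The windows behind `X p` and `X (p + l)` leave a gap of `l * k - 2 * N`, which is at least `l /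
  -- 2` once `l ≥ 4 * N + 2`; this costs the factor `(1 / 2) ^ c`. For smaller `l` the exponential
  -- added to `a` makes the bound at least `1`, hence trivial.
  set b' := b * (1 / 2) ^ c with hb'
  have hb'0 : 0 < b' := by positivity
  set a' := a + Real.exp (b' * (4 * N + 2 : ℕ) ^ c) with ha'
  have hXadapt : ∀ p, ∀ i ≤ p, Measurable[ℱ p] (X i) := fun p i hi => by
    refine Measurable.sub_const (m := ℱ p) (hV.comp ?_) m
    refine measurable_windowSeq_comp (m' := ℱ p) y₀ N _ fun q hq => ?_
    have hik := Nat.mul_le_mul_right k hi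
    refine (comap_measurable (ζ q)).mono ?_ le_rfl
    exact le_iSup₂_of_le q ⟨by have := hq.1; omega, by have := hq.2; omega⟩ le_rfl
  have hXmix : IsMixingSeq P₀ ℱ X fun l => a' * Real.exp (-b' * (l : ℝ) ^ c) := by
    refine ⟨hXm, hXadapt, fun p l hl A hA B hB => ?_⟩
    by_cases hlN : 4 * N + 2 ≤ l
    · have hfut : MeasurableSet[⨆ i ∈ Set.Ici ((p * k + 2 * N + 1) + (l * k - 2 * N)),
          MeasurableSpace.comap (ζ i) inferInstance] (X (p + l) ⁻¹' B) := by
        set ℋ := ⨆ i ∈ Set.Ici ((p * k + 2 * N + 1) + (l * k - 2 * N)),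
          MeasurableSpace.comap (ζ i) inferInstance with hℋ
        have : Measurable[ℋ] (X (p + l)) := by
          refine Measurable.sub_const (m := ℋ) (hV.comp ?_) m
          refine measurable_windowSeq_comp (m' := ℋ) y₀ N _ fun q hq => ?_
          refine (comap_measurable (ζ q)).mono ?_ le_rfl
          have hlk := Nat.le_mul_of_pos_right l hk
          refine le_iSup₂_of_le q ?_ le_rfl
          have := hq.1
          rw [Nat.add_mul] at this
          simp only [Set.mem_Ici]
          omega
        exact this hB
      have hlk := Nat.le_mul_of_pos_right l hk
      refine (hmix (l * k - 2 * N) (p * k + 2 * N + 1) (by omega) (by omega) A _ hA hfut).trans ?_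
      refine mul_le_mul (by rw [ha']; linarith [Real.exp_pos (b' * (4 * N + 2 : ℕ) ^ c)])
        (Real.exp_le_exp.2 ?_) (Real.exp_pos _).le (by positivity)
      have h1 : (1 / 2 * (l : ℝ)) ≤ ((l * k - 2 * N : ℕ) : ℝ) := by
        have : l ≤ 2 * (l * k - 2 * N) := by omega
        have : (l : ℝ) ≤ 2 * ((l * k - 2 * N : ℕ) : ℝ) := by exact_mod_cast this
        linarith
      have h2 := Real.rpow_le_rpow (by positivity) h1 hc.le
      rw [Real.mul_rpow (by norm_num) (by positivity)] at h2
      rw [hb']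
      nlinarith
    · have h1 : |P₀.real (A ∩ X (p + l) ⁻¹' B) - P₀.real A * P₀.real (X (p + l) ⁻¹' B)| ≤ 1 := by
        rw [abs_le]
        have i1 : P₀.real (A ∩ X (p + l) ⁻¹' B) ≤ 1 := measureReal_le_one
        have i2 : P₀.real A ≤ 1 := measureReal_le_one
        have i3 : P₀.real (X (p + l) ⁻¹' B) ≤ 1 := measureReal_le_one
        have j1 : 0 ≤ P₀.real (A ∩ X (p + l) ⁻¹' B) := measureReal_nonneg
        have j2 : 0 ≤ P₀.real A := measureReal_nonneg
        have j3 : 0 ≤ P₀.real (X (p + l) ⁻¹' B) := measureReal_nonneg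
        constructor <;> nlinarith
      refine h1.trans ?_
      have h2 : (l : ℝ) ^ c ≤ (4 * N + 2 : ℕ) ^ c :=
        Real.rpow_le_rpow (by positivity) (by exact_mod_cast (not_le.1 hlN).le) hc.le
      calc (1 : ℝ) ≤ Real.exp (b' * (4 * N + 2 : ℕ) ^ c) * Real.exp (-b' * (l : ℝ) ^ c) := by
            rw [← Real.exp_add]
            refine Real.one_le_exp ?_
            nlinarith
        _ ≤ _ := mul_le_mul_of_nonneg_right (by rw [ha']; linarith) (Real.exp_pos _).le
  obtain ⟨d, hd⟩ := hXmix.exists_measure_abs_sum_ge_le (a := a') (b := b') (c := c)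
    (B := 2 * M + 1) (by positivity) hb'0 hc (fun l _ => le_rfl) (by positivity) hε hβ hXB hX0
  refine ⟨d, fun n hn => le_trans (le_of_eq ?_) (hd n hn)⟩
  have hS : MeasurableSet {y : ℕ → Y | ε * n ≤ |∑ j ∈ Finset.range n, F j y|} :=
    measurableSet_le measurable_const (Finset.measurable_sum _ fun j _ => hFm j).abs
  have e1 : {ω | ε * n ≤ |∑ j ∈ Finset.range n, V (shift^[j * k] ω) - n * m|} =
      R ⁻¹' {y : ℕ → Y | ε * n ≤ |∑ j ∈ Finset.range n, F j y|} := by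
    ext ω
    simp only [Set.mem_ofPred_eq, Set.mem_preimage, hFR, Finset.sum_sub_distrib, Finset.sum_const,
      Finset.card_range, nsmul_eq_mul]
  have e2 : {w | ε * n ≤ |∑ j ∈ Finset.range n, X j w|} =
      (fun w n => ζ n w) ⁻¹' {y : ℕ → Y | ε * n ≤ |∑ j ∈ Finset.range n, F j y|} := rfl
  rw [e1, e2, measureReal_def, measureReal_def, ← Measure.map_apply hRm hS,
    ← Measure.map_apply hζm hS, hR]

end LocalConcentration

/-! ### Normalized transfer operators along a sequence of expanding maps -/

section Averaging

variable {X : Type*}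

theorem finsum_fiber_eq_sum {M : Type*} [AddCommMonoid M] {T : X → X} {x : X} {k : ℕ}
    {y : Fin k → X} (hy : Function.Injective y) (hr : Set.range y = T ⁻¹' {x}) (g : X → M) :
    ∑ᶠ (z : X) (_ : T z = x), g z = ∑ i, g (y i) := by
  have h1 : ∑ᶠ (z : X) (_ : T z = x), g z = ∑ᶠ (z : X) (_ : z ∈ T ⁻¹' {x}), g z := rfl
  rw [h1, ← hr, finsum_mem_range hy, finsum_eq_sum_of_fintype]

/-- The averaging operator `f ↦ ∑_{T y = x} w(y) f(y)`. -/
noncomputable def avgOp (T : X → X) (w f : X → ℝ) (x : X) : ℝ :=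
  ∑ᶠ (y : X) (_ : T y = x), w y * f y

/-- `T_{n-1} ∘ ⋯ ∘ T_0`. -/
def seqIter (T : ℕ → X → X) : ℕ → X → X
  | 0 => id
  | n + 1 => T n ∘ seqIter T n

/-- The composition of the averaging operators with indices `n-1, …, 0`. -/
noncomputable def iterAvg (T : ℕ → X → X) (w : ℕ → X → ℝ) (f : X → ℝ) : ℕ → X → ℝ
  | 0 => f
  | n + 1 => avgOp (T n) (w n) (iterAvg T w f n)

theorem seqIter_add (T : ℕ → X → X) (m n : ℕ) (x : X) :
    seqIter T (m + n) x = seqIter (fun i => T (m + i)) n (seqIter T m x) := by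
  induction n with
  | zero => rfl
  | succ n ih =>
    change T (m + n) (seqIter T (m + n) x) = _
    rw [ih]; rfl

theorem iterAvg_add (T : ℕ → X → X) (w : ℕ → X → ℝ) (f : X → ℝ) (m n : ℕ) :
    iterAvg T w f (m + n) =
      iterAvg (fun i => T (m + i)) (fun i => w (m + i)) (iterAvg T w f m) n := by
  induction n with
  | zero => rfl
  | succ n ih =>
    change avgOp (T (m + n)) (w (m + n)) (iterAvg T w f (m + n)) = _
    rw [ih]; rfl

/-- The oscillation of `f` is at most `a`. -/
def OscLE (a : ℝ) (f : X → ℝ) : Prop := ∀ x x', |f x - f x'| ≤ a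

theorem OscLE.exists_bounds [Nonempty X] {f : X → ℝ} {a : ℝ} (h : OscLE a f) :
    ∃ m, (∀ x, m ≤ f x) ∧ (∀ x, f x ≤ m + a) ∧ ∀ e > 0, ∃ z, f z < m + e := by
  have hbdd : BddBelow (Set.range f) := by
    obtain ⟨x₀⟩ := ‹Nonempty X›
    refine ⟨f x₀ - a, ?_⟩
    rintro _ ⟨x, rfl⟩
    linarith [(abs_le.1 (h x x₀)).1]
  refine ⟨⨅ x, f x, fun x => ciInf_le hbdd x, fun x => ?_, fun e he => ?_⟩
  · have : f x - a ≤ ⨅ x, f x := le_ciInf fun x' => by linarith [(abs_le.1 (h x x')).2]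
    linarith
  · exact exists_lt_of_ciInf_lt (by linarith)

variable [MetricSpace X]

/-- `|f x - f x'| ≤ v ρ(x,x')^α` whenever `ρ(x,x') < ξ`. -/
def LocHolder (α ξ v : ℝ) (f : X → ℝ) : Prop :=
  ∀ x x', dist x x' < ξ → |f x - f x'| ≤ v * dist x x' ^ α

theorem LocHolder.continuous {α ξ v : ℝ} {f : X → ℝ} (h : LocHolder α ξ v f) (hα : 0 < α)
    (hξ : 0 < ξ) : Continuous f := by
  refine continuous_iff_continuousAt.2 fun x => ?_
  rw [ContinuousAt, tendsto_iff_dist_tendsto_zero]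
  have h1 : Tendsto (fun x' => v * dist x' x ^ α) (𝓝 x) (𝓝 0) := by
    have : Tendsto (fun x' => dist x' x) (𝓝 x) (𝓝 0) := by
      simpa using (tendsto_id (α := X) (x := 𝓝 x)).dist (tendsto_const_nhds (x := x))
    simpa [Real.zero_rpow hα.ne'] using ((this.rpow_const (Or.inr hα.le)).const_mul v)
  refine squeeze_zero' (Eventually.of_forall fun _ => dist_nonneg) ?_ h1
  filter_upwards [Metric.ball_mem_nhds x hξ] with x' hx'
  exact h x' x hx'

theorem LocHolder.mono {α ξ v v' : ℝ} {f : X → ℝ} (h : LocHolder α ξ v f) (hv : v ≤ v') :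
    LocHolder α ξ v' f := fun x x' hx =>
  (h x x' hx).trans (mul_le_mul_of_nonneg_right hv (Real.rpow_nonneg dist_nonneg _))

/-- An expanding map with a positive normalized weight. -/
structure IsFiberStep (α ξ γ η K : ℝ) (D : ℕ) (T : X → X) (w : X → ℝ) : Prop where
  pairing : ∀ x x' : X, dist x x' < ξ →
    ∃ (k : ℕ) (y y' : Fin k → X), k ≤ D ∧ Function.Injective y ∧ Function.Injective y' ∧
      Set.range y = T ⁻¹' {x} ∧ Set.range y' = T ⁻¹' {x'} ∧
      ∀ i, dist (y i) (y' i) ≤ γ⁻¹ * dist x x'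
  lower : ∀ y, η ≤ w y
  sum_eq_one : ∀ x, ∑ᶠ (y : X) (_ : T y = x), w y = 1
  holder : ∀ y y', dist (T y) (T y') < ξ → dist y y' ≤ γ⁻¹ * dist (T y) (T y') →
    |w y - w y'| ≤ K * dist (T y) (T y') ^ α

section Step

variable {α ξ γ η K : ℝ} {D : ℕ} {T : X → X} {w f : X → ℝ}

theorem IsFiberStep.exists_fiber (h : IsFiberStep α ξ γ η K D T w) (hξ : 0 < ξ) (x : X) :
    ∃ (k : ℕ) (y : Fin k → X), (∀ i, T (y i) = x) ∧ (∀ z, T z = x → ∃ i, y i = z) ∧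
      (∑ i, w (y i) = 1) ∧ ∀ f : X → ℝ, avgOp T w f x = ∑ i, w (y i) * f (y i) := by
  obtain ⟨k, y, -, -, hy, -, hr, -, -⟩ := h.pairing x x (by simpa using hξ)
  refine ⟨k, y, fun i => ?_, fun z hz => ?_, ?_, fun f => finsum_fiber_eq_sum hy hr _⟩
  · have : y i ∈ T ⁻¹' {x} := hr ▸ Set.mem_range_self i
    exact this
  · have : z ∈ Set.range y := hr ▸ hz
    exact this
  · rw [← h.sum_eq_one x, finsum_fiber_eq_sum hy hr]

/-- An average with values at most `b` is pulled down by a single preimage with the smaller value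
`b'`, because that preimage carries weight at least `η`. -/
theorem IsFiberStep.avgOp_le (h : IsFiberStep α ξ γ η K D T w) (hξ : 0 < ξ) (hη : 0 ≤ η)
    {b b' : ℝ} (hf : ∀ x, f x ≤ b) {y : X} (hy : f y ≤ b') (hb : b' ≤ b) :
    avgOp T w f (T y) ≤ b - η * (b - b') := by
  obtain ⟨k, z, -, hz2, hz3, hz4⟩ := h.exists_fiber hξ (T y)
  obtain ⟨i, rfl⟩ := hz2 y rfl
  rw [hz4 f]
  have h1 : ∑ j, w (z j) * f (z j) = b - ∑ j, w (z j) * (b - f (z j)) := by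
    simp only [mul_sub, Finset.sum_sub_distrib, ← Finset.sum_mul, hz3]; ring
  have h2 : w (z i) * (b - f (z i)) ≤ ∑ j, w (z j) * (b - f (z j)) :=
    Finset.single_le_sum (f := fun j => w (z j) * (b - f (z j)))
      (fun j _ => mul_nonneg (hη.trans (h.lower _)) (sub_nonneg.2 (hf _))) (Finset.mem_univ i)
  have h3 : η * (b - b') ≤ w (z i) * (b - f (z i)) :=
    mul_le_mul (h.lower _) (by linarith) (by linarith) (hη.trans (h.lower _))
  linarith

theorem IsFiberStep.avgOp_le_const (h : IsFiberStep α ξ γ η K D T w) (hξ : 0 < ξ) (hη : 0 ≤ η)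
    {b : ℝ} (hf : ∀ x, f x ≤ b) (x : X) : avgOp T w f x ≤ b := by
  obtain ⟨k, z, -, -, hz3, hz4⟩ := h.exists_fiber hξ x
  rw [hz4 f]
  calc _ ≤ ∑ j, w (z j) * b := Finset.sum_le_sum fun j _ =>
        mul_le_mul_of_nonneg_left (hf _) (hη.trans (h.lower _))
    _ = b := by rw [← Finset.sum_mul, hz3, one_mul]

theorem IsFiberStep.le_avgOp (h : IsFiberStep α ξ γ η K D T w) (hξ : 0 < ξ) (hη : 0 ≤ η)
    {b : ℝ} (hf : ∀ x, b ≤ f x) (x : X) : b ≤ avgOp T w f x := by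
  obtain ⟨k, z, -, -, hz3, hz4⟩ := h.exists_fiber hξ x
  rw [hz4 f]
  calc b = ∑ j, w (z j) * b := by rw [← Finset.sum_mul, hz3, one_mul]
    _ ≤ _ := Finset.sum_le_sum fun j _ =>
        mul_le_mul_of_nonneg_left (hf _) (hη.trans (h.lower _))

theorem IsFiberStep.oscLE (h : IsFiberStep α ξ γ η K D T w) (hξ : 0 < ξ) (hη : 0 ≤ η) {a : ℝ}
    (hf : OscLE a f) : OscLE a (avgOp T w f) := fun x x' => by
  have : Nonempty X := ⟨x⟩
  obtain ⟨m, h1, h2, -⟩ := hf.exists_bounds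
  have hlo := h.le_avgOp hξ hη h1
  have hhi := h.avgOp_le_const hξ hη h2
  rw [abs_le]
  constructor <;> linarith [hlo x', hhi x', hlo x, hhi x]

/-- The Lasota-Yorke inequality. -/
theorem IsFiberStep.locHolder (h : IsFiberStep α ξ γ η K D T w) (hα : 0 < α)
    (hγ : 1 < γ) (hη : 0 ≤ η) (hK : 0 ≤ K) {a v : ℝ} (ha : 0 ≤ a) (hv : 0 ≤ v)
    (hf : OscLE a f) (hfv : LocHolder α ξ v f) :
    LocHolder α ξ (γ⁻¹ ^ α * v + D * K * a) (avgOp T w f) := fun x x' hx => by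
  obtain ⟨k, y, y', hkD, hy, hy', hr, hr', hd⟩ := h.pairing x x' hx
  have hγ1 : γ⁻¹ ≤ 1 := inv_le_one_of_one_le₀ hγ.le
  have hγ0 : 0 ≤ γ⁻¹ := by positivity
  have hTy : ∀ i, T (y i) = x := fun i => by
    have : y i ∈ T ⁻¹' {x} := hr ▸ Set.mem_range_self i
    exact this
  have hTy' : ∀ i, T (y' i) = x' := fun i => by
    have : y' i ∈ T ⁻¹' {x'} := hr' ▸ Set.mem_range_self i
    exact this
  have hs : ∑ i, w (y i) = 1 := by rw [← h.sum_eq_one x, finsum_fiber_eq_sum hy hr]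
  have hs' : ∑ i, w (y' i) = 1 := by rw [← h.sum_eq_one x', finsum_fiber_eq_sum hy' hr']
  have e1 : avgOp T w f x = ∑ i, w (y i) * f (y i) := finsum_fiber_eq_sum hy hr _
  have e2 : avgOp T w f x' = ∑ i, w (y' i) * f (y' i) := finsum_fiber_eq_sum hy' hr' _
  -- Both families of weights sum to `1`, so the constant `f x` can be subtracted in the second sum.
  -- It is then controlled by the oscillation of `f` and not by its size.
  have e3 : avgOp T w f x - avgOp T w f x' = ∑ i, w (y i) * (f (y i) - f (y' i)) +
      ∑ i, (w (y i) - w (y' i)) * (f (y' i) - f x) := by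
    rw [e1, e2]
    simp only [mul_sub, sub_mul, Finset.sum_sub_distrib, ← Finset.sum_mul, hs, hs']
    ring
  have hdist : ∀ i, dist (y i) (y' i) < ξ := fun i =>
    (hd i).trans_lt ((mul_le_of_le_one_left dist_nonneg hγ1).trans_lt hx)
  rw [e3, add_mul]
  refine (abs_add_le _ _).trans (add_le_add ?_ ?_)
  · refine (Finset.abs_sum_le_sum_abs _ _).trans ?_
    calc ∑ i, |w (y i) * (f (y i) - f (y' i))| ≤
        ∑ i, w (y i) * (γ⁻¹ ^ α * v * dist x x' ^ α) := Finset.sum_le_sum fun i _ => by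
          rw [abs_mul, abs_of_nonneg (hη.trans (h.lower _))]
          refine mul_le_mul_of_nonneg_left ?_ (hη.trans (h.lower _))
          refine (hfv _ _ (hdist i)).trans ?_
          have := Real.rpow_le_rpow dist_nonneg (hd i) hα.le
          rw [Real.mul_rpow hγ0 dist_nonneg] at this
          nlinarith
      _ = _ := by rw [← Finset.sum_mul, hs, one_mul]
  · refine (Finset.abs_sum_le_sum_abs _ _).trans ?_
    have hp : 0 ≤ dist x x' ^ α := Real.rpow_nonneg dist_nonneg _
    calc ∑ i, |(w (y i) - w (y' i)) * (f (y' i) - f x)| ≤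
        ∑ _i : Fin k, K * dist x x' ^ α * a := Finset.sum_le_sum fun i _ => by
          rw [abs_mul]
          refine mul_le_mul ?_ (hf _ _) (abs_nonneg _) (by positivity)
          have := h.holder (y i) (y' i) (by rw [hTy, hTy']; exact hx)
            (by rw [hTy, hTy']; exact hd i)
          rwa [hTy, hTy'] at this
      _ = k * (K * dist x x' ^ α * a) := by simp
      _ ≤ D * (K * dist x x' ^ α * a) := by
          have : (k : ℝ) ≤ D := by exact_mod_cast hkD
          exact mul_le_mul_of_nonneg_right this (by positivity)
      _ = _ := by ring

end Step

end Averaging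

/-! ### Contraction of oscillations along sequences of maps -/

section Contraction

variable {X : Type*} [MetricSpace X] {α ξ γ η K : ℝ} {D : ℕ} {T : ℕ → X → X} {w : ℕ → X → ℝ}
  {f : X → ℝ}

/-- Iterating the Lasota-Yorke inequality sums a geometric series; the coefficient of `a` is its
fixed point. -/
theorem iterAvg_oscLE_locHolder (h : ∀ j, IsFiberStep α ξ γ η K D (T j) (w j)) (hα : 0 < α)
    (hξ : 0 < ξ) (hγ : 1 < γ) (hη : 0 ≤ η) (hK : 0 ≤ K) {a v : ℝ} (ha : 0 ≤ a) (hv : 0 ≤ v)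
    (hf : OscLE a f) (hfv : LocHolder α ξ v f) (n : ℕ) :
    OscLE a (iterAvg T w f n) ∧
      LocHolder α ξ ((γ⁻¹ ^ α) ^ n * v + D * K / (1 - γ⁻¹ ^ α) * a) (iterAvg T w f n) := by
  have hκ0 : 0 < γ⁻¹ ^ α := by positivity
  have hκ1 : γ⁻¹ ^ α < 1 := Real.rpow_lt_one (by positivity) (inv_lt_one_of_one_lt₀ hγ) hα
  have hκ : 0 < 1 - γ⁻¹ ^ α := by linarith
  induction n with
  | zero =>
    refine ⟨hf, hfv.mono ?_⟩
    have : 0 ≤ D * K / (1 - γ⁻¹ ^ α) * a := by positivity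
    simpa using this
  | succ n ih =>
    refine ⟨(h n).oscLE hξ hη ih.1, ?_⟩
    refine ((h n).locHolder hα hγ hη hK ha (by positivity) ih.1 ih.2).mono (le_of_eq ?_)
    have hcancel : (D * K / (1 - γ⁻¹ ^ α)) * (1 - γ⁻¹ ^ α) = D * K := div_mul_cancel₀ _ hκ.ne'
    linear_combination (-a) * hcancel

theorem iterAvg_le (h : ∀ j, IsFiberStep α ξ γ η K D (T j) (w j)) (hξ : 0 < ξ) (hη : 0 ≤ η)
    {b b' : ℝ} (hf : ∀ x, f x ≤ b) {y : X} (hy : f y ≤ b') (hb : b' ≤ b) (n : ℕ) :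
    (∀ x, iterAvg T w f n x ≤ b) ∧
      iterAvg T w f n (seqIter T n y) ≤ b - η ^ n * (b - b') := by
  induction n with
  | zero => exact ⟨hf, by simpa [iterAvg, seqIter] using hy⟩
  | succ n ih =>
    refine ⟨(h n).avgOp_le_const hξ hη ih.1, ?_⟩
    have h0 : 0 ≤ η ^ n * (b - b') := mul_nonneg (pow_nonneg hη n) (by linarith)
    have := (h n).avgOp_le hξ hη ih.1 ih.2 (by linarith)
    refine this.trans (le_of_eq ?_)
    ring

theorem le_iterAvg (h : ∀ j, IsFiberStep α ξ γ η K D (T j) (w j)) (hξ : 0 < ξ) (hη : 0 ≤ η)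
    {b : ℝ} (hf : ∀ x, b ≤ f x) (n : ℕ) (x : X) : b ≤ iterAvg T w f n x := by
  induction n generalizing x with
  | zero => exact hf x
  | succ n ih => exact (h n).le_avgOp hξ hη ih x

/-- The pairing property of the maps. -/
def IsPaired (ξ γ : ℝ) (D : ℕ) (T : X → X) : Prop :=
  ∀ x x' : X, dist x x' < ξ →
    ∃ (k : ℕ) (y y' : Fin k → X), k ≤ D ∧ Function.Injective y ∧ Function.Injective y' ∧
      Set.range y = T ⁻¹' {x} ∧ Set.range y' = T ⁻¹' {x'} ∧
      ∀ i, dist (y i) (y' i) ≤ γ⁻¹ * dist x x'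

/-- Going backwards, the pairing selects at each step the inverse branch that follows the orbit of
`z`; each branch contracts by `γ⁻¹`, so the distance stays below `ξ` and the pairing can be used
again. -/
theorem exists_preimage_near (h : ∀ j, IsPaired ξ γ D (T j)) (hγ : 1 < γ) (n : ℕ) (z x : X)
    (hx : dist x (seqIter T n z) < ξ) :
    ∃ y, seqIter T n y = x ∧ dist y z ≤ γ⁻¹ ^ n * dist x (seqIter T n z) := by
  induction n generalizing x with
  | zero => exact ⟨x, rfl, by simp [seqIter]⟩
  | succ n ih =>
    have hγ1 : γ⁻¹ ≤ 1 := inv_le_one_of_one_le₀ hγ.le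
    obtain ⟨k, y, y', -, -, -, hr, hr', hd⟩ := h n x (seqIter T (n + 1) z) hx
    have hz : seqIter T n z ∈ Set.range y' := by rw [hr']; rfl
    obtain ⟨i, hi⟩ := hz
    have hyi : T n (y i) = x := by
      have : y i ∈ T n ⁻¹' {x} := hr ▸ Set.mem_range_self i
      exact this
    have hdi := hd i
    rw [hi] at hdi
    obtain ⟨p, hp1, hp2⟩ := ih (y i)
      (hdi.trans_lt ((mul_le_of_le_one_left dist_nonneg hγ1).trans_lt hx))
    refine ⟨p, by rw [seqIter, Function.comp_apply, hp1, hyi], hp2.trans ?_⟩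
    rw [pow_succ, mul_assoc]
    exact mul_le_mul_of_nonneg_left hdi (by positivity)

/-- Exactness at scale `ξ` gives exactness at all smaller scales. -/
theorem exists_preimage_in_small_ball (h : ∀ j, IsPaired ξ γ D (T j)) (hγ : 1 < γ) {n₀ : ℕ}
    (hex : ∀ j x, seqIter (fun i => T (j + i)) n₀ '' Metric.ball x ξ = Set.univ) (p : ℕ) (z x : X) :
    ∃ y, seqIter T (p + n₀) y = x ∧ dist y z ≤ γ⁻¹ ^ p * ξ := by
  have hx : x ∈ seqIter (fun i => T (p + i)) n₀ '' Metric.ball (seqIter T p z) ξ := by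
    rw [hex]; trivial
  obtain ⟨x', hx', hxx'⟩ := hx
  obtain ⟨y, hy, hyz⟩ := exists_preimage_near h hγ p z x' hx'
  refine ⟨y, by rw [seqIter_add, hy, hxx'], hyz.trans ?_⟩
  have : dist x' (seqIter T p z) ≤ ξ := le_of_lt hx'
  exact mul_le_mul_of_nonneg_left this (by positivity)

/-- Scales at which a Hölder function with constant `v` varies by at most `e`. -/
theorem exists_small_scale (hα : 0 < α) (hξ : 0 < ξ) (hγ : 1 < γ) {v e : ℝ} (hv : 0 ≤ v)
    (he : 0 < e) :
    ∃ p₀ : ℕ, ∀ p, p₀ ≤ p → γ⁻¹ ^ p * ξ < ξ ∧ ∀ r : ℝ, 0 ≤ r → r ≤ γ⁻¹ ^ p * ξ → v * r ^ α ≤ e := by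
  have hγ1 : γ⁻¹ < 1 := inv_lt_one_of_one_lt₀ hγ
  have hγ0 : 0 ≤ γ⁻¹ := by positivity
  have h1 : Tendsto (fun p : ℕ => γ⁻¹ ^ p * ξ) atTop (𝓝 0) := by
    simpa using (tendsto_pow_atTop_nhds_zero_of_lt_one hγ0 hγ1).mul_const ξ
  have h2 : Tendsto (fun p : ℕ => v * (γ⁻¹ ^ p * ξ) ^ α) atTop (𝓝 0) := by
    simpa [Real.zero_rpow hα.ne'] using (h1.rpow_const (Or.inr hα.le)).const_mul v
  obtain ⟨p₀, hp₀⟩ := eventually_atTop.1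
    ((h1.eventually_lt_const hξ).and (h2.eventually_le_const he))
  refine ⟨p₀, fun p hp => ⟨(hp₀ p hp).1, fun r hr hrp => ?_⟩⟩
  exact (mul_le_mul_of_nonneg_left (Real.rpow_le_rpow hr hrp hα.le) hv).trans (hp₀ p hp).2

/-- After `q` steps the class of functions with oscillation at most `a` and Hölder constant at most
`Λ a` is mapped to the class with `τ a` in place of `a`. -/
theorem exists_contraction (X : Type*) [MetricSpace X] (hα : 0 < α) (hξ : 0 < ξ) (hγ : 1 < γ)
    (hη : 0 < η) (hη1 : η ≤ 1) (hK : 0 ≤ K) (D n₀ : ℕ) :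
    ∃ (Λ τ : ℝ) (q : ℕ), 0 < Λ ∧ 0 < τ ∧ τ < 1 ∧ 1 ≤ q ∧
      ∀ (T : ℕ → X → X) (w : ℕ → X → ℝ), (∀ j, IsFiberStep α ξ γ η K D (T j) (w j)) →
      (∀ j x, seqIter (fun i => T (j + i)) n₀ '' Metric.ball x ξ = Set.univ) →
      ∀ (f : X → ℝ) (a : ℝ), 0 ≤ a → OscLE a f → LocHolder α ξ (Λ * a) f →
        OscLE (τ * a) (iterAvg T w f q) ∧ LocHolder α ξ (Λ * (τ * a)) (iterAvg T w f q) := by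
  have hκ0 : 0 < γ⁻¹ ^ α := by positivity
  have hκ1 : γ⁻¹ ^ α < 1 := Real.rpow_lt_one (by positivity) (inv_lt_one_of_one_lt₀ hγ) hα
  have hκ : 0 < 1 - γ⁻¹ ^ α := by linarith
  set Ks := D * K / (1 - γ⁻¹ ^ α) with hKs
  have hKs0 : 0 ≤ Ks := by positivity
  -- With this `Λ` the inhomogeneous term is at most `Λ * a / 4`, and after `q` steps the old Hölder
  -- constant contributes at most `Λ * a / 2`. The total `3 / 4 * (Λ * a)` fits under `τ * Λ * a`,
  -- since `τ ≥ 3 / 4`.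
  set Λ := 4 * Ks + 1 with hΛ
  have hΛ0 : 0 < Λ := by positivity
  obtain ⟨p₀, hp₀⟩ := exists_small_scale hα hξ hγ hΛ0.le (show (0 : ℝ) < 1 / 4 by norm_num)
  obtain ⟨p₁, hp₁⟩ := eventually_atTop.1 ((tendsto_pow_atTop_nhds_zero_of_lt_one hκ0.le
    hκ1).eventually_le_const (show (0 : ℝ) < 1 / 2 by norm_num))
  set p := max p₀ p₁ + 1 with hp
  obtain ⟨hp1, hp2⟩ := hp₀ p (by omega)
  set q := p + n₀ with hq
  have hq2 : (γ⁻¹ ^ α) ^ q ≤ 1 / 2 := hp₁ q (by omega)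
  have hηq : 0 < η ^ q := by positivity
  have hηq1 : η ^ q ≤ 1 := pow_le_one₀ hη.le hη1
  refine ⟨Λ, 1 - η ^ q / 4, q, hΛ0, by linarith, by linarith, by omega, ?_⟩
  intro T w h hex f a ha hf hfv
  obtain ⟨h1, h2⟩ := iterAvg_oscLE_locHolder h hα hξ hγ hη.le hK ha (by positivity) hf hfv q
  constructor
  · intro x x'
    have : Nonempty X := ⟨x⟩
    rcases ha.eq_or_lt with rfl | ha'
    · simpa using h1 x x'
    obtain ⟨m, hm1, hm2, hm3⟩ := hf.exists_bounds
    obtain ⟨z, hz⟩ := hm3 (a / 4) (by positivity)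
    -- Exactness puts a preimage `y` of `x` so close to the near-minimizer `z` that `f y` lies below
    -- the middle of the range of `f`. The weight of its branch is at least `η ^ q`, which lowers
    -- the maximum by a fixed proportion of `a`.
    have key : ∀ x, iterAvg T w f q x ≤ m + a - η ^ q * (a / 2) := fun x => by
      obtain ⟨y, hy, hyz⟩ := exists_preimage_in_small_ball (fun j => (h j).pairing) hγ hex p z x
      have hfy : f y ≤ m + a / 2 := by
        have := (abs_le.1 (hfv y z (hyz.trans_lt hp1))).2
        have := hp2 (dist y z) dist_nonneg hyz
        nlinarith
      have := (iterAvg_le h hξ hη.le hm2 hfy (by linarith) q).2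
      rw [hq, hy] at this
      rw [hq]
      refine this.trans (le_of_eq ?_)
      ring
    have hl := le_iterAvg h hξ hη.le hm1 q
    rw [abs_le]
    constructor <;> nlinarith [key x, key x', hl x, hl x']
  · refine h2.mono ?_
    rw [← hKs]
    have e1 : (γ⁻¹ ^ α) ^ q * (Λ * a) ≤ 1 / 2 * (Λ * a) :=
      mul_le_mul_of_nonneg_right hq2 (by positivity)
    have e2 : Ks * a ≤ 1 / 4 * (Λ * a) := by rw [hΛ]; nlinarith
    have e3 : 3 / 4 * (Λ * a) ≤ (1 - η ^ q / 4) * (Λ * a) :=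
      mul_le_mul_of_nonneg_right (by linarith) (by positivity)
    linarith

/-- Exponential decay of oscillations. -/
theorem exists_oscLE_decay (X : Type*) [MetricSpace X] (hα : 0 < α) (hξ : 0 < ξ) (hγ : 1 < γ)
    (hη : 0 < η) (hη1 : η ≤ 1) (hK : 0 ≤ K) (D n₀ : ℕ) :
    ∃ (C τ : ℝ), 0 < C ∧ 0 < τ ∧ τ < 1 ∧
      ∀ (T : ℕ → X → X) (w : ℕ → X → ℝ), (∀ j, IsFiberStep α ξ γ η K D (T j) (w j)) →
      (∀ j x, seqIter (fun i => T (j + i)) n₀ '' Metric.ball x ξ = Set.univ) →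
      ∀ (f : X → ℝ) (a : ℝ), 0 ≤ a → OscLE a f → LocHolder α ξ a f → ∀ n,
        OscLE (C * τ ^ n * a) (iterAvg T w f n) := by
  obtain ⟨Λ, τ, q, hΛ, hτ0, hτ1, hq, hcon⟩ := exists_contraction X hα hξ hγ hη hη1 hK D n₀
  have hq0 : (0 : ℝ) < q := by exact_mod_cast hq
  -- Raising the level from `a` to `C₀ * a` brings a function with Hölder constant `a` into the
  -- contracted class, even if `Λ < 1`.
  set C₀ := max 1 Λ⁻¹ with hC₀
  have hC₀1 : 1 ≤ C₀ := le_max_left _ _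
  have hC₀Λ : 1 ≤ Λ * C₀ := by
    have : Λ⁻¹ ≤ C₀ := le_max_right _ _
    calc 1 = Λ * Λ⁻¹ := by field_simp
      _ ≤ _ := mul_le_mul_of_nonneg_left this hΛ.le
  refine ⟨τ⁻¹ * C₀, τ ^ (1 / (q : ℝ)), by positivity, by positivity,
    Real.rpow_lt_one hτ0.le hτ1 (by positivity), fun T w h hex f a ha hf hfv n => ?_⟩
  have main : ∀ i : ℕ, OscLE (τ ^ i * (C₀ * a)) (iterAvg T w f (i * q)) ∧
      LocHolder α ξ (Λ * (τ ^ i * (C₀ * a))) (iterAvg T w f (i * q)) := fun i => by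
    induction i with
    | zero =>
      simp only [zero_mul, pow_zero, one_mul, iterAvg]
      refine ⟨fun x x' => (hf x x').trans (le_mul_of_one_le_left ha hC₀1), hfv.mono ?_⟩
      rw [← mul_assoc]
      exact le_mul_of_one_le_left ha hC₀Λ
    | succ i ih =>
      have := hcon (fun j => T (i * q + j)) (fun j => w (i * q + j)) (fun j => h _)
        (fun j x => by simpa only [add_assoc] using hex (i * q + j) x) _ _
        (by positivity) ih.1 ih.2
      rw [Nat.succ_mul, iterAvg_add, pow_succ', mul_assoc]
      exact this
  have hn : n = n / q * q + n % q := (Nat.div_add_mod' n q).symm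
  have hosc : OscLE (τ ^ (n / q) * (C₀ * a)) (iterAvg T w f n) := by
    rw [hn, iterAvg_add]
    rw [show (n / q * q + n % q) / q = n / q by rw [← hn]]
    exact (iterAvg_oscLE_locHolder (fun j => h _) hα hξ hγ hη.le hK (by positivity)
      (by positivity) (main _).1 (main _).2 _).1
  -- The factor `τ⁻¹` pays for rounding `n / q` down.
  have hpow : τ ^ (n / q) ≤ τ⁻¹ * (τ ^ (1 / (q : ℝ))) ^ n := by
    have hlt : n < (n / q + 1) * q := by
      have := Nat.mod_lt n hq
      nlinarith
    have hlt' : (n : ℝ) / q ≤ (n / q : ℕ) + 1 := by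
      rw [div_le_iff₀ hq0]
      exact_mod_cast hlt.le
    calc τ ^ (n / q) = τ⁻¹ * τ ^ (((n / q : ℕ) : ℝ) + 1) := by
          rw [Real.rpow_add hτ0, Real.rpow_natCast, Real.rpow_one]; field_simp
      _ ≤ τ⁻¹ * τ ^ ((n : ℝ) / q) :=
          mul_le_mul_of_nonneg_left (Real.rpow_le_rpow_of_exponent_ge hτ0 hτ1.le hlt')
            (by positivity)
      _ = _ := by
          rw [← Real.rpow_natCast (τ ^ (1 / (q : ℝ))), ← Real.rpow_mul hτ0.le]
          congr 2; ring
  intro x x'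
  refine (hosc x x').trans ?_
  calc τ ^ (n / q) * (C₀ * a) ≤ (τ⁻¹ * (τ ^ (1 / (q : ℝ))) ^ n) * (C₀ * a) :=
        mul_le_mul_of_nonneg_right hpow (by positivity)
    _ = _ := by ring

end Contraction

/-! ### Bounded Hölder functions -/

section HolderBdd

variable {X : Type*} [MetricSpace X] {α ξ : ℝ}

/-- `|f| ≤ b` and `v_{α,ξ}(f) ≤ b`. -/
structure HolderBdd (α ξ b : ℝ) (f : X → ℝ) : Prop where
  bound : ∀ x, |f x| ≤ b
  locHolder : LocHolder α ξ b f

theorem norm_le_of_holderNorm_le {g : X → ℝ} {C : ℝ≥0∞} (h : holderNorm α ξ g ≤ C) (x : X) :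
    ‖g x‖ₑ ≤ C :=
  (le_iSup (fun x => ‖g x‖ₑ) x).trans (le_self_add.trans h)

theorem holderBdd_of_holderNorm_le {g : X → ℝ} {C : ℝ≥0} (h : holderNorm α ξ g ≤ C) :
    HolderBdd α ξ C g := by
  constructor
  · intro x
    have := norm_le_of_holderNorm_le h x
    rw [← ofReal_norm, ENNReal.ofReal_le_coe] at this
    exact_mod_cast this
  · intro x x' hx
    have hv : holderVar α ξ g ≤ C := le_add_self.trans h
    have hd : 0 ≤ dist x x' ^ α := Real.rpow_nonneg dist_nonneg _
    -- The infimum defining `holderVar` is approached by admissible constants below `C + e`; the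
    -- bound with `C` itself follows as `e → 0`.
    have key : ∀ e : ℝ, 0 < e → |g x - g x'| ≤ (C + e) * dist x x' ^ α := fun e he => by
      have hlt : holderVar α ξ g < ((C + e.toNNReal : ℝ≥0) : ℝ≥0∞) :=
        hv.trans_lt (by
          rw [ENNReal.coe_lt_coe]
          exact lt_add_of_pos_right _ (Real.toNNReal_pos.2 he))
      rw [holderVar, iInf_lt_iff] at hlt
      obtain ⟨R, hR⟩ := hlt
      rw [iInf_lt_iff] at hR
      obtain ⟨hR1, hR2⟩ := hR
      rw [ENNReal.coe_lt_coe, ← NNReal.coe_lt_coe] at hR2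
      push_cast at hR2
      rw [Real.coe_toNNReal _ he.le] at hR2
      exact (hR1 x x' hx).trans (mul_le_mul_of_nonneg_right hR2.le hd)
    have hlim : Tendsto (fun e : ℝ => (C + e) * dist x x' ^ α) (𝓝[>] 0)
        (𝓝 (C * dist x x' ^ α)) := by
      have : Tendsto (fun e : ℝ => (C + e) * dist x x' ^ α) (𝓝 0)
          (𝓝 ((C + 0) * dist x x' ^ α)) :=
        (tendsto_const_nhds.add tendsto_id).mul_const _
      rw [add_zero] at this
      exact this.mono_left nhdsWithin_le_nhds
    refine ge_of_tendsto hlim ?_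
    filter_upwards [self_mem_nhdsWithin] with e he using key e he

variable {b b₁ b₂ : ℝ} {f g : X → ℝ}

theorem HolderBdd.mono (h : HolderBdd α ξ b₁ f) (hb : b₁ ≤ b₂) : HolderBdd α ξ b₂ f :=
  ⟨fun x => (h.bound x).trans hb, h.locHolder.mono hb⟩

theorem HolderBdd.mul (hf : HolderBdd α ξ b₁ f) (hg : HolderBdd α ξ b₂ g) (h₁ : 0 ≤ b₁)
    (h₂ : 0 ≤ b₂) : HolderBdd α ξ (2 * b₁ * b₂) fun x => f x * g x := by
  constructor
  · intro x
    rw [abs_mul]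
    have := mul_le_mul (hf.bound x) (hg.bound x) (abs_nonneg _) h₁
    nlinarith [mul_nonneg h₁ h₂]
  · intro x x' hx
    have hd : 0 ≤ dist x x' ^ α := Real.rpow_nonneg dist_nonneg _
    have e : f x * g x - f x' * g x' = f x * (g x - g x') + (f x - f x') * g x' := by ring
    rw [e]
    refine (abs_add_le _ _).trans ?_
    rw [abs_mul, abs_mul]
    have i1 := mul_le_mul (hf.bound x) (hg.locHolder x x' hx) (abs_nonneg _) h₁
    have i2 := mul_le_mul (hf.locHolder x x' hx) (hg.bound x') (abs_nonneg _) (by positivity)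
    linarith

theorem HolderBdd.add (hf : HolderBdd α ξ b₁ f) (hg : HolderBdd α ξ b₂ g) :
    HolderBdd α ξ (b₁ + b₂) fun x => f x + g x := by
  constructor
  · exact fun x => (abs_add_le _ _).trans (add_le_add (hf.bound x) (hg.bound x))
  · intro x x' hx
    rw [add_sub_add_comm, add_mul]
    exact (abs_add_le _ _).trans (add_le_add (hf.locHolder x x' hx) (hg.locHolder x x' hx))

theorem HolderBdd.neg (hf : HolderBdd α ξ b f) : HolderBdd α ξ b fun x => -f x := by
  constructor
  · simpa using hf.bound
  · intro x x' hx
    rw [← neg_sub', abs_neg]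
    exact hf.locHolder x x' hx

theorem HolderBdd.const_mul (hf : HolderBdd α ξ b f) (c : ℝ) :
    HolderBdd α ξ (|c| * b) fun x => c * f x := by
  constructor
  · intro x
    rw [abs_mul]
    exact mul_le_mul_of_nonneg_left (hf.bound x) (abs_nonneg _)
  · intro x x' hx
    rw [← mul_sub, abs_mul, mul_assoc]
    exact mul_le_mul_of_nonneg_left (hf.locHolder x x' hx) (abs_nonneg _)

theorem holderBdd_const (c : ℝ) : HolderBdd α ξ |c| fun _ : X => c := by
  constructor
  · exact fun _ => le_rfl
  · intro x x' _
    simp only [sub_self, abs_zero]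
    positivity

theorem HolderBdd.sub_const (hf : HolderBdd α ξ b₁ f) {c : ℝ} (hc : |c| ≤ b₂) :
    HolderBdd α ξ (b₁ + b₂) fun x => f x - c := by
  simpa [sub_eq_add_neg] using hf.add (((holderBdd_const (-c)).mono (by simpa using hc)))

theorem HolderBdd.inv (hf : HolderBdd α ξ b f) {c : ℝ} (hc : 0 < c) (hcf : ∀ x, c ≤ f x)
    (hb : 0 ≤ b) : HolderBdd α ξ (c⁻¹ + b * (c⁻¹ * c⁻¹)) fun x => (f x)⁻¹ := by
  have hpos : ∀ x, 0 < f x := fun x => hc.trans_le (hcf x)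
  have hi : ∀ x, (f x)⁻¹ ≤ c⁻¹ := fun x => inv_anti₀ hc (hcf x)
  constructor
  · intro x
    rw [abs_of_pos (inv_pos.2 (hpos x))]
    have : 0 ≤ b * (c⁻¹ * c⁻¹) := by positivity
    linarith [hi x]
  · intro x x' hx
    have hd : 0 ≤ dist x x' ^ α := Real.rpow_nonneg dist_nonneg _
    have e : (f x)⁻¹ - (f x')⁻¹ = (f x' - f x) * ((f x)⁻¹ * (f x')⁻¹) := by
      have := (hpos x).ne'
      have := (hpos x').ne'
      field_simp
    rw [e, abs_mul, abs_sub_comm,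
      abs_of_pos (mul_pos (inv_pos.2 (hpos x)) (inv_pos.2 (hpos x')))]
    have i1 : (f x)⁻¹ * (f x')⁻¹ ≤ c⁻¹ * c⁻¹ :=
      mul_le_mul (hi x) (hi x') (inv_pos.2 (hpos x')).le (by positivity)
    have i2 := mul_le_mul (hf.locHolder x x' hx) i1
      (mul_pos (inv_pos.2 (hpos x)) (inv_pos.2 (hpos x'))).le (by positivity)
    refine i2.trans ?_
    have : 0 ≤ c⁻¹ * dist x x' ^ α := by positivity
    linarith

theorem HolderBdd.exp (hf : HolderBdd α ξ b f) (hb : 0 ≤ b) :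
    HolderBdd α ξ (Real.exp b * (1 + b)) fun x => Real.exp (f x) := by
  constructor
  · intro x
    rw [abs_of_pos (Real.exp_pos _)]
    have := Real.exp_le_exp.2 ((le_abs_self _).trans (hf.bound x))
    nlinarith [Real.exp_pos b]
  · intro x x' hx
    have hd : 0 ≤ dist x x' ^ α := Real.rpow_nonneg dist_nonneg _
    have key : ∀ s t : ℝ, s ≤ b → t ≤ b → Real.exp s - Real.exp t ≤ Real.exp b * |s - t| := by
      intro s t hs _
      have h1 : Real.exp s - Real.exp t = Real.exp s * (1 - Real.exp (t - s)) := by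
        rw [mul_sub, ← Real.exp_add]; ring_nf
      have h2 : 1 - Real.exp (t - s) ≤ |s - t| := by
        linarith [Real.add_one_le_exp (t - s), le_abs_self (s - t)]
      rw [h1]
      exact (mul_le_mul_of_nonneg_left h2 (Real.exp_pos _).le).trans
        (mul_le_mul_of_nonneg_right (Real.exp_le_exp.2 hs) (abs_nonneg _))
    have hx1 := (le_abs_self _).trans (hf.bound x)
    have hx2 := (le_abs_self _).trans (hf.bound x')
    have h3 : |Real.exp (f x) - Real.exp (f x')| ≤ Real.exp b * |f x - f x'| := by
      rw [abs_le]
      have := key _ _ hx1 hx2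
      have := key _ _ hx2 hx1
      rw [abs_sub_comm] at this
      constructor <;> linarith
    refine h3.trans ?_
    have := mul_le_mul_of_nonneg_left (hf.locHolder x x' hx) (Real.exp_pos b).le
    have : 0 ≤ Real.exp b * dist x x' ^ α := by positivity
    nlinarith

theorem HolderBdd.measurable [MeasurableSpace X] [BorelSpace X] (hf : HolderBdd α ξ b f)
    (hα : 0 < α) (hξ : 0 < ξ) : Measurable f := (hf.locHolder.continuous hα hξ).measurable

theorem HolderBdd.oscLE (hf : HolderBdd α ξ b f) : OscLE (2 * b) f := fun x x' => by
  refine (abs_sub _ _).trans ?_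
  linarith [hf.bound x, hf.bound x']

end HolderBdd

/-! ### Consequences of the standing assumptions along a typical orbit -/

section Orbit

theorem fiberIter_eq_seqIter {Y X : Type*} (T : (ℤ → Y) → X → X) (n : ℕ) (ω : ℤ → Y) :
    fiberIter shift T n ω = seqIter (fun j => T (shiftBy j ω)) n := by
  induction n with
  | zero => rfl
  | succ n ih => simp only [fiberIter, seqIter, ih, iterate_shift]

/-- The constants of the standing assumptions. -/
structure Params where
  (α ξ γ C m M : ℝ)
  (D n₀ : ℕ)
  alpha_pos : 0 < α
  xi_pos : 0 < ξ
  one_lt_gamma : 1 < γ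
  one_le_C : 1 ≤ C
  m_pos : 0 < m

variable {Y X : Type*} [MetricSpace X] [MeasurableSpace X]

/-- The almost sure properties of the system, with explicit constants, at a single `ω`. -/
structure IsTypical (p : Params) (T : (ℤ → Y) → X → X) (φ u : (ℤ → Y) → X → ℝ)
    (lam : (ℤ → Y) → ℝ) (h : (ℤ → Y) → X → ℝ) (ν : (ℤ → Y) → Measure X) (μ : Measure X)
    (r : (ℤ → Y) → X → ℝ) (ω : ℤ → Y) : Prop where
  continuous_map : Continuous (T ω)
  exact : ∀ x, fiberIter shift T p.n₀ ω '' Metric.ball x p.ξ = Set.univ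
  paired : IsPaired p.ξ p.γ p.D (T ω)
  holder_phi : HolderBdd p.α p.ξ p.C (φ ω)
  holder_u : HolderBdd p.α p.ξ p.C (u ω)
  lam_pos : 0 < lam ω
  h_pos : ∀ x, 0 < h ω x
  holder_h : HolderBdd p.α p.ξ p.C (h ω)
  nu_prob : IsProbabilityMeasure (ν ω)
  h_eq : ∀ x, transferOp T φ u 0 ω (fun y => (h ω y : ℂ)) x = (lam ω : ℂ) * (h (shift ω) x : ℂ)
  nu_eq : ∀ g : X → ℂ, Measurable g → (∃ C : ℝ, ∀ x, ‖g x‖ ≤ C) →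
    ∫ x, transferOp T φ u 0 ω g x ∂(ν (shift ω)) = (lam ω : ℂ) * ∫ x, g x ∂(ν ω)
  nu_h : ∫ x, h ω x ∂(ν ω) = 1
  r_mem : ∀ x, r ω x ∈ Set.Ioo p.m p.M
  holder_r : HolderBdd p.α p.ξ p.C (r ω)
  gibbs_eq : gibbs h ν ω = μ.withDensity fun x => ENNReal.ofReal (r ω x)

/-- All almost sure hypotheses are collected with common constants and transported along the whole
orbit by invariance of `P`. Negative times are included because the Gibbs measures are reconstructed
from the past. -/
theorem exists_isTypical [MeasurableSpace Y] {P : Measure (ℤ → Y)}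
    (hmp : ∀ m : ℤ, MeasurePreserving (shiftBy m) P P)
    {T : (ℤ → Y) → X → X} {φ u : (ℤ → Y) → X → ℝ} {α ξ : ℝ}
    (hsys : IsExpandingSystem P shift T φ u α ξ)
    {lam : (ℤ → Y) → ℝ} {h : (ℤ → Y) → X → ℝ} {ν : (ℤ → Y) → Measure X}
    (hRPF : IsRPFTriplet P shift T φ u α ξ lam h ν)
    {μ : Measure X} (hμ : HasCommonReference P α ξ h ν μ) :
    ∃ (p : Params) (r : (ℤ → Y) → X → ℝ), p.α = α ∧ p.ξ = ξ ∧
      ∀ᵐ ω ∂P, ∀ j : ℤ, IsTypical p T φ u lam h ν μ r (shiftBy j ω) := by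
  obtain ⟨n₀, hex⟩ := hsys.exact
  obtain ⟨D, γ, hγ, hpair⟩ := hsys.pairing
  obtain ⟨C₁, hφ⟩ := hsys.bounded_phi
  obtain ⟨C₂, hu⟩ := hsys.bounded_u
  obtain ⟨C₃, hh⟩ := hRPF.h_bounded
  obtain ⟨r, m, M, C₄, hm, hr⟩ := hμ
  have hC₁ : (C₁ : ℝ) ≤ 1 + C₁ + C₂ + C₃ + C₄ := by
    linarith [C₂.coe_nonneg, C₃.coe_nonneg, C₄.coe_nonneg]
  have hC₂ : (C₂ : ℝ) ≤ 1 + C₁ + C₂ + C₃ + C₄ := by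
    linarith [C₁.coe_nonneg, C₃.coe_nonneg, C₄.coe_nonneg]
  have hC₃ : (C₃ : ℝ) ≤ 1 + C₁ + C₂ + C₃ + C₄ := by
    linarith [C₂.coe_nonneg, C₁.coe_nonneg, C₄.coe_nonneg]
  have hC₄ : (C₄ : ℝ) ≤ 1 + C₁ + C₂ + C₃ + C₄ := by
    linarith [C₂.coe_nonneg, C₃.coe_nonneg, C₁.coe_nonneg]
  let p : Params :=
    { α := α, ξ := ξ, γ := γ, C := 1 + C₁ + C₂ + C₃ + C₄, m := m, M := M, D := D, n₀ := n₀
      alpha_pos := hsys.alpha_pos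
      xi_pos := hsys.xi_pos
      one_lt_gamma := hγ
      one_le_C := by linarith [C₁.coe_nonneg, C₂.coe_nonneg, C₃.coe_nonneg, C₄.coe_nonneg]
      m_pos := hm }
  refine ⟨p, r, rfl, rfl, ?_⟩
  have key : ∀ᵐ ω ∂P, IsTypical p T φ u lam h ν μ r ω := by
    filter_upwards [hex, hpair, hφ, hu, hh, hr, hRPF.lam_pos, hRPF.h_pos, hRPF.nu_prob, hRPF.h_eq,
      hRPF.nu_eq, hRPF.nu_h] with ω a1 a2 a3 a4 a5 a6 a7 a8 a9 a10 a11 a12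
    exact
      { continuous_map := hsys.continuous_map ω
        exact := a1
        paired := a2
        holder_phi := (holderBdd_of_holderNorm_le a3).mono hC₁
        holder_u := (holderBdd_of_holderNorm_le a4).mono hC₂
        lam_pos := a7
        h_pos := a8
        holder_h := (holderBdd_of_holderNorm_le a5).mono hC₃
        nu_prob := a9
        h_eq := a10
        nu_eq := a11
        nu_h := a12
        r_mem := a6.2.1
        holder_r := (holderBdd_of_holderNorm_le a6.2.2.1).mono hC₄
        gibbs_eq := a6.2.2.2 }
  exact ae_all_iff.2 fun j => (hmp j).quasiMeasurePreserving.ae key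

variable {p : Params} {T : (ℤ → Y) → X → X} {φ u : (ℤ → Y) → X → ℝ}
  {lam : (ℤ → Y) → ℝ} {h : (ℤ → Y) → X → ℝ} {ν : (ℤ → Y) → Measure X} {μ : Measure X}
  {r : (ℤ → Y) → X → ℝ} {ω : ℤ → Y}

/-- The normalized weight `e^{φ_ω} h_ω / (λ_ω h_{θω} ∘ T_ω)`. -/
noncomputable def normWeight (T : (ℤ → Y) → X → X) (φ : (ℤ → Y) → X → ℝ) (lam : (ℤ → Y) → ℝ)
    (h : (ℤ → Y) → X → ℝ) (ω : ℤ → Y) (y : X) : ℝ :=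
  Real.exp (φ ω y) * h ω y * (lam ω * h (shift ω) (T ω y))⁻¹

namespace IsTypical

theorem exists_fiber (hω : IsTypical p T φ u lam h ν μ r ω) (x : X) :
    ∃ (k : ℕ) (y : Fin k → X), k ≤ p.D ∧ Function.Injective y ∧
      Set.range y = T ω ⁻¹' {x} ∧ ∀ i, T ω (y i) = x := by
  obtain ⟨k, y, -, hk, hy, -, hr, -, -⟩ := hω.paired x x (by simpa using p.xi_pos)
  refine ⟨k, y, hk, hy, hr, fun i => ?_⟩
  have : y i ∈ T ω ⁻¹' {x} := hr ▸ Set.mem_range_self i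
  exact this

theorem transferOp_ofReal (hω : IsTypical p T φ u lam h ν μ r ω) (g : X → ℝ) (x : X) :
    transferOp T φ u 0 ω (fun y => (g y : ℂ)) x =
      (avgOp (T ω) (fun y => Real.exp (φ ω y)) g x : ℝ) := by
  obtain ⟨k, y, -, hy, hr, -⟩ := hω.exists_fiber x
  rw [transferOp, avgOp, finsum_fiber_eq_sum hy hr, finsum_fiber_eq_sum hy hr]
  push_cast
  refine Finset.sum_congr rfl fun i _ => ?_
  simp

theorem avgOp_h (hω : IsTypical p T φ u lam h ν μ r ω) (x : X) :
    avgOp (T ω) (fun y => Real.exp (φ ω y)) (h ω) x = lam ω * h (shift ω) x := by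
  have := hω.h_eq x
  rw [hω.transferOp_ofReal] at this
  exact_mod_cast this

theorem integral_avgOp (hω : IsTypical p T φ u lam h ν μ r ω) {g : X → ℝ} (hg : Measurable g)
    {B : ℝ} (hB : ∀ x, |g x| ≤ B) :
    ∫ x, avgOp (T ω) (fun y => Real.exp (φ ω y)) g x ∂(ν (shift ω)) =
      lam ω * ∫ x, g x ∂(ν ω) := by
  have := hω.nu_eq (fun x => (g x : ℂ)) (Complex.measurable_ofReal.comp hg)
    ⟨B, fun x => by simpa using hB x⟩
  simp_rw [hω.transferOp_ofReal] at this
  rw [integral_complex_ofReal, integral_complex_ofReal] at this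
  exact_mod_cast this

/-- Otherwise `1 - h ω` would be strictly positive with integral zero against the probability
measure `ν ω`. This is the only pointwise normalization of `h` used for the two-sided bounds on `λ`
and `h`. -/
theorem exists_one_le_h (hω : IsTypical p T φ u lam h ν μ r ω) : ∃ x, 1 ≤ h ω x := by
  by_contra hcon
  push Not at hcon
  have := hω.nu_prob
  have hint : Integrable (h ω) (ν ω) := by
    by_contra hni
    have := hω.nu_h
    rw [integral_undef hni] at this
    norm_num at this
  have h1 : 0 < ∫ x, (1 - h ω x) ∂(ν ω) := by
    rw [integral_pos_iff_support_of_nonneg (f := fun x => 1 - h ω x)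
      (fun x => (sub_pos.2 (hcon x)).le)
      ((integrable_const _).sub hint)]
    have : Function.support (fun x => 1 - h ω x) = Set.univ := by
      refine Set.eq_univ_of_forall fun x => ?_
      have := hcon x
      exact (by linarith : 0 < 1 - h ω x).ne'
    rw [this]
    simp
  rw [integral_sub (integrable_const _) hint, hω.nu_h] at h1
  simp at h1

end IsTypical

end Orbit

/-! ### Uniform bounds for the triplet and the normalized weights -/

section OrbitBounds

variable {Y X : Type*} [MetricSpace X] [MeasurableSpace X]
  {p : Params} {T : (ℤ → Y) → X → X} {φ u : (ℤ → Y) → X → ℝ}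
  {lam : (ℤ → Y) → ℝ} {h : (ℤ → Y) → X → ℝ} {ν : (ℤ → Y) → Measure X} {μ : Measure X}
  {r : (ℤ → Y) → X → ℝ} {ω : ℤ → Y}

/-- Every point of the orbit of `ω` is typical. -/
def IsTypicalOrbit (p : Params) (T : (ℤ → Y) → X → X) (φ u : (ℤ → Y) → X → ℝ)
    (lam : (ℤ → Y) → ℝ) (h : (ℤ → Y) → X → ℝ) (ν : (ℤ → Y) → Measure X) (μ : Measure X)
    (r : (ℤ → Y) → X → ℝ) (ω : ℤ → Y) : Prop :=
  ∀ j : ℤ, IsTypical p T φ u lam h ν μ r (shiftBy j ω)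

theorem IsTypicalOrbit.shiftBy (hω : IsTypicalOrbit p T φ u lam h ν μ r ω) (m : ℤ) :
    IsTypicalOrbit p T φ u lam h ν μ r (shiftBy m ω) := fun j => by
  rw [shiftBy_shiftBy]; exact hω _

theorem IsTypicalOrbit.self (hω : IsTypicalOrbit p T φ u lam h ν μ r ω) :
    IsTypical p T φ u lam h ν μ r ω := by simpa using hω 0

theorem IsTypicalOrbit.shift (hω : IsTypicalOrbit p T φ u lam h ν μ r ω) :
    IsTypicalOrbit p T φ u lam h ν μ r (shift ω) := hω.shiftBy 1

/-- An upper bound for `λ_ω`. -/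
noncomputable def Params.lamUpper (p : Params) : ℝ := (p.D + 1) * (Real.exp p.C * p.C)

theorem Params.C_pos (p : Params) : 0 < p.C := zero_lt_one.trans_le p.one_le_C

theorem Params.lamUpper_pos (p : Params) : 0 < p.lamUpper := by
  have := p.C_pos
  unfold Params.lamUpper
  positivity

namespace IsTypical

theorem h_le (hω : IsTypical p T φ u lam h ν μ r ω) (x : X) : h ω x ≤ p.C :=
  (le_abs_self _).trans (hω.holder_h.bound x)

theorem exp_le (hω : IsTypical p T φ u lam h ν μ r ω) (x : X) :
    Real.exp (φ ω x) ≤ Real.exp p.C :=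
  Real.exp_le_exp.2 ((le_abs_self _).trans (hω.holder_phi.bound x))

theorem le_exp (hω : IsTypical p T φ u lam h ν μ r ω) (x : X) :
    Real.exp (-p.C) ≤ Real.exp (φ ω x) :=
  Real.exp_le_exp.2 (abs_le.1 (hω.holder_phi.bound x)).1

theorem r_pos (hω : IsTypical p T φ u lam h ν μ r ω) (x : X) : 0 < r ω x :=
  p.m_pos.trans (hω.r_mem x).1

theorem exp_mul_h_le (hω : IsTypical p T φ u lam h ν μ r ω) (y : X) :
    Real.exp (φ ω y) * h ω y ≤ lam ω * h (RandomSkew.shift ω) (T ω y) := by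
  obtain ⟨k, z, -, hz, hr, -⟩ := hω.exists_fiber (T ω y)
  obtain ⟨i, hi⟩ : y ∈ Set.range z := by rw [hr]; rfl
  rw [← hω.avgOp_h, avgOp, finsum_fiber_eq_sum hz hr, ← hi]
  exact Finset.single_le_sum (f := fun j => Real.exp (φ ω (z j)) * h ω (z j))
    (fun j _ => mul_nonneg (Real.exp_pos _).le (hω.h_pos _).le) (Finset.mem_univ i)

theorem lam_le (hω : IsTypical p T φ u lam h ν μ r ω)
    (hω' : IsTypical p T φ u lam h ν μ r (RandomSkew.shift ω)) : lam ω ≤ p.lamUpper := by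
  obtain ⟨x, hx⟩ := hω'.exists_one_le_h
  obtain ⟨k, z, hk, hz, hr, -⟩ := hω.exists_fiber x
  have h1 : lam ω ≤ lam ω * h (RandomSkew.shift ω) x := le_mul_of_one_le_right hω.lam_pos.le hx
  have hC := p.C_pos
  have hkD : (k : ℝ) ≤ p.D := by exact_mod_cast hk
  rw [← hω.avgOp_h, avgOp, finsum_fiber_eq_sum hz hr] at h1
  refine h1.trans ?_
  calc ∑ i, Real.exp (φ ω (z i)) * h ω (z i) ≤ ∑ _i : Fin k, Real.exp p.C * p.C :=
        Finset.sum_le_sum fun i _ =>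
          mul_le_mul (hω.exp_le _) (hω.h_le _) (hω.h_pos _).le (Real.exp_pos _).le
    _ = k * (Real.exp p.C * p.C) := by simp
    _ ≤ (p.D + 1) * (Real.exp p.C * p.C) :=
        mul_le_mul_of_nonneg_right (by linarith) (by positivity)

theorem le_lam (hω : IsTypical p T φ u lam h ν μ r ω)
    (hω' : IsTypical p T φ u lam h ν μ r (RandomSkew.shift ω)) :
    Real.exp (-p.C) * p.C⁻¹ ≤ lam ω := by
  obtain ⟨y, hy⟩ := hω.exists_one_le_h
  have h1 := hω.exp_mul_h_le y
  have h2 := mul_le_mul_of_nonneg_left (hω'.h_le (T ω y)) hω.lam_pos.le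
  have h3 : Real.exp (-p.C) * 1 ≤ Real.exp (φ ω y) * h ω y :=
    mul_le_mul (hω.le_exp y) hy zero_le_one (Real.exp_pos _).le
  rw [← div_eq_mul_inv, div_le_iff₀ p.C_pos]
  linarith

theorem h_step (hω : IsTypical p T φ u lam h ν μ r ω)
    (hω' : IsTypical p T φ u lam h ν μ r (RandomSkew.shift ω)) (y : X) :
    Real.exp (-p.C) / p.lamUpper * h ω y ≤ h (RandomSkew.shift ω) (T ω y) := by
  have h1 := hω.exp_mul_h_le y
  have h2 := mul_le_mul_of_nonneg_right (hω.lam_le hω') (hω'.h_pos (T ω y)).le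
  have h3 := mul_le_mul_of_nonneg_right (hω.le_exp y) (hω.h_pos y).le
  rw [div_mul_eq_mul_div, div_le_iff₀ p.lamUpper_pos]
  linarith

end IsTypical

theorem IsTypicalOrbit.h_iterate (hω : IsTypicalOrbit p T φ u lam h ν μ r ω) (y : X) (n : ℕ) :
    (Real.exp (-p.C) / p.lamUpper) ^ n * h ω y ≤
      h (RandomSkew.shiftBy n ω) (seqIter (fun j => T (RandomSkew.shiftBy j ω)) n y) := by
  induction n with
  | zero => simp [seqIter]
  | succ n ih =>
    have hs : RandomSkew.shift (RandomSkew.shiftBy n ω) =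
        RandomSkew.shiftBy ((n + 1 : ℕ) : ℤ) ω := by
      rw [shift_eq_shiftBy, shiftBy_shiftBy, add_comm]; rfl
    have hω₁ := (hω.shiftBy n).self
    have hω₂ := (hω.shiftBy n).shift.self
    have h1 := hω₁.h_step hω₂ (seqIter (fun j => T (RandomSkew.shiftBy j ω)) n y)
    rw [hs] at h1
    refine le_trans ?_ h1
    rw [pow_succ', mul_assoc]
    exact mul_le_mul_of_nonneg_left ih (div_pos (Real.exp_pos _) p.lamUpper_pos).le

theorem IsTypicalOrbit.exact (hω : IsTypicalOrbit p T φ u lam h ν μ r ω) (j : ℕ) (x : X) :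
    seqIter (fun i => T (RandomSkew.shiftBy ((j + i : ℕ) : ℤ) ω)) p.n₀ '' Metric.ball x p.ξ =
      Set.univ := by
  have := (hω j).exact x
  rw [fiberIter_eq_seqIter] at this
  simpa only [shiftBy_shiftBy, ← Nat.cast_add, add_comm] using this

/-- The functions `h_ω` are bounded away from zero. -/
theorem exists_le_h (p : Params) (T : (ℤ → Y) → X → X) (φ u : (ℤ → Y) → X → ℝ)
    (lam : (ℤ → Y) → ℝ) (h : (ℤ → Y) → X → ℝ) (ν : (ℤ → Y) → Measure X) (μ : Measure X)
    (r : (ℤ → Y) → X → ℝ) :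
    ∃ c > 0, ∀ ω, IsTypicalOrbit p T φ u lam h ν μ r ω → ∀ x, c ≤ h ω x := by
  obtain ⟨k, hk⟩ := exists_small_scale p.alpha_pos p.xi_pos p.one_lt_gamma p.C_pos.le
    (show (0 : ℝ) < 1 / 2 by norm_num)
  obtain ⟨hk1, hk2⟩ := hk k le_rfl
  have hc : 0 < Real.exp (-p.C) / p.lamUpper := div_pos (Real.exp_pos _) p.lamUpper_pos
  refine ⟨(Real.exp (-p.C) / p.lamUpper) ^ (k + p.n₀) * (1 / 2), by positivity, fun ω hω x => ?_⟩
  set q := k + p.n₀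
  -- The argument starts `q` steps in the past, at a point `z` with `h ω' z ≥ 1`. Every `x` has a
  -- `q`-step preimage so near to `z` that `h ω'` is at least `1 / 2` there, and each step forward
  -- loses only a fixed factor.
  set ω' := RandomSkew.shiftBy (-(q : ℤ)) ω with hω'def
  have hω' := hω.shiftBy (-(q : ℤ))
  rw [← hω'def] at hω'
  have hback : RandomSkew.shiftBy (q : ℤ) ω' = ω := by simp [hω'def, shiftBy_shiftBy]
  obtain ⟨z, hz⟩ := hω'.self.exists_one_le_h
  obtain ⟨y, hy, hyz⟩ := exists_preimage_in_small_ball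
    (T := fun j : ℕ => T (RandomSkew.shiftBy j ω'))
    (fun j => (hω' j).paired) p.one_lt_gamma (n₀ := p.n₀) (fun j x => hω'.exact j x) k z x
  have h1 := hω'.h_iterate y q
  rw [hback, hy] at h1
  refine le_trans (mul_le_mul_of_nonneg_left ?_ (by positivity)) h1
  have h2 := (abs_le.1 (hω'.self.holder_h.locHolder y z (hyz.trans_lt hk1))).1
  have h3 := hk2 (dist y z) dist_nonneg hyz
  linarith

/-- The normalized transfer operators satisfy uniform bounds. -/
theorem exists_isFiberStep (p : Params) (T : (ℤ → Y) → X → X) (φ u : (ℤ → Y) → X → ℝ)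
    (lam : (ℤ → Y) → ℝ) (h : (ℤ → Y) → X → ℝ) (ν : (ℤ → Y) → Measure X) (μ : Measure X)
    (r : (ℤ → Y) → X → ℝ) :
    ∃ η K : ℝ, 0 < η ∧ η ≤ 1 ∧ 0 ≤ K ∧ ∀ ω, IsTypicalOrbit p T φ u lam h ν μ r ω →
      IsFiberStep p.α p.ξ p.γ η K p.D (T ω) (normWeight T φ lam h ω) := by
  obtain ⟨c, hc, hch⟩ := exists_le_h p T φ u lam h ν μ r
  have hC := p.C_pos
  have hU := p.lamUpper_pos
  -- A lower bound for the denominator `λ_ω h_{θω}` of the normalized weight: the lower bound for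
  -- `λ` times the one for `h`.
  set lo := Real.exp (-p.C) * p.C⁻¹ * c with hlo
  have hlo0 : 0 < lo := by positivity
  set bA := 2 * (Real.exp p.C * (1 + p.C)) * p.C with hbA
  have hbA0 : 0 ≤ bA := by positivity
  set bR := lo⁻¹ + (p.lamUpper * p.C) * (lo⁻¹ * lo⁻¹) with hbR
  have hbR0 : 0 ≤ bR := by positivity
  refine ⟨min 1 (Real.exp (-p.C) * c * (p.lamUpper * p.C)⁻¹), 2 * (bA * bR), by positivity,
    min_le_left _ _, by positivity, fun ω hω => ?_⟩
  have h0 := hω.self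
  have h1 := hω.shift.self
  have hden : ∀ x, 0 < lam ω * h (RandomSkew.shift ω) x := fun x => mul_pos h0.lam_pos (h1.h_pos x)
  have hA : HolderBdd p.α p.ξ bA fun y => Real.exp (φ ω y) * h ω y :=
    (h0.holder_phi.exp hC.le).mul h0.holder_h (by positivity) hC.le
  have hR : HolderBdd p.α p.ξ bR fun x => (lam ω * h (RandomSkew.shift ω) x)⁻¹ := by
    refine HolderBdd.inv ((h1.holder_h.const_mul (lam ω)).mono ?_) hlo0 (fun x => ?_)
      (by positivity)
    · rw [abs_of_pos h0.lam_pos]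
      exact mul_le_mul_of_nonneg_right (h0.lam_le h1) hC.le
    · exact mul_le_mul (h0.le_lam h1) (hch _ hω.shift x) hc.le h0.lam_pos.le
  refine ⟨h0.paired, fun y => ?_, fun x => ?_, fun y y' hd hyy' => ?_⟩
  · refine (min_le_right _ _).trans ?_
    unfold normWeight
    refine mul_le_mul ?_ ?_ (by positivity) (mul_pos (Real.exp_pos _) (h0.h_pos y)).le
    · exact mul_le_mul (h0.le_exp y) (hch _ hω y) hc.le (Real.exp_pos _).le
    · refine inv_anti₀ (hden _) ?_
      exact mul_le_mul (h0.lam_le h1) (h1.h_le _) (h1.h_pos _).le hU.le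
  · obtain ⟨k, z, -, hz, hr, hTz⟩ := h0.exists_fiber x
    have e := h0.avgOp_h x
    rw [avgOp, finsum_fiber_eq_sum hz hr] at e
    rw [finsum_fiber_eq_sum hz hr]
    simp only [normWeight, hTz]
    rw [← Finset.sum_mul, e, mul_inv_cancel₀ (hden x).ne']
  · have hγ1 : p.γ⁻¹ ≤ 1 := inv_le_one_of_one_le₀ p.one_lt_gamma.le
    have hle : dist y y' ≤ dist (T ω y) (T ω y') :=
      hyy'.trans (mul_le_of_le_one_left dist_nonneg hγ1)
    have hdα : dist y y' ^ p.α ≤ dist (T ω y) (T ω y') ^ p.α :=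
      Real.rpow_le_rpow dist_nonneg hle p.alpha_pos.le
    have hp : 0 ≤ dist (T ω y) (T ω y') ^ p.α := Real.rpow_nonneg dist_nonneg _
    unfold normWeight
    set A := fun y => Real.exp (φ ω y) * h ω y
    set R := fun x => (lam ω * h (RandomSkew.shift ω) x)⁻¹
    change |A y * R (T ω y) - A y' * R (T ω y')| ≤ _
    have e : A y * R (T ω y) - A y' * R (T ω y') =
        (A y - A y') * R (T ω y) + A y' * (R (T ω y) - R (T ω y')) := by ring
    rw [e]
    refine (abs_add_le _ _).trans ?_
    rw [abs_mul, abs_mul]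
    have i1 : |A y - A y'| ≤ bA * dist (T ω y) (T ω y') ^ p.α :=
      (hA.locHolder y y' (hle.trans_lt hd)).trans (mul_le_mul_of_nonneg_left hdα hbA0)
    have i2 := mul_le_mul i1 (hR.bound (T ω y)) (abs_nonneg _) (by positivity)
    have i3 := mul_le_mul (hA.bound y') (hR.locHolder _ _ hd) (abs_nonneg _) hbA0
    linarith

end OrbitBounds

/-! ### Duality with respect to `μ` and recovery of the Gibbs measures -/

section Duality

variable {Y X : Type*} [MetricSpace X] [MeasurableSpace X] [BorelSpace X]
  {p : Params} {T : (ℤ → Y) → X → X} {φ u : (ℤ → Y) → X → ℝ}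
  {lam : (ℤ → Y) → ℝ} {h : (ℤ → Y) → X → ℝ} {ν : (ℤ → Y) → Measure X} {μ : Measure X}
  {r : (ℤ → Y) → X → ℝ} {ω : ℤ → Y}

namespace IsTypical

theorem integral_gibbs (hω : IsTypical p T φ u lam h ν μ r ω) (F : X → ℝ) :
    ∫ x, F x ∂(gibbs h ν ω) = ∫ x, h ω x * F x ∂(ν ω) := by
  have hm := hω.holder_h.measurable p.alpha_pos p.xi_pos
  rw [gibbs, integral_withDensity_eq_integral_toReal_smul hm.ennreal_ofReal
    (Eventually.of_forall fun x => ENNReal.ofReal_lt_top)]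
  refine integral_congr_ae (Eventually.of_forall fun x => ?_)
  simp [ENNReal.toReal_ofReal (hω.h_pos x).le]

theorem integral_gibbs_eq (hω : IsTypical p T φ u lam h ν μ r ω) (F : X → ℝ) :
    ∫ x, F x ∂(gibbs h ν ω) = ∫ x, r ω x * F x ∂μ := by
  have hm := hω.holder_r.measurable p.alpha_pos p.xi_pos
  rw [hω.gibbs_eq, integral_withDensity_eq_integral_toReal_smul hm.ennreal_ofReal
    (Eventually.of_forall fun x => ENNReal.ofReal_lt_top)]
  refine integral_congr_ae (Eventually.of_forall fun x => ?_)
  simp [ENNReal.toReal_ofReal (hω.r_pos x).le]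

theorem isProbabilityMeasure_gibbs (hω : IsTypical p T φ u lam h ν μ r ω) :
    IsProbabilityMeasure (gibbs h ν ω) := by
  have := hω.nu_prob
  have hm := hω.holder_h.measurable p.alpha_pos p.xi_pos
  have hint : Integrable (h ω) (ν ω) := Integrable.of_bound hm.aestronglyMeasurable p.C
    (Eventually.of_forall hω.holder_h.bound)
  constructor
  rw [gibbs, withDensity_apply _ MeasurableSet.univ, Measure.restrict_univ,
    ← ofReal_integral_eq_lintegral_ofReal hint (Eventually.of_forall fun x => (hω.h_pos x).le),
    hω.nu_h, ENNReal.ofReal_one]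

/-- The Gibbs measure has total mass `1` and density at least `m > 0` with respect to `μ`. -/
theorem isFiniteMeasure (hω : IsTypical p T φ u lam h ν μ r ω) : IsFiniteMeasure μ := by
  have := hω.isProbabilityMeasure_gibbs
  have h1 : ENNReal.ofReal p.m * μ Set.univ ≤ 1 := by
    rw [← measure_univ (μ := gibbs h ν ω), hω.gibbs_eq, withDensity_apply _ MeasurableSet.univ,
      Measure.restrict_univ, ← lintegral_const]
    exact lintegral_mono fun x => ENNReal.ofReal_le_ofReal (hω.r_mem x).1.le
  constructor
  by_contra hcon
  rw [not_lt, top_le_iff] at hcon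
  rw [hcon, ENNReal.mul_top (by simpa using p.m_pos)] at h1
  simp at h1

theorem measure_ne_zero (hω : IsTypical p T φ u lam h ν μ r ω) : μ ≠ 0 := by
  have := hω.isProbabilityMeasure_gibbs
  rintro rfl
  have h1 := measure_univ (μ := gibbs h ν ω)
  rw [hω.gibbs_eq] at h1
  simp at h1

end IsTypical

/-- The normalized transfer operator is dual to the composition with `T_ω`. -/
theorem IsTypicalOrbit.integral_avgOp_mul (hω : IsTypicalOrbit p T φ u lam h ν μ r ω)
    {f G : X → ℝ} (hf : Measurable f) (hG : Measurable G) {b B : ℝ} (hfb : ∀ x, |f x| ≤ b)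
    (hGB : ∀ x, |G x| ≤ B) :
    ∫ x, avgOp (T ω) (normWeight T φ lam h ω) f x * G x ∂(gibbs h ν (RandomSkew.shift ω)) =
      ∫ x, f x * G (T ω x) ∂(gibbs h ν ω) := by
  have h0 := hω.self
  have h1 := hω.shift.self
  rw [h0.integral_gibbs, h1.integral_gibbs]
  -- The factor `h_{θω}` cancels the denominator of the normalized weight, and `G x` equals `G (T ω
  -- z)` on the fibre over `x`; this reduces the claim to the eigenmeasure equation for `ν`.
  have hpt : ∀ x, h (RandomSkew.shift ω) x *
      (avgOp (T ω) (normWeight T φ lam h ω) f x * G x) =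
      (lam ω)⁻¹ * avgOp (T ω) (fun y => Real.exp (φ ω y))
        (fun y => h ω y * (f y * G (T ω y))) x := fun x => by
    obtain ⟨k, z, -, hz, hr, hTz⟩ := h0.exists_fiber x
    rw [avgOp, avgOp, finsum_fiber_eq_sum hz hr, finsum_fiber_eq_sum hz hr, Finset.sum_mul,
      Finset.mul_sum, Finset.mul_sum]
    refine Finset.sum_congr rfl fun i _ => ?_
    have e1 := (h1.h_pos x).ne'
    have e2 := h0.lam_pos.ne'
    simp only [normWeight, hTz]
    field_simp
  simp_rw [hpt]
  have hhm := h0.holder_h.measurable p.alpha_pos p.xi_pos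
  have hgm : Measurable fun y => h ω y * (f y * G (T ω y)) :=
    hhm.mul (hf.mul (hG.comp h0.continuous_map.measurable))
  rw [integral_const_mul, h0.integral_avgOp (B := p.C * (b * B)) hgm, ← mul_assoc,
    inv_mul_cancel₀ h0.lam_pos.ne', one_mul]
  intro x
  rw [abs_mul, abs_mul]
  have hb : 0 ≤ b := (abs_nonneg _).trans (hfb x)
  exact mul_le_mul (h0.holder_h.bound x) (mul_le_mul (hfb x) (hGB _) (abs_nonneg _) hb)
    (by positivity) p.C_pos.le

/-- The composition with `T` has a dual operator with respect to `μ` that is bounded on Hölder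
functions. -/
structure IsRegularMap (μ : Measure X) (α ξ K : ℝ) (T : X → X) : Prop where
  continuous : Continuous T
  exists_dual : ∀ (b : ℝ) (f : X → ℝ), 0 ≤ b → HolderBdd α ξ b f →
    ∃ F : X → ℝ, HolderBdd α ξ (K * b) F ∧ ∀ (G : X → ℝ) (B : ℝ), Measurable G →
      (∀ x, |G x| ≤ B) → ∫ x, f x * G (T x) ∂μ = ∫ x, F x * G x ∂μ

/-- Dividing by `r ω` passes from `μ` to the Gibbs measure at `ω`, where the normalized operator is
the dual; multiplying by `r` at `θω` returns to `μ`. All three operations preserve Hölder bounds,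
with constants independent of `ω`. -/
theorem exists_isRegularMap (p : Params) (T : (ℤ → Y) → X → X) (φ u : (ℤ → Y) → X → ℝ)
    (lam : (ℤ → Y) → ℝ) (h : (ℤ → Y) → X → ℝ) (ν : (ℤ → Y) → Measure X) (μ : Measure X)
    (r : (ℤ → Y) → X → ℝ) :
    ∃ K : ℝ, 0 ≤ K ∧ ∀ ω, IsTypicalOrbit p T φ u lam h ν μ r ω →
      IsRegularMap μ p.α p.ξ K (T ω) := by
  obtain ⟨η, K, hη, -, hK, hstep⟩ := exists_isFiberStep p T φ u lam h ν μ r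
  have hC := p.C_pos
  have hm := p.m_pos
  set bI := p.m⁻¹ + p.C * (p.m⁻¹ * p.m⁻¹) with hbI
  have hbI0 : 0 ≤ bI := by positivity
  refine ⟨2 * p.C * (2 * bI * (1 + 2 * (p.D * K))), by positivity, fun ω hω =>
    ⟨hω.self.continuous_map, fun b f hb hf => ?_⟩⟩
  have h0 := hω.self
  have h1 := hω.shift.self
  have hs := hstep ω hω
  have hrinv : HolderBdd p.α p.ξ bI fun x => (r ω x)⁻¹ :=
    h0.holder_r.inv hm (fun x => (h0.r_mem x).1.le) hC.le
  have hg := hf.mul hrinv hb hbI0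
  set g := fun x => f x * (r ω x)⁻¹ with hgdef
  have ha : HolderBdd p.α p.ξ (2 * bI * (1 + 2 * (p.D * K)) * b)
      (avgOp (T ω) (normWeight T φ lam h ω) g) := by
    have hnn : 0 ≤ 2 * b * bI * (p.D * K) := by positivity
    constructor
    · intro x
      rw [abs_le]
      have i1 := hs.le_avgOp p.xi_pos hη.le (fun x => (abs_le.1 (hg.bound x)).1) x
      have i2 := hs.avgOp_le_const p.xi_pos hη.le (fun x => (abs_le.1 (hg.bound x)).2) x
      constructor <;> linarith
    · refine (hs.locHolder p.alpha_pos p.one_lt_gamma hη.le hK (by positivity)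
        (by positivity) hg.oscLE hg.locHolder).mono ?_
      have hγ0 : 0 ≤ p.γ⁻¹ := inv_nonneg.2 (zero_le_one.trans p.one_lt_gamma.le)
      have hγ1 : p.γ⁻¹ ^ p.α ≤ 1 :=
        Real.rpow_le_one hγ0 (inv_le_one_of_one_le₀ p.one_lt_gamma.le) p.alpha_pos.le
      have := mul_le_mul_of_nonneg_right hγ1 (show 0 ≤ 2 * b * bI by positivity)
      linarith
  refine ⟨fun x => r (RandomSkew.shift ω) x * avgOp (T ω) (normWeight T φ lam h ω) g x, ?_, ?_⟩
  · refine (h1.holder_r.mul ha hC.le (by positivity)).mono (le_of_eq (by ring))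
  · intro G B hG hGB
    have e1 := hω.integral_avgOp_mul (hg.measurable p.alpha_pos p.xi_pos) hG hg.bound hGB
    rw [h0.integral_gibbs_eq, h1.integral_gibbs_eq] at e1
    calc ∫ x, f x * G (T ω x) ∂μ = ∫ x, r ω x * (g x * G (T ω x)) ∂μ := by
          refine integral_congr_ae (Eventually.of_forall fun x => ?_)
          have := (h0.r_pos x).ne'
          simp only [hgdef]
          field_simp
      _ = _ := by
          rw [← e1]
          refine integral_congr_ae (Eventually.of_forall fun x => ?_)
          simp only
          ring

theorem abs_integral_mul_sub_mul_le_of_oscLE {Z : Type*} [MeasurableSpace Z] {Q : Measure Z}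
    [IsProbabilityMeasure Q] {F G : Z → ℝ} (hF : Measurable F) (hG : Measurable G) {a b B : ℝ}
    (hFb : ∀ x, |F x| ≤ b)
    (hosc : OscLE a F) (hGB : ∀ x, |G x| ≤ B) :
    |(∫ x, F x * G x ∂Q) - (∫ x, F x ∂Q) * (∫ x, G x ∂Q)| ≤ a * B := by
  have hFi : Integrable F Q := Integrable.of_bound hF.aestronglyMeasurable b
    (Eventually.of_forall hFb)
  have hGi : Integrable G Q := Integrable.of_bound hG.aestronglyMeasurable B
    (Eventually.of_forall hGB)
  have hFGi : Integrable (fun x => F x * G x) Q := hGi.bdd_mul (c := b) hF.aestronglyMeasurable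
    (Eventually.of_forall hFb)
  set c := ∫ x, F x ∂Q with hc
  have hFc : ∀ x, |F x - c| ≤ a := fun x => by
    have e : F x - c = ∫ x', (F x - F x') ∂Q := by
      rw [integral_sub (integrable_const _) hFi]; simp [hc]
    rw [e]
    have := norm_integral_le_of_norm_le_const (μ := Q) (f := fun x' => F x - F x') (C := a)
      (Eventually.of_forall fun x' => hosc x x')
    simpa using this
  rw [← integral_const_mul, ← integral_sub hFGi (hGi.const_mul c)]
  have := norm_integral_le_of_norm_le_const (μ := Q) (f := fun x => F x * G x - c * G x)
    (C := a * B) (Eventually.of_forall fun x => by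
      rw [← sub_mul, norm_mul]
      exact mul_le_mul (hFc x) (hGB x) (norm_nonneg _) ((abs_nonneg _).trans (hFc x)))
  simpa using this

/-- The images of `μ` under the compositions `T_ω^n` converge to the Gibbs measures, with an
exponential rate. -/
theorem exists_gibbs_approx (p : Params) (T : (ℤ → Y) → X → X) (φ u : (ℤ → Y) → X → ℝ)
    (lam : (ℤ → Y) → ℝ) (h : (ℤ → Y) → X → ℝ) (ν : (ℤ → Y) → Measure X) (μ : Measure X)
    (r : (ℤ → Y) → X → ℝ) :
    ∃ C₀ τ : ℝ, 0 < C₀ ∧ 0 < τ ∧ τ < 1 ∧ ∀ ω, IsTypicalOrbit p T φ u lam h ν μ r ω →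
      ∀ (n : ℕ) (G : X → ℝ) (B : ℝ), Measurable G → (∀ x, |G x| ≤ B) →
      |(∫ x, G (seqIter (fun j => T (shiftBy j ω)) n x) ∂μ) -
        μ.real Set.univ * (∫ x, G x ∂(gibbs h ν (shiftBy n ω)))| ≤ C₀ * τ ^ n * B := by
  obtain ⟨η, K, hη, hη1, hK, hstep⟩ := exists_isFiberStep p T φ u lam h ν μ r
  obtain ⟨C, τ, hC0, hτ0, hτ1, hdecay⟩ :=
    exists_oscLE_decay X p.alpha_pos p.xi_pos p.one_lt_gamma hη hη1 hK p.D p.n₀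
  have hC := p.C_pos
  have hm := p.m_pos
  set bI := p.m⁻¹ + p.C * (p.m⁻¹ * p.m⁻¹) with hbI
  have hbI0 : 0 < bI := by positivity
  refine ⟨C * (2 * bI), τ, by positivity, hτ0, hτ1, fun ω hω n G B hG hGB => ?_⟩
  have h0 := hω.self
  -- The density of `μ` with respect to the Gibbs measure at `ω`. Its iterates are the densities of
  -- the images of `μ` with respect to the later Gibbs measures; they become nearly constant, and
  -- testing with `1` identifies their mean as `μ(X)`.
  set f : X → ℝ := fun x => (r ω x)⁻¹ with hf
  have hfH : HolderBdd p.α p.ξ bI f := h0.holder_r.inv hm (fun x => (h0.r_mem x).1.le) hC.le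
  set Ts : ℕ → X → X := fun j => T (shiftBy j ω)
  set w : ℕ → X → ℝ := fun j => normWeight T φ lam h (shiftBy j ω)
  have hs : ∀ j, IsFiberStep p.α p.ξ p.γ η K p.D (Ts j) (w j) := fun j =>
    hstep _ (hω.shiftBy j)
  have hosc := hdecay Ts w hs (fun j x => hω.exact j x) f (2 * bI) (by positivity) hfH.oscLE
    (hfH.locHolder.mono (by linarith))
  have hmeas : ∀ n, Measurable (iterAvg Ts w f n) := fun n =>
    ((iterAvg_oscLE_locHolder hs p.alpha_pos p.xi_pos p.one_lt_gamma hη.le hK (by positivity)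
      hbI0.le hfH.oscLE hfH.locHolder n).2.continuous p.alpha_pos p.xi_pos).measurable
  have hbd : ∀ n x, |iterAvg Ts w f n x| ≤ bI := fun n x => abs_le.2
    ⟨le_iterAvg hs p.xi_pos hη.le (fun x => (abs_le.1 (hfH.bound x)).1) n x,
      (iterAvg_le hs p.xi_pos hη.le (fun x => (abs_le.1 (hfH.bound x)).2)
        (y := x) (abs_le.1 (hfH.bound x)).2 le_rfl n).1 x⟩
  have hdual : ∀ (n : ℕ) (G : X → ℝ) (B : ℝ), Measurable G → (∀ x, |G x| ≤ B) →
      ∫ x, iterAvg Ts w f n x * G x ∂(gibbs h ν (shiftBy n ω)) =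
        ∫ x, G (seqIter Ts n x) ∂μ := by
    intro n
    induction n with
    | zero =>
      intro G B hG hGB
      simp only [Nat.cast_zero, shiftBy_zero, iterAvg, seqIter, id]
      rw [h0.integral_gibbs_eq]
      refine integral_congr_ae (Eventually.of_forall fun x => ?_)
      have := (h0.r_pos x).ne'
      simp only [hf]
      field_simp
    | succ n ih =>
      intro G B hG hGB
      have e := (hω.shiftBy n).integral_avgOp_mul (hmeas n) hG (hbd n) hGB
      have hsn : RandomSkew.shift (shiftBy (n : ℤ) ω) = shiftBy ((n + 1 : ℕ) : ℤ) ω := by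
        rw [shift_eq_shiftBy, shiftBy_shiftBy, add_comm]; rfl
      rw [hsn] at e
      exact e.trans (ih (fun x => G (Ts n x)) B
        (hG.comp (hω n).continuous_map.measurable) fun x => hGB _)
  have e1 := hdual n G B hG hGB
  have e2 := hdual n (fun _ => 1) 1 measurable_const (by simp)
  simp only [mul_one, integral_const, smul_eq_mul] at e2
  have := (hω n).isProbabilityMeasure_gibbs
  have key := abs_integral_mul_sub_mul_le_of_oscLE (Q := gibbs h ν (shiftBy n ω)) (hmeas n) hG
    (hbd n) (hosc n) hGB
  rw [e1, e2] at key
  refine key.trans (le_of_eq ?_)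
  ring

end Duality

/-! ### Pairs of functions that are close against Hölder test functions -/

section WeakPair

variable {X : Type*} [MetricSpace X] [MeasurableSpace X]

/-- `G` and `G'` are measurable, bounded by `B`, and `c`-close as functionals on Hölder
functions. -/
structure WeakPair (μ : Measure X) (α ξ B c : ℝ) (G G' : X → ℝ) : Prop where
  meas_left : Measurable G
  meas_right : Measurable G'
  bound_left : ∀ x, |G x| ≤ B
  bound_right : ∀ x, |G' x| ≤ B
  close : ∀ (b : ℝ) (f : X → ℝ), 0 ≤ b → HolderBdd α ξ b f →
    |∫ x, f x * (G x - G' x) ∂μ| ≤ c * b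

variable {μ : Measure X} {α ξ B B₁ B₂ c c₁ c₂ : ℝ} {G G' G₁ G₁' G₂ G₂' : X → ℝ}

theorem WeakPair.mono (h : WeakPair μ α ξ B₁ c₁ G G') (hB : B₁ ≤ B₂) (hc : c₁ ≤ c₂) :
    WeakPair μ α ξ B₂ c₂ G G' :=
  ⟨h.meas_left, h.meas_right, fun x => (h.bound_left x).trans hB,
    fun x => (h.bound_right x).trans hB, fun b f hb hf =>
    (h.close b f hb hf).trans (mul_le_mul_of_nonneg_right hc hb)⟩

theorem integrable_mul_of_bounded {Z : Type*} [MeasurableSpace Z] {μ : Measure Z}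
    [IsFiniteMeasure μ] {f g : Z → ℝ} {a b : ℝ} (hf : Measurable f) (hg : Measurable g)
    (hfa : ∀ x, |f x| ≤ a) (hgb : ∀ x, |g x| ≤ b) : Integrable (fun x => f x * g x) μ :=
  (Integrable.of_bound hg.aestronglyMeasurable b (Eventually.of_forall hgb)).bdd_mul (c := a)
    hf.aestronglyMeasurable (Eventually.of_forall hfa)

theorem abs_integral_le_mul_measure {Z : Type*} [MeasurableSpace Z] {μ : Measure Z}
    [IsFiniteMeasure μ] {f : Z → ℝ} {a : ℝ} (h : ∀ x, |f x| ≤ a) :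
    |∫ x, f x ∂μ| ≤ a * μ.real Set.univ :=
  norm_integral_le_of_norm_le_const (f := f) (Eventually.of_forall h)

theorem WeakPair.of_uniform [IsFiniteMeasure μ] (hG : Measurable G)
    (hG' : Measurable G') (hGB : ∀ x, |G x| ≤ B)
    (hGB' : ∀ x, |G' x| ≤ B) {δ : ℝ} (hδ : ∀ x, |G x - G' x| ≤ δ) :
    WeakPair μ α ξ B (δ * μ.real Set.univ) G G' := by
  refine ⟨hG, hG', hGB, hGB', fun b f hb hf => ?_⟩
  have := abs_integral_le_mul_measure (μ := μ) (f := fun x => f x * (G x - G' x)) (a := b * δ)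
    fun x => by
      rw [abs_mul]
      exact mul_le_mul (hf.bound x) (hδ x) (abs_nonneg _) hb
  linarith

variable [BorelSpace X] [IsFiniteMeasure μ]

namespace WeakPair

theorem integrable_left (h : WeakPair μ α ξ B c G G') (hα : 0 < α) (hξ : 0 < ξ) {b : ℝ}
    {f : X → ℝ} (hf : HolderBdd α ξ b f) : Integrable (fun x => f x * G x) μ :=
  integrable_mul_of_bounded (hf.measurable hα hξ) h.meas_left hf.bound h.bound_left

theorem integrable_right (h : WeakPair μ α ξ B c G G') (hα : 0 < α) (hξ : 0 < ξ) {b : ℝ}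
    {f : X → ℝ} (hf : HolderBdd α ξ b f) : Integrable (fun x => f x * G' x) μ :=
  integrable_mul_of_bounded (hf.measurable hα hξ) h.meas_right hf.bound h.bound_right

theorem integrable_sub (h : WeakPair μ α ξ B c G G') (hα : 0 < α) (hξ : 0 < ξ) {b : ℝ}
    {f : X → ℝ} (hf : HolderBdd α ξ b f) : Integrable (fun x => f x * (G x - G' x)) μ := by
  simp only [mul_sub]
  exact (h.integrable_left hα hξ hf).sub (h.integrable_right hα hξ hf)

theorem add (h₁ : WeakPair μ α ξ B₁ c₁ G₁ G₁') (h₂ : WeakPair μ α ξ B₂ c₂ G₂ G₂') (hα : 0 < α)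
    (hξ : 0 < ξ) :
    WeakPair μ α ξ (B₁ + B₂) (c₁ + c₂) (fun x => G₁ x + G₂ x) fun x => G₁' x + G₂' x := by
  refine ⟨h₁.meas_left.add h₂.meas_left, h₁.meas_right.add h₂.meas_right,
    fun x => (abs_add_le _ _).trans (add_le_add (h₁.bound_left x) (h₂.bound_left x)),
    fun x => (abs_add_le _ _).trans (add_le_add (h₁.bound_right x) (h₂.bound_right x)),
    fun b f hb hf => ?_⟩
  have e : ∫ x, f x * (G₁ x + G₂ x - (G₁' x + G₂' x)) ∂μ =
      (∫ x, f x * (G₁ x - G₁' x) ∂μ) + ∫ x, f x * (G₂ x - G₂' x) ∂μ := by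
    rw [← integral_add (h₁.integrable_sub hα hξ hf) (h₂.integrable_sub hα hξ hf)]
    refine integral_congr_ae (Eventually.of_forall fun x => ?_)
    simp only
    ring
  rw [e, add_mul]
  exact (abs_add_le _ _).trans (add_le_add (h₁.close b f hb hf) (h₂.close b f hb hf))

/-- In `a * (G - G') + (a - a') * G'` the factor `a` is moved into the Hölder test function, which
costs `2 * b₀`; the second term is uniformly small. -/
theorem mul (h : WeakPair μ α ξ B c G G') (hα : 0 < α) (hξ : 0 < ξ) {a a' : X → ℝ} {b₀ δ : ℝ}
    (hb₀ : 0 ≤ b₀) (ha : HolderBdd α ξ b₀ a) (ha' : HolderBdd α ξ b₀ a')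
    (hδ : ∀ x, |a x - a' x| ≤ δ) :
    WeakPair μ α ξ (b₀ * B) (2 * b₀ * c + B * δ * μ.real Set.univ) (fun x => a x * G x)
      fun x => a' x * G' x := by
  have ham := ha.measurable hα hξ
  have ham' := ha'.measurable hα hξ
  refine ⟨ham.mul h.meas_left, ham'.mul h.meas_right, fun x => ?_, fun x => ?_,
    fun b f hb hf => ?_⟩
  · rw [abs_mul]
    exact mul_le_mul (ha.bound x) (h.bound_left x) (abs_nonneg _) hb₀
  · rw [abs_mul]
    exact mul_le_mul (ha'.bound x) (h.bound_right x) (abs_nonneg _) hb₀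
  · have hfa := hf.mul ha hb hb₀
    have hfm := hf.measurable hα hξ
    have hi : Integrable (fun x => f x * (a x - a' x) * G' x) μ := by
      have := ((hf.mul ha hb hb₀).add (hf.mul ha' hb hb₀).neg)
      have h1 := h.integrable_right hα hξ this
      refine h1.congr (Eventually.of_forall fun x => ?_)
      simp only
      ring
    have e : ∫ x, f x * (a x * G x - a' x * G' x) ∂μ =
        (∫ x, f x * a x * (G x - G' x) ∂μ) + ∫ x, f x * (a x - a' x) * G' x ∂μ := by
      rw [← integral_add (h.integrable_sub hα hξ hfa) hi]
      refine integral_congr_ae (Eventually.of_forall fun x => ?_)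
      simp only
      ring
    have h1 := h.close _ _ (by positivity) hfa
    have h2 := abs_integral_le_mul_measure (μ := μ) (f := fun x => f x * (a x - a' x) * G' x)
      (a := b * δ * B) fun x => by
        rw [abs_mul, abs_mul]
        exact mul_le_mul (mul_le_mul (hf.bound x) (hδ x) (abs_nonneg _) hb) (h.bound_right x)
          (abs_nonneg _) (mul_nonneg hb ((abs_nonneg _).trans (hδ x)))
    rw [e]
    refine (abs_add_le _ _).trans ?_
    linarith

end WeakPair

/-- Replacing a regular map by another one that is uniformly close. No regularity of the
function `G` is needed. -/
theorem abs_integral_comp_sub_le {K : ℝ} (hK : 0 ≤ K) (hα : 0 < α) (hξ : 0 < ξ) {T T' : X → X}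
    (hT : IsRegularMap μ α ξ K T) (hT' : IsRegularMap μ α ξ K T') {e : ℝ} (he : 0 ≤ e)
    (hTT' : ∀ x, dist (T x) (T' x) ≤ e) (hG : Measurable G) (hB : 0 ≤ B) (hGB : ∀ x, |G x| ≤ B)
    {b : ℝ} (hb : 0 ≤ b) {f : X → ℝ} (hf : HolderBdd α ξ b f) :
    |(∫ x, f x * G (T x) ∂μ) - ∫ x, f x * G (T' x) ∂μ| ≤
      μ.real Set.univ * (1 + 2 * K + 2 * (ξ ^ (α / 2))⁻¹) * B * e ^ (α / 2) * b := by
  set V := μ.real Set.univ with hV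
  have hV0 : 0 ≤ V := measureReal_nonneg
  set s := e ^ (α / 2) with hs
  have hs0 : 0 ≤ s := Real.rpow_nonneg he _
  have hξ0 : 0 < ξ ^ (α / 2) := Real.rpow_pos_of_pos hξ _
  have hfm := hf.measurable hα hξ
  have hI : ∀ (H : X → ℝ) (B : ℝ), Measurable H → (∀ x, |H x| ≤ B) →
      Integrable (fun x => f x * H x) μ := fun H B hH hHB =>
    integrable_mul_of_bounded hfm hH hf.bound hHB
  -- If `e ≥ ξ`, local Hölder continuity gives nothing for the pair `T x`, `T' x`, but then the
  -- bound is trivial by the term with `(ξ ^ (α / 2))⁻¹`.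
  rcases le_or_gt ξ e with hξe | hξe
  · have h1 : 1 ≤ (ξ ^ (α / 2))⁻¹ * s := by
      rw [← div_eq_inv_mul, le_div_iff₀ hξ0, one_mul]
      exact Real.rpow_le_rpow hξ.le hξe (by positivity)
    have h2 := abs_integral_le_mul_measure (μ := μ) (f := fun x => f x * G (T x)) (a := b * B)
      fun x => by
        rw [abs_mul]; exact mul_le_mul (hf.bound x) (hGB _) (abs_nonneg _) hb
    have h3 := abs_integral_le_mul_measure (μ := μ) (f := fun x => f x * G (T' x)) (a := b * B)
      fun x => by
        rw [abs_mul]; exact mul_le_mul (hf.bound x) (hGB _) (abs_nonneg _) hb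
    refine (abs_sub _ _).trans ?_
    have h4 : 0 ≤ V * B * b := by positivity
    have h5 := mul_le_mul_of_nonneg_left h1 h4
    have h6 : 0 ≤ V * (1 + 2 * K) * B * s * b := by positivity
    rw [← hV] at h2 h3
    nlinarith
  obtain ⟨F₁, hF₁, hd₁⟩ := hT.exists_dual b f hb hf
  obtain ⟨F₂, hF₂, hd₂⟩ := hT'.exists_dual b f hb hf
  have hF : HolderBdd α ξ (2 * K * b) fun x => F₁ x + -F₂ x :=
    (hF₁.add hF₂.neg).mono (by linarith)
  set F := fun x => F₁ x + -F₂ x with hFdef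
  have hFm : Measurable F := hF.measurable hα hξ
  have hF₁m := hF₁.measurable hα hξ
  have hF₂m := hF₂.measurable hα hξ
  have key : ∀ (H : X → ℝ) (B : ℝ), Measurable H → (∀ x, |H x| ≤ B) →
      (∫ x, f x * H (T x) ∂μ) - ∫ x, f x * H (T' x) ∂μ = ∫ x, F x * H x ∂μ := by
    intro H B hH hHB
    rw [hd₁ H B hH hHB, hd₂ H B hH hHB, ← integral_sub
      (integrable_mul_of_bounded hF₁m hH hF₁.bound hHB)
      (integrable_mul_of_bounded hF₂m hH hF₂.bound hHB)]
    refine integral_congr_ae (Eventually.of_forall fun x => ?_)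
    simp only [hFdef]
    ring
  rw [key G B hG hGB]
  rcases hb.eq_or_lt with rfl | hb'
  · have : ∀ x, F x = 0 := fun x => by
      have := hF.bound x
      rw [mul_zero, abs_nonpos_iff] at this
      exact this
    simp [this]
  rcases he.eq_or_lt with rfl | he'
  · have hTeq : T = T' := funext fun x => dist_le_zero.1 (hTT' x)
    rw [← key G B hG hGB, hTeq, sub_self, abs_zero]
    positivity
  have hs1 : 0 < s := Real.rpow_pos_of_pos he' _
  have hss : s * s = e ^ α := by
    rw [hs, ← Real.rpow_add he']; ring_nf
  -- Duality is tested with `F` itself. Unlike `G`, it is Hölder, so exchanging `T` and `T'` inside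
  -- it costs only `e ^ α`.
  have hsq : ∫ x, F x * F x ∂μ ≤ 2 * K * b * b * (s * s) * V := by
    have i1 := hI (fun x => F (T x)) _ (hFm.comp hT.continuous.measurable) fun x => hF.bound _
    have i2 := hI (fun x => F (T' x)) _ (hFm.comp hT'.continuous.measurable) fun x => hF.bound _
    rw [← key F _ hFm hF.bound, ← integral_sub i1 i2]
    refine (le_abs_self _).trans ?_
    refine abs_integral_le_mul_measure fun x => ?_
    rw [← mul_sub, abs_mul]
    have h1 := hF.locHolder (T x) (T' x) ((hTT' x).trans_lt hξe)
    have h2 : dist (T x) (T' x) ^ α ≤ s * s := by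
      rw [hss]; exact Real.rpow_le_rpow dist_nonneg (hTT' x) hα.le
    have h3 := mul_le_mul_of_nonneg_left h2 (show 0 ≤ 2 * K * b by positivity)
    have h4 := mul_le_mul (hf.bound x) (h1.trans h3) (abs_nonneg _) hb
    linarith
  have hFFi : Integrable (fun x => F x * F x) μ :=
    integrable_mul_of_bounded hFm hFm hF.bound hF.bound
  -- The arithmetic-geometric inequality with weight `b * s` plays the role of Cauchy-Schwarz; the
  -- weight must be positive, hence the separate cases `b = 0` and `e = 0` above.
  have hpt : ∀ x, |F x * G x| ≤ B * (b * s + (b * s)⁻¹ * (F x * F x)) := fun x => by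
    rw [abs_mul, mul_comm]
    refine mul_le_mul (hGB x) ?_ (abs_nonneg _) hB
    have hbs : 0 < b * s := by positivity
    have h1 : 0 ≤ (b * s)⁻¹ * (|F x| - b * s) ^ 2 := by positivity
    have h2 : (b * s)⁻¹ * (|F x| - b * s) ^ 2 =
        (b * s)⁻¹ * (F x * F x) - 2 * |F x| + b * s := by
      have : |F x| * |F x| = F x * F x := abs_mul_abs_self _
      field_simp
      nlinarith
    have h3 : 0 ≤ |F x| := abs_nonneg _
    linarith
  have hint : |∫ x, F x * G x ∂μ| ≤ B * (b * s * V + (b * s)⁻¹ * ∫ x, F x * F x ∂μ) := by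
    have h1 := norm_integral_le_of_norm_le (μ := μ) (f := fun x => F x * G x)
      (((integrable_const (b * s)).add (hFFi.const_mul (b * s)⁻¹)).const_mul B)
      (Eventually.of_forall hpt)
    refine h1.trans (le_of_eq ?_)
    simp only [Pi.add_apply]
    rw [integral_const_mul, integral_add (integrable_const _) (hFFi.const_mul _),
      integral_const_mul (b * s)⁻¹, integral_const, smul_eq_mul, ← hV, mul_comm V]
  refine hint.trans ?_
  have h1 : (b * s)⁻¹ * ∫ x, F x * F x ∂μ ≤ 2 * K * b * s * V := by
    rw [← div_eq_inv_mul, div_le_iff₀ (by positivity)]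
    refine hsq.trans (le_of_eq (by ring))
  have h2 : B * (b * s * V + (b * s)⁻¹ * ∫ x, F x * F x ∂μ) ≤
      B * (b * s * V + 2 * K * b * s * V) :=
    mul_le_mul_of_nonneg_left (by linarith) hB
  have h3 : 0 ≤ V * (2 * (ξ ^ (α / 2))⁻¹) * B * s * b := by positivity
  linarith

/-- The maps are exchanged first, with `G` fixed; then `G` is replaced by `G'` under the single map
`T'`, whose dual turns `f` into an admissible test function. -/
theorem WeakPair.comp (h : WeakPair μ α ξ B c G G') {K : ℝ} (hK : 0 ≤ K) (hα : 0 < α) (hξ : 0 < ξ)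
    (hB : 0 ≤ B) {T T' : X → X} (hT : IsRegularMap μ α ξ K T) (hT' : IsRegularMap μ α ξ K T')
    {e : ℝ} (he : 0 ≤ e) (hTT' : ∀ x, dist (T x) (T' x) ≤ e) :
    WeakPair μ α ξ B
      (K * c + μ.real Set.univ * (1 + 2 * K + 2 * (ξ ^ (α / 2))⁻¹) * B * e ^ (α / 2))
      (fun x => G (T x)) fun x => G' (T' x) := by
  refine ⟨h.meas_left.comp hT.continuous.measurable, h.meas_right.comp hT'.continuous.measurable,
    fun x => h.bound_left _, fun x => h.bound_right _, fun b f hb hf => ?_⟩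
  have hfm := hf.measurable hα hξ
  have hI : ∀ (H : X → ℝ) (B : ℝ), Measurable H → (∀ x, |H x| ≤ B) →
      Integrable (fun x => f x * H x) μ := fun H B hH hHB =>
    integrable_mul_of_bounded hfm hH hf.bound hHB
  have hTm := hT.continuous.measurable
  have hTm' := hT'.continuous.measurable
  obtain ⟨F, hF, hd⟩ := hT'.exists_dual b f hb hf
  have h1 := abs_integral_comp_sub_le hK hα hξ hT hT' he hTT' h.meas_left hB h.bound_left hb hf
  have h2 := h.close _ F (by positivity) hF
  have h3 := hd (fun x => G x - G' x) (B + B) (h.meas_left.sub h.meas_right) fun x =>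
    (abs_sub _ _).trans (add_le_add (h.bound_left x) (h.bound_right x))
  rw [← h3] at h2
  have i1 := hI (fun x => G (T x)) B (h.meas_left.comp hTm) fun x => h.bound_left _
  have i2 := hI (fun x => G (T' x)) B (h.meas_left.comp hTm') fun x => h.bound_left _
  have i3 := hI (fun x => G' (T' x)) B (h.meas_right.comp hTm') fun x => h.bound_right _
  have e1 : ∫ x, f x * (G (T x) - G' (T' x)) ∂μ =
      ((∫ x, f x * G (T x) ∂μ) - ∫ x, f x * G (T' x) ∂μ) +
        ∫ x, f x * (G (T' x) - G' (T' x)) ∂μ := by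
    simp only [mul_sub]
    rw [integral_sub i1 i3, integral_sub i2 i3]
    ring
  rw [e1]
  refine (abs_add_le _ _).trans ?_
  linarith

end WeakPair

/-! ### Closeness of Birkhoff-type sums and their squares -/

section WeakSums

variable {X : Type*}

/-- `∑_{j<k} a_j ∘ T_{j-1} ∘ ⋯ ∘ T_0`. -/
noncomputable def sumSeq (T : ℕ → X → X) (a : ℕ → X → ℝ) (k : ℕ) (x : X) : ℝ :=
  ∑ j ∈ Finset.range k, a j (seqIter T j x)

theorem seqIter_succ (T : ℕ → X → X) (n : ℕ) (x : X) :
    seqIter T (n + 1) x = seqIter (fun i => T (i + 1)) n (T 0 x) := by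
  rw [add_comm, seqIter_add]
  simp only [add_comm 1, seqIter, Function.comp_apply, id]

theorem sumSeq_succ (T : ℕ → X → X) (a : ℕ → X → ℝ) (k : ℕ) (x : X) :
    sumSeq T a (k + 1) x =
      a 0 x + sumSeq (fun i => T (i + 1)) (fun i => a (i + 1)) k (T 0 x) := by
  simp only [sumSeq, Finset.sum_range_succ', seqIter_succ, add_comm (a 0 x)]
  rfl

variable [MetricSpace X] [MeasurableSpace X] [BorelSpace X] {μ : Measure X} [IsFiniteMeasure μ]
  {α ξ K : ℝ}

theorem WeakPair.comp_seqIter (hK : 0 ≤ K) (hα : 0 < α) (hξ : 0 < ξ) {B c e : ℝ} (hB : 0 ≤ B)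
    (he : 0 ≤ e) (n : ℕ) {G G' : X → ℝ} (h : WeakPair μ α ξ B c G G')
    (hc : 0 ≤ c) {T T' : ℕ → X → X} (hT : ∀ j, IsRegularMap μ α ξ K (T j))
    (hT' : ∀ j, IsRegularMap μ α ξ K (T' j)) (hTT' : ∀ j < n, ∀ x, dist (T j x) (T' j x) ≤ e) :
    WeakPair μ α ξ B ((K + 2) ^ n *
      (c + μ.real Set.univ * (1 + 2 * K + 2 * (ξ ^ (α / 2))⁻¹) * B * e ^ (α / 2)))
      (fun x => G (seqIter T n x)) fun x => G' (seqIter T' n x) := by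
  have hξ0 : 0 < ξ ^ (α / 2) := Real.rpow_pos_of_pos hξ _
  have hV0 : 0 ≤ μ.real Set.univ := measureReal_nonneg
  set E := μ.real Set.univ * (1 + 2 * K + 2 * (ξ ^ (α / 2))⁻¹) * B * e ^ (α / 2) with hE
  have hE0 : 0 ≤ E := by positivity
  induction n generalizing G G' c with
  | zero => exact h.mono le_rfl (by simpa using hE0)
  | succ n ih =>
    have h1 := h.comp hK hα hξ hB (hT n) (hT' n) he (hTT' n (Nat.lt_succ_self n))
    rw [← hE] at h1
    refine (ih h1 (by positivity) fun j hj => hTT' j (hj.trans (Nat.lt_succ_self n))).mono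
      le_rfl ?_
    rw [pow_succ, mul_assoc]
    refine mul_le_mul_of_nonneg_left ?_ (by positivity)
    nlinarith [mul_nonneg hK hE0]

/-- Induction along `S_{k+1} = a_0 + S_k ∘ T_0`. The square produces the cross term `2 a_0 (S_k ∘
T_0)`, so sums and squares have to be carried through the induction together. -/
theorem exists_weakPair_sumSeq (μ : Measure X) [IsFiniteMeasure μ] (hK : 0 ≤ K) (hα : 0 < α)
    (hξ : 0 < ξ) {A : ℝ} (hA : 0 ≤ A) (k : ℕ) :
    ∃ B c : ℝ, 0 ≤ B ∧ 0 ≤ c ∧ ∀ (T T' : ℕ → X → X) (a a' : ℕ → X → ℝ) (e Δ : ℝ),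
      (∀ j, IsRegularMap μ α ξ K (T j)) → (∀ j, IsRegularMap μ α ξ K (T' j)) →
      (∀ j, HolderBdd α ξ A (a j)) → (∀ j, HolderBdd α ξ A (a' j)) → 0 ≤ e → e ^ (α / 2) ≤ Δ →
      (∀ j < k, ∀ x, dist (T j x) (T' j x) ≤ e) → (∀ j < k, ∀ x, |a j x - a' j x| ≤ Δ) →
      WeakPair μ α ξ B (c * Δ) (sumSeq T a k) (sumSeq T' a' k) ∧
      WeakPair μ α ξ B (c * Δ) (fun x => sumSeq T a k x ^ 2) fun x => sumSeq T' a' k x ^ 2 := by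
  have hξ0 : 0 < ξ ^ (α / 2) := Real.rpow_pos_of_pos hξ _
  set V := μ.real Set.univ with hV
  have hV0 : 0 ≤ V := measureReal_nonneg
  set Cc := V * (1 + 2 * K + 2 * (ξ ^ (α / 2))⁻¹) with hCc
  have hCc0 : 0 ≤ Cc := by positivity
  induction k with
  | zero =>
    refine ⟨0, 0, le_rfl, le_rfl, fun T T' a a' e Δ _ _ _ _ _ _ _ _ => ?_⟩
    have : WeakPair μ α ξ 0 (0 * μ.real Set.univ) (fun _ => 0) fun _ => 0 :=
      WeakPair.of_uniform measurable_const measurable_const (by simp) (by simp) (by simp)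
    rw [zero_mul] at this ⊢
    constructor
    · exact this
    · have e1 : ∀ (T : ℕ → X → X) (a : ℕ → X → ℝ), (fun x => sumSeq T a 0 x ^ 2) = fun _ => 0 :=
        fun T a => by funext x; simp [sumSeq]
      rw [e1, e1]
      exact this
  | succ k ih =>
    obtain ⟨B, c, hB, hc, ih⟩ := ih
    set c' := K * c + Cc * B with hc'
    have hc'0 : 0 ≤ c' := by positivity
    set c₁ := V + c' with hc₁
    set c₂ := (2 * A * V + A * V) + (2 * (2 * A) * c' + B * 2 * V) + c' with hc₂
    refine ⟨(A + B) + (A * A + 2 * A * B + B), c₁ + c₂, by positivity, by positivity, ?_⟩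
    intro T T' a a' e Δ hT hT' ha ha' he hΔ hTT' haa'
    have hΔ0 : 0 ≤ Δ := (Real.rpow_nonneg he _).trans hΔ
    obtain ⟨i1, i2⟩ := ih (fun i => T (i + 1)) (fun i => T' (i + 1)) (fun i => a (i + 1))
      (fun i => a' (i + 1)) e Δ (fun j => hT _) (fun j => hT' _) (fun j => ha _) (fun j => ha' _)
      he hΔ (fun j hj => hTT' _ (by omega)) (fun j hj => haa' _ (by omega))
    have hcomp : K * (c * Δ) + Cc * B * e ^ (α / 2) ≤ c' * Δ := by
      have := mul_le_mul_of_nonneg_left hΔ (show 0 ≤ Cc * B by positivity)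
      rw [hc']
      linarith
    have j1 := (i1.comp hK hα hξ hB (hT 0) (hT' 0) he (hTT' 0 (by omega))).mono le_rfl hcomp
    have j2 := (i2.comp hK hα hξ hB (hT 0) (hT' 0) he (hTT' 0 (by omega))).mono le_rfl hcomp
    have j0 : WeakPair μ α ξ A (Δ * V) (a 0) (a' 0) :=
      WeakPair.of_uniform ((ha 0).measurable hα hξ) ((ha' 0).measurable hα hξ) (ha 0).bound
        (ha' 0).bound (haa' 0 (by omega))
    have k1 := j0.add j1 hα hξ
    have k2 := j0.mul hα hξ hA (ha 0) (ha' 0) (haa' 0 (by omega))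
    have h2a := ((ha 0).const_mul 2).mono (show |(2 : ℝ)| * A ≤ 2 * A by simp)
    have h2a' := ((ha' 0).const_mul 2).mono (show |(2 : ℝ)| * A ≤ 2 * A by simp)
    have k3 := j1.mul hα hξ (by positivity) h2a h2a' (δ := 2 * Δ) fun x => by
      rw [← mul_sub, abs_mul, abs_two]
      exact mul_le_mul_of_nonneg_left (haa' 0 (by omega) x) zero_le_two
    have k4 := (k2.add k3 hα hξ).add j2 hα hξ
    have p1 : 0 ≤ A * A + 2 * A * B + B := by positivity
    have p2 : 0 ≤ A + B := by positivity
    have p3 : 0 ≤ c₁ * Δ := by positivity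
    have p4 : 0 ≤ c₂ * Δ := by positivity
    constructor
    · have e1 : ∀ (T : ℕ → X → X) (a : ℕ → X → ℝ), sumSeq T a (k + 1) = fun x => a 0 x +
          sumSeq (fun i => T (i + 1)) (fun i => a (i + 1)) k (T 0 x) :=
        fun T a => funext fun x => sumSeq_succ T a k x
      rw [e1, e1]
      refine k1.mono (by linarith) ?_
      rw [add_mul, hc₁]
      linarith
    · have e2 : ∀ (T : ℕ → X → X) (a : ℕ → X → ℝ), (fun x => sumSeq T a (k + 1) x ^ 2) =
          fun x => a 0 x * a 0 x +
            2 * a 0 x * sumSeq (fun i => T (i + 1)) (fun i => a (i + 1)) k (T 0 x) +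
            sumSeq (fun i => T (i + 1)) (fun i => a (i + 1)) k (T 0 x) ^ 2 :=
        fun T a => funext fun x => by rw [sumSeq_succ]; ring
      rw [e2, e2]
      refine k4.mono (by linarith) ?_
      rw [← hV, add_mul, hc₂]
      linarith

end WeakSums

/-! ### Dependence of the Gibbs mean and of the variance on the base point -/

section Variance

variable {Y X : Type*} [MetricSpace X]

/-- The maps `T_ω`, `T_ω'` and the functions `u_ω`, `u_ω'` are uniformly `e`-close. -/
def FamClose (T : (ℤ → Y) → X → X) (u : (ℤ → Y) → X → ℝ) (e : ℝ) (ω ω' : ℤ → Y) : Prop :=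
  ∀ x, dist (T ω x) (T ω' x) ≤ e ∧ |u ω x - u ω' x| ≤ e

theorem centeredSum_eq_sumSeq {X : Type*} [MeasurableSpace X] (T : (ℤ → Y) → X → X)
    (u h : (ℤ → Y) → X → ℝ) (ν : (ℤ → Y) → Measure X) (k : ℕ) (ω : ℤ → Y) :
    centeredSum shift T u h ν k ω = sumSeq (fun j => T (shiftBy j ω))
      (fun j x => u (shiftBy j ω) x - gibbsMean u h ν (shiftBy j ω)) k := by
  funext x
  simp only [centeredSum, sumSeq, iterate_shift, fiberIter_eq_seqIter]

theorem IsTypical.abs_gibbsMean_le [MeasurableSpace X] [BorelSpace X] {p : Params}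
    {T : (ℤ → Y) → X → X} {φ u : (ℤ → Y) → X → ℝ} {lam : (ℤ → Y) → ℝ} {h : (ℤ → Y) → X → ℝ}
    {ν : (ℤ → Y) → Measure X} {μ : Measure X} {r : (ℤ → Y) → X → ℝ} {ω : ℤ → Y}
    (hω : IsTypical p T φ u lam h ν μ r ω) : |gibbsMean u h ν ω| ≤ p.C := by
  have := hω.isProbabilityMeasure_gibbs
  rw [gibbsMean]
  simpa using abs_integral_le_mul_measure (μ := gibbs h ν ω) hω.holder_u.bound

variable [MeasurableSpace X] [BorelSpace X] (p : Params) (T : (ℤ → Y) → X → X)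
  (φ u : (ℤ → Y) → X → ℝ) (lam : (ℤ → Y) → ℝ) (h : (ℤ → Y) → X → ℝ) (ν : (ℤ → Y) → Measure X) (μ : Measure X)
  (r : (ℤ → Y) → X → ℝ)

variable [IsFiniteMeasure μ]

/-- Both means are computed from `μ`, transported from time `-n` to time `0`, with error `τ ^ n`.
The two transports involve only `T` and `u`, and exchanging the `n` maps one at a time costs a fixed
factor per map. -/
theorem exists_gibbsMean_sub_le (hμ : μ ≠ 0) :
    ∃ C K τ : ℝ, 0 < C ∧ 1 ≤ K ∧ 0 < τ ∧ τ < 1 ∧ ∀ ω ω',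
      IsTypicalOrbit p T φ u lam h ν μ r ω → IsTypicalOrbit p T φ u lam h ν μ r ω' →
      ∀ (n : ℕ) (e : ℝ), 0 ≤ e →
      (∀ j : ℤ, -n ≤ j → j ≤ 0 → FamClose T u e (shiftBy j ω) (shiftBy j ω')) →
      |gibbsMean u h ν ω - gibbsMean u h ν ω'| ≤ C * (τ ^ n + K ^ n * (e + e ^ (p.α / 2))) := by
  obtain ⟨K, hK, hreg⟩ := exists_isRegularMap p T φ u lam h ν μ r
  obtain ⟨C₀, τ, hC₀, hτ0, hτ1, happ⟩ := exists_gibbs_approx p T φ u lam h ν μ r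
  have hC := p.C_pos
  set V := μ.real Set.univ with hV
  have hV0 : 0 < V := by
    rw [hV, measureReal_def]
    exact ENNReal.toReal_pos (by simpa using hμ) (measure_ne_top _ _)
  have hξ0 : 0 < p.ξ ^ (p.α / 2) := Real.rpow_pos_of_pos p.xi_pos _
  set Cc := V * (1 + 2 * K + 2 * (p.ξ ^ (p.α / 2))⁻¹) with hCc
  have hCc0 : 0 ≤ Cc := by positivity
  refine ⟨(2 * C₀ * p.C + V + Cc * p.C) / V, K + 2, τ, by positivity, by linarith, hτ0, hτ1, ?_⟩
  intro ω ω' hω hω' n e he hclose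
  have hes : 0 ≤ e ^ (p.α / 2) := Real.rpow_nonneg he _
  have hback : ∀ ω : ℤ → Y, shiftBy (n : ℤ) (shiftBy (-(n : ℤ)) ω) = ω := fun ω => by
    simp [shiftBy_shiftBy]
  have hmain : ∀ ω, IsTypicalOrbit p T φ u lam h ν μ r ω →
      |(∫ x, u ω (seqIter (fun j => T (shiftBy j (shiftBy (-(n : ℤ)) ω))) n x) ∂μ) -
        V * gibbsMean u h ν ω| ≤ C₀ * τ ^ n * p.C := fun ω hω => by
    have := happ _ (hω.shiftBy (-(n : ℤ))) n (u ω) p.C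
      (hω.self.holder_u.measurable p.alpha_pos p.xi_pos) hω.self.holder_u.bound
    rwa [hback] at this
  have h00 := hclose 0 (by omega) le_rfl
  simp only [shiftBy_zero] at h00
  have hu : WeakPair μ p.α p.ξ p.C (e * V) (u ω) (u ω') :=
    WeakPair.of_uniform (hω.self.holder_u.measurable p.alpha_pos p.xi_pos)
      (hω'.self.holder_u.measurable p.alpha_pos p.xi_pos) hω.self.holder_u.bound
      hω'.self.holder_u.bound fun x => (h00 x).2
  have hpair := hu.comp_seqIter hK p.alpha_pos p.xi_pos hC.le he n (by positivity)
    (T := fun j => T (shiftBy j (shiftBy (-(n : ℤ)) ω)))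
    (T' := fun j => T (shiftBy j (shiftBy (-(n : ℤ)) ω')))
    (fun j => hreg _ ((hω.shiftBy _).shiftBy j)) (fun j => hreg _ ((hω'.shiftBy _).shiftBy j))
    (fun j hj x => by
      simp only [shiftBy_shiftBy]
      exact (hclose (j + -(n : ℤ)) (by omega) (by omega) x).1)
  rw [← hV, ← hCc] at hpair
  have hone : HolderBdd p.α p.ξ 1 fun _ : X => (1 : ℝ) := by
    simpa using holderBdd_const (X := X) (α := p.α) (ξ := p.ξ) 1
  have hcl := hpair.close 1 (fun _ => 1) zero_le_one hone
  have i1 := hpair.integrable_left p.alpha_pos p.xi_pos hone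
  have i2 := hpair.integrable_right p.alpha_pos p.xi_pos hone
  simp only [one_mul, mul_one] at hcl i1 i2
  rw [integral_sub i1 i2] at hcl
  have m1 := hmain ω hω
  have m2 := hmain ω' hω'
  set I₁ := ∫ x, u ω (seqIter (fun j => T (shiftBy j (shiftBy (-(n : ℤ)) ω))) n x) ∂μ
  set I₂ := ∫ x, u ω' (seqIter (fun j => T (shiftBy j (shiftBy (-(n : ℤ)) ω'))) n x) ∂μ
  have hdiff : V * |gibbsMean u h ν ω - gibbsMean u h ν ω'| ≤
      2 * (C₀ * τ ^ n * p.C) + (K + 2) ^ n * (e * V + Cc * p.C * e ^ (p.α / 2)) := by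
    rw [← abs_of_pos hV0, ← abs_mul, abs_of_pos hV0]
    rw [abs_le] at m1 m2 hcl ⊢
    constructor <;> nlinarith
  have hKn : 0 ≤ (K + 2) ^ n := by positivity
  have hτn : 0 ≤ τ ^ n := by positivity
  rw [div_mul_eq_mul_div, le_div_iff₀ hV0, mul_comm]
  refine hdiff.trans ?_
  have t1 : 0 ≤ (V + Cc * p.C) * τ ^ n := by positivity
  have t2 : 0 ≤ (2 * C₀ * p.C + Cc * p.C) * ((K + 2) ^ n * e) := by positivity
  have t3 : 0 ≤ (2 * C₀ * p.C + V) * ((K + 2) ^ n * e ^ (p.α / 2)) := by positivity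
  linarith

/-- The sum uses the maps and functions at times below `k`, and the centring at each of these times
looks `n` steps further back; hence the range from `-n` to `k`. -/
theorem exists_tildeV_sub_le (hμ : μ ≠ 0) (k : ℕ) :
    ∃ C K τ : ℝ, 0 < C ∧ 1 ≤ K ∧ 0 < τ ∧ τ < 1 ∧
      (∀ ω, IsTypicalOrbit p T φ u lam h ν μ r ω → |tildeV shift T u h ν μ k ω| ≤ C) ∧
      ∀ ω ω', IsTypicalOrbit p T φ u lam h ν μ r ω → IsTypicalOrbit p T φ u lam h ν μ r ω' →
      ∀ (n : ℕ) (e : ℝ), 0 ≤ e →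
      (∀ j : ℤ, -n ≤ j → j ≤ k → FamClose T u e (shiftBy j ω) (shiftBy j ω')) →
      |tildeV shift T u h ν μ k ω - tildeV shift T u h ν μ k ω'| ≤
        C * (τ ^ n + K ^ n * (e + e ^ (p.α / 2))) := by
  obtain ⟨K, hK, hreg⟩ := exists_isRegularMap p T φ u lam h ν μ r
  obtain ⟨C₁, K₁, τ, hC₁, hK₁, hτ0, hτ1, hgm⟩ := exists_gibbsMean_sub_le p T φ u lam h ν μ r hμ
  have hC := p.C_pos
  obtain ⟨B, c, hB, hc, hsum⟩ := exists_weakPair_sumSeq μ hK p.alpha_pos p.xi_pos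
    (show 0 ≤ p.C + p.C by positivity) k
  have hV0 : 0 ≤ μ.real Set.univ := measureReal_nonneg
  have hone : HolderBdd p.α p.ξ 1 fun _ : X => (1 : ℝ) := by
    simpa using holderBdd_const (X := X) (α := p.α) (ξ := p.ξ) 1
  have hcent : ∀ ω, IsTypicalOrbit p T φ u lam h ν μ r ω → ∀ j : ℕ, HolderBdd p.α p.ξ (p.C + p.C)
      fun x => u (shiftBy j ω) x - gibbsMean u h ν (shiftBy j ω) := fun ω hω j =>
    (hω j).holder_u.sub_const (hω j).abs_gibbsMean_le
  have htV : ∀ ω, tildeV shift T u h ν μ k ω = ∫ x, sumSeq (fun j => T (shiftBy j ω))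
      (fun j x => u (shiftBy j ω) x - gibbsMean u h ν (shiftBy j ω)) k x ^ 2 ∂μ := fun ω => by
    rw [tildeV, centeredSum_eq_sumSeq]
  refine ⟨c * (1 + C₁) + B * μ.real Set.univ + 1, K₁, τ, by positivity, hK₁, hτ0, hτ1, ?_, ?_⟩
  · intro ω hω
    -- Comparing `ω` with itself yields the uniform bound on the squared sum.
    have hp := (hsum (fun j => T (shiftBy j ω)) (fun j => T (shiftBy j ω)) _ _ 0 0
      (fun j => hreg _ (hω.shiftBy j)) (fun j => hreg _ (hω.shiftBy j)) (hcent ω hω) (hcent ω hω)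
      le_rfl (by rw [Real.zero_rpow (by have := p.alpha_pos; positivity)])
      (by simp) (by simp)).2
    rw [htV]
    refine (abs_integral_le_mul_measure hp.bound_left).trans ?_
    have : 0 ≤ c * (1 + C₁) := by positivity
    linarith
  · intro ω ω' hω hω' n e he hclose
    have hes : 0 ≤ e ^ (p.α / 2) := Real.rpow_nonneg he _
    have hKn : 1 ≤ K₁ ^ n := one_le_pow₀ hK₁
    set R := τ ^ n + K₁ ^ n * (e + e ^ (p.α / 2)) with hR
    have hR1 : e + e ^ (p.α / 2) ≤ R := by
      have h1 : e + e ^ (p.α / 2) ≤ K₁ ^ n * (e + e ^ (p.α / 2)) :=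
        le_mul_of_one_le_left (by positivity) hKn
      have h2 : 0 ≤ τ ^ n := by positivity
      linarith
    have hR0 : 0 ≤ R := by linarith
    have hp := (hsum (fun j => T (shiftBy j ω)) (fun j => T (shiftBy j ω')) _ _ e ((1 + C₁) * R)
      (fun j => hreg _ (hω.shiftBy j)) (fun j => hreg _ (hω'.shiftBy j)) (hcent ω hω)
      (hcent ω' hω') he (by nlinarith)
      (fun j hj x => (hclose j (by omega) (by omega) x).1)
      (fun j hj x => by
        have h1 := (hclose j (by omega) (by omega) x).2
        have h2 := hgm _ _ (hω.shiftBy j) (hω'.shiftBy j) n e he fun i hi1 hi2 => by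
          rw [shiftBy_shiftBy, shiftBy_shiftBy]
          exact hclose (i + j) (by omega) (by omega)
        rw [← hR] at h2
        have h3 : u (shiftBy j ω) x - gibbsMean u h ν (shiftBy j ω) -
            (u (shiftBy j ω') x - gibbsMean u h ν (shiftBy j ω')) =
            (u (shiftBy j ω) x - u (shiftBy j ω') x) -
            (gibbsMean u h ν (shiftBy j ω) - gibbsMean u h ν (shiftBy j ω')) := by ring
        rw [h3]
        refine (abs_sub _ _).trans ?_
        linarith)).2
    have hcl := hp.close 1 (fun _ => 1) zero_le_one hone
    have i1 := hp.integrable_left p.alpha_pos p.xi_pos hone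
    have i2 := hp.integrable_right p.alpha_pos p.xi_pos hone
    simp only [one_mul, mul_one] at hcl i1 i2
    rw [integral_sub i1 i2, ← htV, ← htV] at hcl
    refine hcl.trans ?_
    have : 0 ≤ (B * μ.real Set.univ + 1) * R := by positivity
    linarith

end Variance

/-! ### The metric `d` on `Y^ℤ` -/

section SeqDist

theorem summable_inv_two_pow_natAbs : Summable fun n : ℤ => (2 : ℝ)⁻¹ ^ n.natAbs := by
  refine Summable.of_nat_of_neg ?_ ?_ <;>
  simpa using summable_geometric_of_lt_one (show (0 : ℝ) ≤ 2⁻¹ by norm_num) (by norm_num)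

variable {Y : Type*} [MetricSpace Y]

theorem summable_seqDist (hdiam : ∀ y y' : Y, dist y y' ≤ 1) (a b : ℤ → Y) :
    Summable fun n : ℤ => (2 : ℝ)⁻¹ ^ n.natAbs * dist (a n) (b n) :=
  summable_inv_two_pow_natAbs.of_nonneg_of_le (fun n => by positivity) fun n =>
    mul_le_of_le_one_right (by positivity) (hdiam _ _)

theorem seqDist_nonneg (a b : ℤ → Y) : 0 ≤ seqDist a b := tsum_nonneg fun n => by positivity

theorem seqDist_comm (a b : ℤ → Y) : seqDist a b = seqDist b a := by
  simp only [seqDist, dist_comm]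

theorem seqDist_self (a : ℤ → Y) : seqDist a a = 0 := by simp [seqDist]

theorem seqDist_triangle (hdiam : ∀ y y' : Y, dist y y' ≤ 1) (a b c : ℤ → Y) :
    seqDist a c ≤ seqDist a b + seqDist b c := by
  rw [seqDist, seqDist, seqDist,
    ← (summable_seqDist hdiam a b).tsum_add (summable_seqDist hdiam b c)]
  refine (summable_seqDist hdiam a c).tsum_le_tsum (fun n => ?_)
    ((summable_seqDist hdiam a b).add (summable_seqDist hdiam b c))
  rw [← mul_add]
  exact mul_le_mul_of_nonneg_left (dist_triangle _ _ _) (by positivity)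

theorem eq_of_seqDist_eq_zero (hdiam : ∀ y y' : Y, dist y y' ≤ 1) {a b : ℤ → Y}
    (h : seqDist a b = 0) : a = b := by
  funext n
  have h1 := (summable_seqDist hdiam a b).le_tsum n fun m _ => by positivity
  rw [← seqDist, h] at h1
  have h2 : 0 < (2 : ℝ)⁻¹ ^ n.natAbs := by positivity
  have h3 : dist (a n) (b n) ≤ 0 := by
    by_contra hcon
    exact absurd h1 (not_le.2 (mul_pos h2 (not_le.1 hcon)))
  exact dist_le_zero.1 h3

theorem seqDist_shiftBy_le (hdiam : ∀ y y' : Y, dist y y' ≤ 1) (j : ℤ) (a b : ℤ → Y) :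
    seqDist (shiftBy j a) (shiftBy j b) ≤ 2 ^ j.natAbs * seqDist a b := by
  have h1 : seqDist (shiftBy j a) (shiftBy j b) =
      ∑' m : ℤ, (2 : ℝ)⁻¹ ^ (m - j).natAbs * dist (a m) (b m) := by
    rw [seqDist, ← (Equiv.addRight j).tsum_eq
      fun m : ℤ => (2 : ℝ)⁻¹ ^ (m - j).natAbs * dist (a m) (b m)]
    simp [shiftBy]
  have hle : ∀ m : ℤ, (2 : ℝ)⁻¹ ^ (m - j).natAbs * dist (a m) (b m) ≤
      2 ^ j.natAbs * ((2 : ℝ)⁻¹ ^ m.natAbs * dist (a m) (b m)) := fun m => by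
    rw [← mul_assoc]
    refine mul_le_mul_of_nonneg_right ?_ dist_nonneg
    have h2 : m.natAbs ≤ (m - j).natAbs + j.natAbs := by omega
    have h3 : (2 : ℝ)⁻¹ ^ ((m - j).natAbs + j.natAbs) ≤ 2⁻¹ ^ m.natAbs :=
      pow_le_pow_of_le_one (by norm_num) (by norm_num) h2
    calc (2 : ℝ)⁻¹ ^ (m - j).natAbs
        = 2 ^ j.natAbs * (2 : ℝ)⁻¹ ^ ((m - j).natAbs + j.natAbs) := by
          rw [pow_add, inv_pow 2 j.natAbs]; field_simp
      _ ≤ _ := mul_le_mul_of_nonneg_left h3 (by positivity)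
  rw [h1, seqDist, ← tsum_mul_left]
  have hs := (summable_seqDist hdiam a b).mul_left (2 ^ j.natAbs)
  exact (hs.of_nonneg_of_le (fun m => by positivity) hle).tsum_le_tsum hle hs

/-- Truncated sequences approximate uniformly. -/
theorem eventually_seqDist_truncate_le (hdiam : ∀ y y' : Y, dist y y' ≤ 1) (y₀ : Y) {δ : ℝ}
    (hδ : 0 < δ) : ∀ᶠ N : ℕ in atTop, ∀ ω, seqDist ω (truncate y₀ N ω) ≤ δ := by
  have hlim : Tendsto (fun N : ℕ => ∑' n : ℤ, if n.natAbs ≤ N then 0 else (2 : ℝ)⁻¹ ^ n.natAbs)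
      atTop (𝓝 (∑' _n : ℤ, (0 : ℝ))) := by
    refine tendsto_tsum_of_dominated_convergence summable_inv_two_pow_natAbs (fun n => ?_)
      (Eventually.of_forall fun N n => ?_)
    · refine tendsto_const_nhds.congr' ?_
      filter_upwards [eventually_ge_atTop n.natAbs] with N hN
      simp [hN]
    · split_ifs
      · simp
      · simp
  rw [tsum_zero] at hlim
  filter_upwards [hlim.eventually_le_const hδ] with N hN ω
  refine le_trans ?_ hN
  refine (summable_seqDist hdiam _ _).tsum_le_tsum (fun n => ?_)
    (summable_inv_two_pow_natAbs.of_nonneg_of_le (fun n => ?_) fun n => ?_)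
  · by_cases hn : n.natAbs ≤ N
    · simp [truncate, hn]
    · simp only [hn, if_false]
      exact mul_le_of_le_one_right (by positivity) (hdiam _ _)
  · split_ifs
    · exact le_rfl
    · positivity
  · split_ifs
    · positivity
    · exact le_rfl

/-- A function that is Hölder on a set extends to a Hölder function. -/
theorem exists_holder_extension (hdiam : ∀ y y' : Y, dist y y' ≤ 1) {A : Set (ℤ → Y)}
    (hA : A.Nonempty) {V : (ℤ → Y) → ℝ} {C κ : ℝ} (hC : 0 ≤ C) (hκ : 0 < κ) (hκ1 : κ ≤ 1)
    (hV : ∀ a ∈ A, ∀ b ∈ A, |V a - V b| ≤ C * seqDist a b ^ κ) :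
    ∃ W : (ℤ → Y) → ℝ, (∀ a ∈ A, W a = V a) ∧ ∀ ω ω', |W ω - W ω'| ≤ C * seqDist ω ω' ^ κ := by
  have htri : ∀ a b c : ℤ → Y, C * seqDist a c ^ κ ≤ C * seqDist a b ^ κ + C * seqDist b c ^ κ := by
    intro a b c
    rw [← mul_add]
    refine mul_le_mul_of_nonneg_left ?_ hC
    exact (Real.rpow_le_rpow (seqDist_nonneg _ _) (seqDist_triangle hdiam a b c) hκ.le).trans
      (Real.rpow_add_le_add_rpow (seqDist_nonneg _ _) (seqDist_nonneg _ _) hκ.le hκ1)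
  have : Nonempty A := hA.to_subtype
  have hlow : ∀ (ω : ℤ → Y), ∀ b ∈ A, ∀ a : A,
      V b - C * seqDist ω b ^ κ ≤ V a.1 + C * seqDist ω a.1 ^ κ := by
    intro ω b hb a
    have h1 := (abs_le.1 (hV b hb a a.2)).2
    have h2 := htri b ω a
    rw [seqDist_comm b ω] at h2
    linarith
  have hbdd : ∀ ω, BddBelow (Set.range fun a : A => V a.1 + C * seqDist ω a.1 ^ κ) := fun ω => by
    obtain ⟨b, hb⟩ := hA
    refine ⟨V b - C * seqDist ω b ^ κ, ?_⟩
    rintro _ ⟨a, rfl⟩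
    exact hlow ω b hb a
  -- McShane's extension. It works because, for `κ ≤ 1`, the power `seqDist ^ κ` still satisfies the
  -- triangle inequality.
  refine ⟨fun ω => ⨅ a : A, V a.1 + C * seqDist ω a.1 ^ κ, fun a ha => le_antisymm ?_ ?_,
    fun ω ω' => ?_⟩
  · have := ciInf_le (hbdd a) ⟨a, ha⟩
    simpa [seqDist_self, Real.zero_rpow hκ.ne'] using this
  · refine le_ciInf fun b => ?_
    have := hlow a a ha b
    simpa [seqDist_self, Real.zero_rpow hκ.ne'] using this
  · have key : ∀ ω ω' : ℤ → Y, (⨅ a : A, V a.1 + C * seqDist ω a.1 ^ κ) ≤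
        (⨅ a : A, V a.1 + C * seqDist ω' a.1 ^ κ) + C * seqDist ω ω' ^ κ := fun ω ω' => by
      rw [← sub_le_iff_le_add]
      refine le_ciInf fun a => ?_
      have h1 := ciInf_le (hbdd ω) a
      have h2 := htri ω ω' a
      linarith
    rw [abs_le]
    have h1 := key ω ω'
    have h2 := key ω' ω
    rw [seqDist_comm ω' ω] at h2
    constructor <;> linarith

/-- Optimizing the number of steps. -/
theorem exists_steps {τ K κ : ℝ} (hτ0 : 0 < τ) (hτ1 : τ < 1) (hK : 1 ≤ K) (hκ : 0 < κ) :
    ∃ C κ' : ℝ, 0 < C ∧ 0 < κ' ∧ κ' ≤ 1 ∧ ∀ d : ℝ, 0 < d → d ≤ 1 → ∃ n : ℕ,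
      τ ^ n + K ^ n * d ^ κ ≤ C * d ^ κ' := by
  -- The base `K + 1` in place of `K` keeps the logarithm positive when `K = 1`.
  set L := Real.log (K + 1) with hL
  have hL0 : 0 < L := Real.log_pos (by linarith)
  have hlτ : Real.log τ < 0 := Real.log_neg hτ0 hτ1
  set s := κ / 2 * (-Real.log τ) / L with hs
  have hs0 : 0 < s := by
    have : 0 < -Real.log τ := by linarith
    positivity
  refine ⟨τ⁻¹ + 1, min 1 (min (κ / 2) s), by positivity, by positivity, min_le_left _ _,
    fun d hd hd1 => ?_⟩
  have hld : Real.log d ≤ 0 := Real.log_nonpos hd.le hd1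
  -- Chosen so that `(K + 1) ^ x = d ^ (-(κ / 2))`: the growing factor uses up half of the exponent
  -- of `d ^ κ`, and `τ ^ x` is still a positive power `d ^ s`.
  set x := κ / 2 * (-Real.log d) / L with hx
  have hx0 : 0 ≤ x := by
    have : 0 ≤ -Real.log d := by linarith
    positivity
  have hn1 : (⌊x⌋₊ : ℝ) ≤ x := Nat.floor_le hx0
  have hn2 : x - 1 ≤ (⌊x⌋₊ : ℝ) := by linarith [Nat.lt_floor_add_one x]
  have e1 : K ^ ⌊x⌋₊ * d ^ κ ≤ d ^ (κ / 2) := by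
    have h1 : K ^ ⌊x⌋₊ ≤ (K + 1) ^ x := by
      calc K ^ ⌊x⌋₊ ≤ (K + 1) ^ ⌊x⌋₊ := pow_le_pow_left₀ (by linarith) (by linarith) _
        _ = (K + 1) ^ (⌊x⌋₊ : ℝ) := (Real.rpow_natCast _ _).symm
        _ ≤ (K + 1) ^ x := Real.rpow_le_rpow_of_exponent_le (by linarith) hn1
    have h2 : (K + 1) ^ x = d ^ (-(κ / 2)) := by
      rw [Real.rpow_def_of_pos (by linarith), Real.rpow_def_of_pos hd, ← hL, hx]
      congr 1
      field_simp
    calc K ^ ⌊x⌋₊ * d ^ κ ≤ d ^ (-(κ / 2)) * d ^ κ :=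
          mul_le_mul_of_nonneg_right (h1.trans_eq h2) (Real.rpow_nonneg hd.le _)
      _ = d ^ (κ / 2) := by rw [← Real.rpow_add hd]; ring_nf
  have e2 : τ ^ ⌊x⌋₊ ≤ τ⁻¹ * d ^ s := by
    calc τ ^ ⌊x⌋₊ = τ ^ (⌊x⌋₊ : ℝ) := (Real.rpow_natCast _ _).symm
      _ ≤ τ ^ (x - 1) := Real.rpow_le_rpow_of_exponent_ge hτ0 hτ1.le hn2
      _ = τ⁻¹ * τ ^ x := by rw [Real.rpow_sub hτ0, Real.rpow_one]; field_simp
      _ = τ⁻¹ * d ^ s := by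
          congr 1
          rw [Real.rpow_def_of_pos hτ0, Real.rpow_def_of_pos hd, hx, hs]
          congr 1
          field_simp
  have e3 : d ^ (κ / 2) ≤ d ^ (min 1 (min (κ / 2) s)) :=
    Real.rpow_le_rpow_of_exponent_ge hd hd1 ((min_le_right _ _).trans (min_le_left _ _))
  have e4 : d ^ s ≤ d ^ (min 1 (min (κ / 2) s)) :=
    Real.rpow_le_rpow_of_exponent_ge hd hd1 ((min_le_right _ _).trans (min_le_right _ _))
  refine ⟨⌊x⌋₊, ?_⟩
  have e5 := mul_le_mul_of_nonneg_left e4 (inv_pos.2 hτ0).le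
  linarith

end SeqDist

/-! ### Concentration for functions approximated by functions of finitely many coordinates -/

section Concentration

/-- `V` is, up to null sets, a uniform limit of bounded functions of finitely many coordinates. -/
def HasLocalApprox {Y : Type*} [MeasurableSpace Y] (P : Measure (ℤ → Y)) (y₀ : Y)
    (V : (ℤ → Y) → ℝ) : Prop :=
  ∀ ε : ℝ, 0 < ε → ∃ (N : ℕ) (W : (ℤ → Y) → ℝ) (M : ℝ), Measurable W ∧
    (∀ ω, W (truncate y₀ N ω) = W ω) ∧ (∀ ω, |W ω| ≤ M) ∧ ∀ᵐ ω ∂P, |V ω - W ω| ≤ ε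

variable {Y : Type*} [MeasurableSpace Y] {P : Measure (ℤ → Y)} {y₀ : Y} {V : (ℤ → Y) → ℝ}

theorem HasLocalApprox.aemeasurable (hV : HasLocalApprox P y₀ V) : AEMeasurable V P := by
  choose N W M hW _ _ hVW using fun i : ℕ => hV (1 / ((i : ℝ) + 1)) (by positivity)
  refine aemeasurable_of_tendsto_metrizable_ae atTop (fun i => (hW i).aemeasurable) ?_
  filter_upwards [ae_all_iff.2 hVW] with ω hω
  refine tendsto_iff_dist_tendsto_zero.2 ?_
  refine squeeze_zero (fun _ => dist_nonneg) (fun i => ?_)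
    (tendsto_one_div_add_atTop_nhds_zero_nat (𝕜 := ℝ))
  rw [dist_comm, Real.dist_eq]
  exact hω i

theorem HasLocalApprox.integrable [IsFiniteMeasure P] (hV : HasLocalApprox P y₀ V) :
    Integrable V P := by
  obtain ⟨N, W, M, -, -, hM, hVW⟩ := hV 1 one_pos
  refine Integrable.of_bound hV.aemeasurable.aestronglyMeasurable (1 + M) ?_
  filter_upwards [hVW] with ω hω
  have h1 := hM ω
  rw [Real.norm_eq_abs]
  rw [abs_le] at *
  constructor <;> linarith

/-- Replacing `V` by an `ε / 4`-approximation moves the average and the mean by `ε / 4` each, which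
leaves a deviation of at least `ε / 2` for the local function. -/
theorem HasLocalApprox.polyConcentration {Ω₀ : Type*} [MeasurableSpace Ω₀]
    {P₀ : Measure Ω₀} [IsProbabilityMeasure P₀] {ζ : ℕ → Ω₀ → Y}
    [IsProbabilityMeasure P] (hstat : IsStationarySeq P₀ ζ)
    (hmix : IsStretchedExpMixing P₀ ζ) (hP : IsTwoSidedLaw P₀ ζ P)
    (hV : HasLocalApprox P y₀ V) {k : ℕ} (hk : 1 ≤ k) {β : ℝ} (hβ : 0 < β) :
    PolyConcentration P shift V k β := by
  refine ⟨hV.integrable, fun ε hε => ?_⟩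
  obtain ⟨N, W, M, hW, hloc, hM, hVW⟩ := hV (ε / 4) (by positivity)
  obtain ⟨d, hd⟩ := exists_measure_abs_birkhoff_sub_ge_le hstat hmix hP hW hloc hM hk
    (show 0 < ε / 2 by positivity) hβ
  have hWi : Integrable W P :=
    Integrable.of_bound hW.aestronglyMeasurable M (Eventually.of_forall hM)
  have hint : |∫ ω, V ω ∂P - ∫ ω, W ω ∂P| ≤ ε / 4 := by
    rw [← integral_sub hV.integrable hWi]
    simpa using norm_integral_le_of_norm_le_const (μ := P)
      (f := fun ω => V ω - W ω) (C := ε / 4) hVW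
  refine ⟨d, fun n hn => ?_⟩
  rw [← ENNReal.ofReal_toReal (measure_ne_top P _)]
  refine ENNReal.ofReal_le_ofReal (le_trans ?_ (hd n hn))
  refine ENNReal.toReal_mono (measure_ne_top P _) (measure_mono_ae ?_)
  have hall : ∀ᵐ ω ∂P, ∀ j : ℕ, |V (shift^[j * k] ω) - W (shift^[j * k] ω)| ≤ ε / 4 := by
    refine ae_all_iff.2 fun j => ?_
    have := (hP.measurePreserving_shiftBy hstat ((j * k : ℕ) : ℤ)).quasiMeasurePreserving.ae hVW
    filter_upwards [this] with ω hω
    rwa [iterate_shift]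
  filter_upwards [hall] with ω hω hmem
  have hmem : ε * n ≤ |∑ j ∈ Finset.range n, V (shift^[j * k] ω) - n * ∫ ω', V ω' ∂P| := hmem
  change ε / 2 * n ≤ |∑ j ∈ Finset.range n, W (shift^[j * k] ω) - n * ∫ ω', W ω' ∂P|
  have h1 : |∑ j ∈ Finset.range n, V (shift^[j * k] ω) -
      ∑ j ∈ Finset.range n, W (shift^[j * k] ω)| ≤ n * (ε / 4) := by
    rw [← Finset.sum_sub_distrib]
    refine (Finset.abs_sum_le_sum_abs _ _).trans ((Finset.sum_le_sum fun j _ => hω j).trans_eq ?_)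
    simp
  have h2 : |n * ∫ ω', V ω' ∂P - n * ∫ ω', W ω' ∂P| ≤ n * (ε / 4) := by
    rw [← mul_sub, abs_mul, Nat.abs_cast]
    exact mul_le_mul_of_nonneg_left hint n.cast_nonneg
  have h3 := abs_sub_abs_le_abs_sub
    (∑ j ∈ Finset.range n, V (shift^[j * k] ω) - n * ∫ ω', V ω' ∂P)
    (∑ j ∈ Finset.range n, W (shift^[j * k] ω) - n * ∫ ω', W ω' ∂P)
  have h4 : |∑ j ∈ Finset.range n, V (shift^[j * k] ω) - n * ∫ ω', V ω' ∂P -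
      (∑ j ∈ Finset.range n, W (shift^[j * k] ω) - n * ∫ ω', W ω' ∂P)| ≤
      n * (ε / 4) + n * (ε / 4) := by
    refine le_trans (le_of_eq ?_) ((abs_sub _ _).trans (add_le_add h1 h2))
    congr 1
    ring
  linarith

end Concentration

/-! ### Hölder continuous families -/

section Holder

variable {Y X : Type*} [MetricSpace Y] [MetricSpace X]

/-- The factor `A` is kept apart from `d` because shifting by `j` multiplies distances by up to `2 ^
|j|`. With `d ≤ 1` the two Hölder exponents can be replaced by their minimum, and with `A ≥ 1` a
power of `A` by `A`. -/
theorem exists_famClose_of_isHolderFamily {T : (ℤ → Y) → X → X} {u : (ℤ → Y) → X → ℝ} {α ξ : ℝ}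
    (hu : IsHolderFamily fun ω ω' => holderNorm α ξ (u ω - u ω'))
    (hT : IsHolderFamily fun ω ω' => ⨆ x, edist (T ω x) (T ω' x)) :
    ∃ H κ : ℝ, 1 ≤ H ∧ 0 < κ ∧ ∀ (ω ω' : ℤ → Y) (A d : ℝ), 1 ≤ A → 0 ≤ d → d ≤ 1 →
      seqDist ω ω' ≤ A * d → FamClose T u (H * A * d ^ κ) ω ω' := by
  obtain ⟨Cu, κu, hκu, hκu1, hu⟩ := hu
  obtain ⟨CT, κT, hκT, hκT1, hT⟩ := hT
  refine ⟨1 + |Cu| + |CT|, min κu κT, by linarith [abs_nonneg Cu, abs_nonneg CT],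
    lt_min hκu hκT, fun ω ω' A d hA hd0 hd1 hd x => ?_⟩
  have hdκ : 0 ≤ d ^ min κu κT := Real.rpow_nonneg hd0 _
  have hnn : 0 ≤ (1 + |Cu| + |CT|) * A * d ^ min κu κT := by positivity
  have hpow : ∀ B s : ℝ, |B| ≤ 1 + |Cu| + |CT| → 0 < s → s ≤ 1 → min κu κT ≤ s →
      B * seqDist ω ω' ^ s ≤ (1 + |Cu| + |CT|) * A * d ^ min κu κT := by
    intro B s hB hs hs1 hsm
    have h1 : seqDist ω ω' ^ s ≤ A * d ^ min κu κT := by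
      calc seqDist ω ω' ^ s ≤ (A * d) ^ s := Real.rpow_le_rpow (seqDist_nonneg _ _) hd hs.le
        _ = A ^ s * d ^ s := Real.mul_rpow (by linarith) hd0
        _ ≤ A * d ^ min κu κT := by
          refine mul_le_mul ?_ ?_ (Real.rpow_nonneg hd0 _) (by linarith)
          · simpa using Real.rpow_le_rpow_of_exponent_le hA hs1
          · rcases hd0.eq_or_lt with rfl | hd0
            · rw [Real.zero_rpow hs.ne']; exact hdκ
            · exact Real.rpow_le_rpow_of_exponent_ge hd0 hd1 hsm
    have h2 : 0 ≤ seqDist ω ω' ^ s := Real.rpow_nonneg (seqDist_nonneg _ _) _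
    calc B * seqDist ω ω' ^ s ≤ (1 + |Cu| + |CT|) * (A * d ^ min κu κT) :=
          mul_le_mul ((le_abs_self B).trans hB) h1 h2 (by positivity)
      _ = _ := by ring
  constructor
  · have h1 : edist (T ω x) (T ω' x) ≤ ENNReal.ofReal (CT * seqDist ω ω' ^ κT) :=
      (le_iSup (fun x => edist (T ω x) (T ω' x)) x).trans (hT ω ω')
    rw [edist_dist] at h1
    exact (ENNReal.ofReal_le_ofReal_iff hnn).1 (h1.trans (ENNReal.ofReal_le_ofReal
      (hpow CT κT (by linarith [abs_nonneg Cu]) hκT hκT1 (min_le_right _ _))))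
  · have h1 := norm_le_of_holderNorm_le (hu ω ω') x
    rw [Real.enorm_eq_ofReal_abs] at h1
    exact (ENNReal.ofReal_le_ofReal_iff hnn).1 (h1.trans (ENNReal.ofReal_le_ofReal
      (hpow Cu κu (by linarith [abs_nonneg CT]) hκu hκu1 (min_le_left _ _))))

theorem eventually_famClose_truncate_of_isHolderFamily (hdiam : ∀ y y' : Y, dist y y' ≤ 1)
    {T : (ℤ → Y) → X → X} {u : (ℤ → Y) → X → ℝ} {α ξ : ℝ}
    (hu : IsHolderFamily fun ω ω' => holderNorm α ξ (u ω - u ω'))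
    (hT : IsHolderFamily fun ω ω' => ⨆ x, edist (T ω x) (T ω' x)) (y₀ : Y) {δ : ℝ} (hδ : 0 < δ)
    (j : ℤ) : ∀ᶠ N : ℕ in atTop, ∀ ω,
      FamClose T u δ (shiftBy j ω) (shiftBy j (truncate y₀ N ω)) := by
  obtain ⟨H, κ, hH, hκ, hclose⟩ := exists_famClose_of_isHolderFamily hu hT
  have hlim : Tendsto (fun d : ℝ => H * 2 ^ j.natAbs * d ^ κ) (𝓝[>] 0) (𝓝 0) := by
    have : ContinuousAt (fun d : ℝ => H * 2 ^ j.natAbs * d ^ κ) 0 :=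
      continuousAt_const.mul (Real.continuousAt_rpow_const _ _ (Or.inr hκ.le))
    have h0 := this.tendsto
    simp only [Real.zero_rpow hκ.ne', mul_zero] at h0
    exact h0.mono_left nhdsWithin_le_nhds
  obtain ⟨d, hdδ, hd0, hd1⟩ := ((hlim.eventually_lt_const hδ).and
    (Ioc_mem_nhdsGT (zero_lt_one (α := ℝ)))).exists
  filter_upwards [eventually_seqDist_truncate_le hdiam y₀ hd0] with N hN ω x
  have h1 := seqDist_shiftBy_le hdiam j ω (truncate y₀ N ω)
  have h2 := hclose _ _ (2 ^ j.natAbs) d (one_le_pow₀ one_le_two) hd0.le hd1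
    (h1.trans (mul_le_mul_of_nonneg_left (hN ω) (by positivity))) x
  exact ⟨h2.1.trans hdδ.le, h2.2.trans hdδ.le⟩

theorem eventually_famClose_truncate_of_dependsOn {Y : Type*} {T : (ℤ → Y) → X → X}
    {u : (ℤ → Y) → X → ℝ} {J : Finset ℤ} (hu : DependsOn u (J : Set ℤ))
    (hT : DependsOn T (J : Set ℤ)) (y₀ : Y) {δ : ℝ} (hδ : 0 < δ) (j : ℤ) :
    ∀ᶠ N : ℕ in atTop, ∀ ω, FamClose T u δ (shiftBy j ω) (shiftBy j (truncate y₀ N ω)) := by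
  filter_upwards [eventually_ge_atTop (J.sup fun i => (i + j).natAbs)] with N hN ω x
  have heq : ∀ i ∈ (J : Set ℤ), shiftBy j ω i = shiftBy j (truncate y₀ N ω) i := fun i hi => by
    have : (i + j).natAbs ≤ N :=
      (Finset.le_sup (f := fun i : ℤ => (i + j).natAbs) (Finset.mem_coe.1 hi)).trans hN
    simp [shiftBy, truncate, this]
  rw [hT heq, hu heq]
  simp [hδ.le]

variable [MeasurableSpace X] [BorelSpace X]
variable (p : Params) (T : (ℤ → Y) → X → X) (φ u : (ℤ → Y) → X → ℝ) (lam : (ℤ → Y) → ℝ)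
  (h : (ℤ → Y) → X → ℝ) (ν : (ℤ → Y) → Measure X) (μ : Measure X) (r : (ℤ → Y) → X → ℝ)

/-- At times `-n, …, k` the shifted sequences are at distance at most `2 ^ (n + k) * d`. The growth
`2 ^ n` joins `K ^ n`, so the number of steps is balanced with base `2 * K`. For `d > 1` the uniform
bound on `tildeV` suffices. -/
theorem exists_tildeV_sub_le_seqDist [IsFiniteMeasure μ] (hμ : μ ≠ 0)
    (hdiam : ∀ y y' : Y, dist y y' ≤ 1) (hα1 : p.α ≤ 1) {α ξ : ℝ}
    (hu : IsHolderFamily fun ω ω' => holderNorm α ξ (u ω - u ω'))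
    (hT : IsHolderFamily fun ω ω' => ⨆ x, edist (T ω x) (T ω' x)) (k : ℕ) :
    ∃ C κ : ℝ, 0 ≤ C ∧ 0 < κ ∧ κ ≤ 1 ∧ ∀ ω ω', IsTypicalOrbit p T φ u lam h ν μ r ω →
      IsTypicalOrbit p T φ u lam h ν μ r ω' →
      |tildeV shift T u h ν μ k ω - tildeV shift T u h ν μ k ω'| ≤ C * seqDist ω ω' ^ κ := by
  obtain ⟨H, κ, hH, hκ, hclose⟩ := exists_famClose_of_isHolderFamily hu hT
  obtain ⟨C, K, τ, hC, hK, hτ0, hτ1, hbd, hsub⟩ :=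
    exists_tildeV_sub_le p T φ u lam h ν μ r hμ k
  have hα := p.alpha_pos
  obtain ⟨C₁, κ₁, hC₁, hκ₁, hκ₁1, hsteps⟩ := exists_steps hτ0 hτ1
    (show 1 ≤ 2 * K by linarith) (show 0 < κ * (p.α / 2) by positivity)
  have hQ : 1 ≤ 2 * H * 2 ^ k := by
    have : (1 : ℝ) ≤ 2 ^ k := one_le_pow₀ one_le_two
    nlinarith
  refine ⟨2 * C + C * (2 * H * 2 ^ k) * C₁, κ₁, by positivity, hκ₁, hκ₁1, fun ω ω' hω hω' => ?_⟩
  set d := seqDist ω ω' with hd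
  have hdκ : 0 ≤ d ^ κ₁ := Real.rpow_nonneg (seqDist_nonneg _ _) _
  rcases (seqDist_nonneg ω ω').eq_or_lt with hd0 | hd0
  · rw [eq_of_seqDist_eq_zero hdiam hd0.symm, sub_self, abs_zero]
    positivity
  rcases le_or_gt d 1 with hd1 | hd1
  · obtain ⟨n, hn⟩ := hsteps d hd0 hd1
    set e := H * 2 ^ (n + k) * d ^ κ with he
    have he0 : 0 ≤ e := by positivity
    have hfam : ∀ j : ℤ, -n ≤ j → j ≤ k → FamClose T u e (shiftBy j ω) (shiftBy j ω') := by
      intro j hj1 hj2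
      refine hclose _ _ (2 ^ (n + k)) d (one_le_pow₀ one_le_two) hd0.le hd1
        ((seqDist_shiftBy_le hdiam j ω ω').trans ?_)
      exact mul_le_mul_of_nonneg_right (pow_le_pow_right₀ one_le_two (by omega)) hd0.le
    have hH1 : 1 ≤ H * 2 ^ (n + k) := by
      have : (1 : ℝ) ≤ 2 ^ (n + k) := one_le_pow₀ one_le_two
      nlinarith
    have e1 : e ≤ H * 2 ^ (n + k) * d ^ (κ * (p.α / 2)) :=
      mul_le_mul_of_nonneg_left
        (Real.rpow_le_rpow_of_exponent_ge hd0 hd1 (by nlinarith)) (by positivity)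
    have e2 : e ^ (p.α / 2) ≤ H * 2 ^ (n + k) * d ^ (κ * (p.α / 2)) := by
      rw [he, Real.mul_rpow (by positivity) (by positivity), ← Real.rpow_mul hd0.le]
      refine mul_le_mul_of_nonneg_right ?_ (by positivity)
      simpa using Real.rpow_le_rpow_of_exponent_le hH1 (show p.α / 2 ≤ 1 by linarith)
    have hKn : 0 < K ^ n := by positivity
    have hτn : 0 < τ ^ n := by positivity
    refine (hsub ω ω' hω hω' n e he0 hfam).trans ?_
    calc C * (τ ^ n + K ^ n * (e + e ^ (p.α / 2)))
        ≤ C * ((2 * H * 2 ^ k) * (τ ^ n + (2 * K) ^ n * d ^ (κ * (p.α / 2)))) := by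
          refine mul_le_mul_of_nonneg_left ?_ hC.le
          have t1 : τ ^ n ≤ (2 * H * 2 ^ k) * τ ^ n := le_mul_of_one_le_left hτn.le hQ
          have t2 := mul_le_mul_of_nonneg_left (add_le_add e1 e2) hKn.le
          have t3 : K ^ n * (H * 2 ^ (n + k) * d ^ (κ * (p.α / 2)) +
              H * 2 ^ (n + k) * d ^ (κ * (p.α / 2))) =
              (2 * H * 2 ^ k) * ((2 * K) ^ n * d ^ (κ * (p.α / 2))) := by
            rw [mul_pow, pow_add]; ring
          linarith
      _ ≤ C * ((2 * H * 2 ^ k) * (C₁ * d ^ κ₁)) := by gcongr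
      _ ≤ _ := by
          have : 0 ≤ 2 * C * d ^ κ₁ := by positivity
          linarith
  · have h1 := hbd ω hω
    have h2 := hbd ω' hω'
    have h3 : 1 ≤ d ^ κ₁ := Real.one_le_rpow hd1.le hκ₁.le
    refine (abs_sub _ _).trans ?_
    have h4 : 0 ≤ C * (2 * H * 2 ^ k) * C₁ * d ^ κ₁ := by positivity
    nlinarith

end Holder

/-! ### Approximation by functions of finitely many coordinates -/

section LocalApprox

theorem exists_seq_dist_lt {S M : Type*} [Nonempty S] [PseudoMetricSpace M]
    [SecondCountableTopology M] (f : S → M) :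
    ∃ a : ℕ → S, ∀ s, ∀ e > 0, ∃ i, dist (f s) (f (a i)) < e := by
  have hne : Nonempty (Set.range f) := (Set.range_nonempty f).to_subtype
  obtain ⟨b, hb⟩ := TopologicalSpace.exists_dense_seq (Set.range f)
  choose a ha using fun i => (b i).2
  refine ⟨a, fun s e he => ?_⟩
  obtain ⟨i, hi⟩ := hb.exists_dist_lt ⟨f s, s, rfl⟩ he
  refine ⟨i, ?_⟩
  rw [ha i]
  exact hi

theorem truncate_truncate {Y : Type*} (y₀ : Y) (N : ℕ) (ω : ℤ → Y) :
    truncate y₀ N (truncate y₀ N ω) = truncate y₀ N ω := by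
  funext i
  by_cases hi : i.natAbs ≤ N <;> simp [truncate, hi]

variable {Y X : Type*} [MeasurableSpace Y] [MetricSpace X] [CompactSpace X] [MeasurableSpace X]
  [BorelSpace X]
variable (p : Params) (T : (ℤ → Y) → X → X) (φ u : (ℤ → Y) → X → ℝ) (lam : (ℤ → Y) → ℝ)
  (h : (ℤ → Y) → X → ℝ) (ν : (ℤ → Y) → Measure X) (μ : Measure X) (r : (ℤ → Y) → X → ℝ)

/-- A truncated sequence need not be typical, so `tildeV` cannot be evaluated there. Instead the
truncation selects, measurably, one of countably many typical points with nearby maps and functions,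
and the value of `tildeV` at that point is used. -/
theorem hasLocalApprox_tildeV [IsFiniteMeasure μ] (hμ : μ ≠ 0) {P : Measure (ℤ → Y)} [NeZero P]
    (hTm : ∀ x, Measurable fun ω => T ω x) (hum : ∀ x, Measurable fun ω => u ω x)
    (hP : ∀ᵐ ω ∂P, IsTypicalOrbit p T φ u lam h ν μ r ω) {y₀ : Y}
    (hloc : ∀ δ : ℝ, 0 < δ → ∀ j : ℤ, ∀ᶠ N : ℕ in atTop, ∀ ω,
      FamClose T u δ (shiftBy j ω) (shiftBy j (truncate y₀ N ω))) (k : ℕ) :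
    HasLocalApprox P y₀ (tildeV shift T u h ν μ k) := by
  classical
  intro ε hε
  obtain ⟨C, K, τ, hC, hK, hτ0, hτ1, hbd, hsub⟩ :=
    exists_tildeV_sub_le p T φ u lam h ν μ r hμ k
  have hα := p.alpha_pos
  obtain ⟨n, hn⟩ := exists_pow_lt_of_lt_one (show 0 < ε / (2 * C) by positivity) hτ1
  have hlim : Tendsto (fun e : ℝ => K ^ n * (e + e ^ (p.α / 2))) (𝓝[>] 0) (𝓝 0) := by
    have : ContinuousAt (fun e : ℝ => K ^ n * (e + e ^ (p.α / 2))) 0 :=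
      continuousAt_const.mul (continuousAt_id.add
        (Real.continuousAt_rpow_const _ _ (Or.inr (by positivity))))
    have h0 := this.tendsto
    simp only [Real.zero_rpow (half_pos hα).ne', add_zero, mul_zero] at h0
    exact h0.mono_left nhdsWithin_le_nhds
  obtain ⟨e, he, he0⟩ := ((hlim.eventually_lt_const (show 0 < ε / (2 * C) by positivity)).and
    self_mem_nhdsWithin).exists
  have he0 : 0 < e := he0
  have hfinal : C * (τ ^ n + K ^ n * (e + e ^ (p.α / 2))) ≤ ε := by
    have h1 : τ ^ n + K ^ n * (e + e ^ (p.α / 2)) ≤ ε / C := by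
      have : ε / C = ε / (2 * C) + ε / (2 * C) := by field_simp; norm_num
      linarith
    calc _ ≤ C * (ε / C) := mul_le_mul_of_nonneg_left h1 hC.le
      _ = ε := by field_simp
  set I : Finset ℤ := Finset.Icc (-n) k with hI
  -- The budget: `e / 4` for truncation and `e / 4` for the countable net put the truncation into
  -- some `E i`; afterwards `e / 2` and again `e / 4` stay below `e`.
  obtain ⟨N, hN⟩ := ((Finset.eventually_all I).2 fun j _ =>
    hloc (e / 4) (by positivity) j).exists
  obtain ⟨ω₀, hω₀⟩ := hP.exists
  have : Nonempty X := by
    have := hω₀.self.nu_prob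
    exact (ν ω₀).nonempty_of_neZero
  let S := {ω // IsTypicalOrbit p T φ u lam h ν μ r ω}
  have : Nonempty S := ⟨⟨ω₀, hω₀⟩⟩
  have hcont : ∀ ω, IsTypical p T φ u lam h ν μ r ω → Continuous (u ω) := fun ω hω =>
    hω.holder_u.locHolder.continuous p.alpha_pos p.xi_pos
  -- On compact `X` these spaces of continuous maps are separable in the uniform metric, so
  -- countably many typical points suffice.
  let Φ : S → I → C(X, X) × C(X, ℝ) := fun s j =>
    (⟨T (shiftBy j s.1), (s.2 j).continuous_map⟩, ⟨u (shiftBy j s.1), hcont _ (s.2 j)⟩)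
  obtain ⟨a, ha⟩ := exists_seq_dist_lt Φ
  obtain ⟨x, hx⟩ := TopologicalSpace.exists_dense_seq X
  -- Testing only at a countable dense set of points makes `E i` measurable; continuity at the
  -- typical points restores uniform closeness at the end.
  let E : ℕ → Set (ℤ → Y) := fun i => {η | ∀ j ∈ I, ∀ m,
    dist (T (shiftBy j η) (x m)) (T (shiftBy j (a i).1) (x m)) ≤ e / 2 ∧
      |u (shiftBy j η) (x m) - u (shiftBy j (a i).1) (x m)| ≤ e / 2}
  have hE : ∀ i, MeasurableSet (E i) := by
    intro i
    have : E i = ⋂ j ∈ I, ⋂ m,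
        ({η | dist (T (shiftBy j η) (x m)) (T (shiftBy j (a i).1) (x m)) ≤ e / 2} ∩
        {η | |u (shiftBy j η) (x m) - u (shiftBy j (a i).1) (x m)| ≤ e / 2}) := by
      ext η
      simp [E]
    rw [this]
    refine Finset.measurableSet_biInter _ fun j _ => MeasurableSet.iInter fun m =>
      MeasurableSet.inter ?_ ?_
    · exact measurableSet_le (((hTm (x m)).comp (measurable_shiftBy j)).dist measurable_const)
        measurable_const
    · exact measurableSet_le (((hum (x m)).comp (measurable_shiftBy j)).sub_const _).abs
        measurable_const
  -- The second alternative gives the search for a least index a value at every `η`; truncations of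
  -- typical sequences never fall into it.
  have hex : ∀ η, ∃ i, η ∈ E i ∨ ∀ i, η ∉ E i := fun η => by
    by_cases hη : ∃ i, η ∈ E i
    · exact hη.imp fun i hi => Or.inl hi
    · exact ⟨0, Or.inr (not_exists.1 hη)⟩
  have hfind : Measurable fun η => Nat.find (hex η) := by
    refine measurable_find hex fun i => ?_
    have : {η | η ∈ E i ∨ ∀ i, η ∉ E i} = E i ∪ ⋂ i, (E i)ᶜ := by ext η; simp
    rw [this]
    exact (hE i).union (MeasurableSet.iInter fun i => (hE i).compl)
  refine ⟨N, fun ω => tildeV shift T u h ν μ k (a (Nat.find (hex (truncate y₀ N ω)))).1, C, ?_,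
    fun ω => by simp only [truncate_truncate], fun ω => hbd _ (a _).2, ?_⟩
  · exact (Measurable.of_discrete (f := fun i : ℕ => tildeV shift T u h ν μ k (a i).1)).comp
      (hfind.comp (measurable_truncate y₀ N))
  filter_upwards [hP] with ω hω
  set η := truncate y₀ N ω with hη
  have hmem : ∃ i, η ∈ E i := by
    obtain ⟨i, hi⟩ := ha ⟨ω, hω⟩ (e / 4) (by positivity)
    refine ⟨i, fun j hj m => ?_⟩
    have h1 := hN j hj ω (x m)
    rw [← hη] at h1
    have h2 := (dist_le_pi_dist (Φ ⟨ω, hω⟩) (Φ (a i)) ⟨j, hj⟩).trans hi.le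
    rw [Prod.dist_eq, max_le_iff] at h2
    have h3 := (ContinuousMap.dist_apply_le_dist (x m)).trans h2.1
    have h4 := (ContinuousMap.dist_apply_le_dist (x m)).trans h2.2
    simp only [Φ, ContinuousMap.coe_mk, Real.dist_eq] at h3 h4
    constructor
    · have := dist_triangle_left (T (shiftBy j η) (x m)) (T (shiftBy j (a i).1) (x m))
        (T (shiftBy j ω) (x m))
      linarith
    · have := h1.2
      rw [abs_le] at *
      constructor <;> linarith
  have hsel : η ∈ E (Nat.find (hex η)) :=
    (Nat.find_spec (hex η)).resolve_right fun hno => hno _ hmem.choose_spec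
  refine (hsub ω _ hω (a _).2 n e he0.le fun j hj1 hj2 => ?_).trans hfinal
  have hj : j ∈ I := Finset.mem_Icc.2 ⟨hj1, hj2⟩
  set b := a (Nat.find (hex η)) with hb
  have hclosed : IsClosed {z | dist (T (shiftBy j ω) z) (T (shiftBy j b.1) z) ≤ e ∧
      |u (shiftBy j ω) z - u (shiftBy j b.1) z| ≤ e} := by
    have c1 := (hω j).continuous_map
    have c2 := (b.2 j).continuous_map
    have c3 := hcont _ (hω j)
    have c4 := hcont _ (b.2 j)
    exact (isClosed_le (c1.dist c2) continuous_const).inter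
      (isClosed_le (c3.sub c4).abs continuous_const)
  intro z
  have hsubset : Set.range x ⊆ {z | dist (T (shiftBy j ω) z) (T (shiftBy j b.1) z) ≤ e ∧
      |u (shiftBy j ω) z - u (shiftBy j b.1) z| ≤ e} := by
    rintro _ ⟨m, rfl⟩
    have h1 := hN j hj ω (x m)
    rw [← hη] at h1
    have h2 := hsel j hj m
    constructor
    · have := dist_triangle (T (shiftBy j ω) (x m)) (T (shiftBy j η) (x m))
        (T (shiftBy j b.1) (x m))
      linarith [h1.1, h2.1]
    · have h3 := h1.2
      have h4 := h2.2
      rw [abs_le] at *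
      constructor <;> linarith
  exact hclosed.closure_subset_iff.2 hsubset (hx z)

end LocalApprox

end RandomSkew

theorem mainTheorem10
    {Ω₀ Y X : Type*} [MeasurableSpace Ω₀]
    [MetricSpace Y] [MeasurableSpace Y] [BorelSpace Y]
    [MetricSpace X] [CompactSpace X] [MeasurableSpace X] [BorelSpace X]
    -- the stationary process and its two-sided shift
    (P₀ : Measure Ω₀) [IsProbabilityMeasure P₀] (ζ : ℕ → Ω₀ → Y)
    (hdiam : ∀ y y' : Y, dist y y' ≤ 1)
    (hstat : RandomSkew.IsStationarySeq P₀ ζ)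
    (hmix : RandomSkew.IsStretchedExpMixing P₀ ζ)
    (P : Measure (ℤ → Y)) [IsProbabilityMeasure P]
    (hP : RandomSkew.IsTwoSidedLaw P₀ ζ P)
    -- the random maps and functions, and their Gibbs measures
    (T : (ℤ → Y) → X → X) (φ u : (ℤ → Y) → X → ℝ) (α ξ : ℝ)
    (hsys : RandomSkew.IsExpandingSystem P RandomSkew.shift T φ u α ξ)
    (lam : (ℤ → Y) → ℝ) (h : (ℤ → Y) → X → ℝ) (ν : (ℤ → Y) → Measure X)
    (hRPF : RandomSkew.IsRPFTriplet P RandomSkew.shift T φ u α ξ lam h ν)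
    (μ : Measure X) (hμ : RandomSkew.HasCommonReference P α ξ h ν μ) :
    -- (i)
    (RandomSkew.IsHolderFamily (fun ω ω' => RandomSkew.holderNorm α ξ (u ω - u ω')) →
      RandomSkew.IsHolderFamily (fun ω ω' => ⨆ x, edist (T ω x) (T ω' x)) →
      (∀ s : ℝ, 0 < s → s ≤ 1 → RandomSkew.UniformlyHolderMaps T s →
        (s = 1 ∨ RandomSkew.IsHolderAE P (RandomSkew.gibbsMean u h ν)) →
        ∀ k : ℕ, 1 ≤ k →
          RandomSkew.IsHolderAE P (RandomSkew.tildeV RandomSkew.shift T u h ν μ k)) ∧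
      ∀ β : ℝ, 0 < β → ∀ k : ℕ, 1 ≤ k →
        RandomSkew.PolyConcentration P RandomSkew.shift
          (RandomSkew.tildeV RandomSkew.shift T u h ν μ k) k β) ∧
    -- (ii)
    (∀ J : Finset ℤ, DependsOn u (J : Set ℤ) → DependsOn T (J : Set ℤ) →
      ∀ β : ℝ, 0 < β → ∀ k : ℕ, 1 ≤ k →
        RandomSkew.PolyConcentration P RandomSkew.shift
          (RandomSkew.tildeV RandomSkew.shift T u h ν μ k) k β) := by
  have hmp := fun m : ℤ => hP.measurePreserving_shiftBy hstat m
  obtain ⟨p, r, hpα, -, htyp⟩ := RandomSkew.exists_isTypical hmp hsys hRPF hμ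
  have htyp : ∀ᵐ ω ∂P, RandomSkew.IsTypicalOrbit p T φ u lam h ν μ r ω := htyp
  obtain ⟨ω₀, hω₀⟩ := htyp.exists
  have := hω₀.self.isFiniteMeasure
  have hμ0 := hω₀.self.measure_ne_zero
  have hTm : ∀ x, Measurable fun ω => T ω x := fun x =>
    hsys.measurable_map.comp measurable_prodMk_right
  have hum : ∀ x, Measurable fun ω => u ω x := fun x =>
    hsys.measurable_u.comp measurable_prodMk_right
  refine ⟨fun hu hT => ⟨fun _ _ _ _ _ k _ => ?_, fun β hβ k hk => ?_⟩,
    fun J hu hT β hβ k hk => ?_⟩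
  · obtain ⟨C, κ, hC, hκ, hκ1, hV⟩ := RandomSkew.exists_tildeV_sub_le_seqDist p T φ u lam h ν μ r
      hμ0 hdiam (hpα.le.trans hsys.alpha_le_one) hu hT k
    -- The Hölder bound holds between any two typical points, a set of full measure; the extension
    -- is the required almost sure version.
    obtain ⟨W, hWV, hW⟩ := RandomSkew.exists_holder_extension hdiam
      (A := {ω | RandomSkew.IsTypicalOrbit p T φ u lam h ν μ r ω}) ⟨ω₀, hω₀⟩ hC hκ hκ1
      fun a ha b hb => hV a b ha hb
    refine ⟨W, ⟨C, κ, hκ, hκ1, fun ω ω' => ?_⟩, ?_⟩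
    · change edist (W ω) (W ω') ≤ _
      rw [edist_dist, Real.dist_eq]
      exact ENNReal.ofReal_le_ofReal (hW ω ω')
    · filter_upwards [htyp] with ω hω
      exact (hWV ω hω).symm
  -- Any symbol can fill the truncated coordinates; `ω₀ 0` is one that is known to exist.
  · exact (RandomSkew.hasLocalApprox_tildeV p T φ u lam h ν μ r hμ0 hTm hum htyp (y₀ := ω₀ 0)
      (fun δ hδ j => RandomSkew.eventually_famClose_truncate_of_isHolderFamily hdiam hu hT
        (ω₀ 0) hδ j) k).polyConcentration hstat hmix hP hk hβ
  · exact (RandomSkew.hasLocalApprox_tildeV p T φ u lam h ν μ r hμ0 hTm hum htyp (y₀ := ω₀ 0)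
      (fun δ hδ j => RandomSkew.eventually_famClose_truncate_of_dependsOn hu hT
        (ω₀ 0) hδ j) k).polyConcentration hstat hmix hP hk hβ
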